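/- **Theorem 1.2.** Let $\mathbf{k}$ be an algebraically closed field, and let $\widehat{\Lambda}_1=\mathbf{k}\widehat{Q}/\langle\widehat{\rho}\rangle$ be the repetitive algebra of the $2$-Kronecker algebra: $\widehat{Q}$ is the quiver with vertices $1_z,2_z$ and arrows $\alpha_z,\beta_z:1_z\to 2_z$ and $\alpha^\ast_z,\beta^\ast_z:2_z\to 1_{z-1}$ $(z\in\mathbb{Z})$, and the relations are $$\alpha^\ast_z\alpha_z=\beta^\ast_z\beta_z,\quad \alpha_{z-1}\alpha^\ast_z=\beta_{z-1}\beta^\ast_z,\quad \alpha^\ast_z\beta_z=\beta^\ast_z\alpha_z=0,\quad \alpha_{z-1}\beta^\ast_z=\beta_{z-1}\alpha^\ast_z=0 \qquad (z\in\mathbb{Z}).$$ Modules are finite dimensional left $\widehat{\Lambda}_1$-modules, i.e. finite dimensional representations of this quiver with relations. For a module $\widehat{V}$ let $\underline{\mathrm{End}}_{\widehat{\Lambda}_1}(\widehat{V})$ be the quotient of $\mathrm{End}_{\widehat{\Lambda}_1}(\widehat{V})$ by the ideal of endomorphisms that factor through a finite dimensional projective module. For a string $C$ (a finite reduced walk in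 arrows and inverse arrows, possibly of length $0$, such that neither it nor its inverse contains a path occurring in one of the relations), let $\widehat{M}[C]$ be the corresponding string module. Let $\Gamma_S(\widehat{\Lambda}_1)$ be the stable Auslander–Reiten quiver: its vertices are the isomorphism classes of indecomposable non-projective modules, and its arrows are given by irreducible morphisms. Let $\widehat{\mathcal{C}}$ be the category of complete local commutative Noetherian $\mathbf{k}$-algebras with residue field $\mathbf{k}$, with the continuous $\mathbf{k}$-algebra homomorphisms inducing the identity on $\mathbf{k}$. For $R$ in $\widehat{\mathcal{C}}$, a lift of $\widehat{V}$ over $R$ is a finitely generated $R\otimes_{\mathbf{k}}\widehat{\Lambda}_1$-module $\widehat{M}$ that is free over $R$, together with an isomorphism $\widehat{\phi}:\mathbf{k}\otimes_R\widehat{M}\to\widehat{V}$ of $\widehat{\Lambda}_1$-modules; lifts $(\widehat M,\widehat\phi)$ and $(\widehat M',\widehat\phi')$ are isomorphic if there is an isomorphism $\widehat{\alpha}:\widehat{M}\to\widehat{M}'$ of $R\otimes_{\mathbf{k}}\widehat{\Lambda}_1$-modules with $\widehat{\phi}'\circ(\mathrm{id}_{\mathbf{k}}\otimes\widehat{\alpha})=\widehat{\phi}$;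 and $\mathrm{Def}(\widehat{V},R)$ is the set of isomorphism classes of lifts. The versal deformation ring $R(\widehat{\Lambda}_1,\widehat{V})$ is the object $R$ of $\widehat{\mathcal{C}}$, unique up to isomorphism, over which there is a lift $U$ of $\widehat{V}$ such that $\mathrm{Hom}_{\widehat{\mathcal{C}}}(R,A)\to\mathrm{Def}(\widehat{V},A)$, $\theta\mapsto[A\otimes_{R,\theta}U]$, is surjective for all $A$ in $\widehat{\mathcal{C}}$ and bijective for $A=\mathbf{k}[\epsilon]$, $\epsilon^2=0$. Let $\widehat{V}$ be a finite dimensional string $\widehat{\Lambda}_1$-module. Then $\underline{\mathrm{End}}_{\widehat{\Lambda}_1}(\widehat{V})\cong\mathbf{k}$ as $\mathbf{k}$-algebras if and only if 1. $\widehat{V}$ belongs to a connected component of $\Gamma_S(\widehat{\Lambda}_1)$ containing a simple $\widehat{\Lambda}_1$-module, or 2. $\widehat{V}\cong\widehat{M}[C]$ where $C$ is an arrow of $\widehat{Q}$. In case 1, $R(\widehat{\Lambda}_1,\widehat{V})$ exists and is isomorphic to $\mathbf{k}$; in case 2, $R(\widehat{\Lambda}_1,\widehat{V})$ exists and is isomorphic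 to $\mathbf{k}[\![t]\!]$ (as $\mathbf{k}$-algebras). -/

import Mathlib

/-!
Finite dimensional modules over the repetitive algebra of the `2`-Kronecker algebra, realised as
representations of its quiver with relations, together with string modules, stable endomorphism
algebras, stable Auslander-Reiten components and versal deformation rings.
-/

universe u

namespace KronRep

open scoped TensorProduct

/-! ### The bound quiver -/

/-- The vertices `1_z` and `2_z`, `z ∈ ℤ`. -/
inductive Vertex : Type
  | one (z : ℤ)
  | two (z : ℤ)

/-- The arrows `α_z, β_z : 1_z → 2_z` and `α*_z, β*_z : 2_z → 1_{z-1}`, `z ∈ ℤ`. -/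
inductive Arrow : Type
  | α (z : ℤ)
  | β (z : ℤ)
  | αs (z : ℤ)
  | βs (z : ℤ)

/-- The source of an arrow. -/
@[reducible] def Arrow.src : Arrow → Vertex
  | .α z => .one z
  | .β z => .one z
  | .αs z => .two z
  | .βs z => .two z

/-- The target of an arrow. -/
@[reducible] def Arrow.tgt : Arrow → Vertex
  | .α z => .two z
  | .β z => .two z
  | .αs z => .one (z - 1)
  | .βs z => .one (z - 1)

/-- A representation over the commutative ring `R` of the quiver with relations of the repetitive
algebra `Λ̂` of the `2`-Kronecker algebra; for a `k`-algebra `R` these are the (unitary) modules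
over `R ⊗ Λ̂`. The relations are
`α*_z α_z = β*_z β_z`, `α_{z-1} α*_z = β_{z-1} β*_z` (commutativity relations) and
`α*_z β_z = 0`, `β*_z α_z = 0`, `α_{z-1} β*_z = 0`, `β_{z-1} α*_z = 0` (zero relations). -/
structure Rep (R : Type u) [CommRing R] : Type (u + 1) where
  obj : Vertex → Type u
  [grp : ∀ v, AddCommGroup (obj v)]
  [mod : ∀ v, Module R (obj v)]
  map : ∀ a : Arrow, obj a.src →ₗ[R] obj a.tgt
  comm_one : ∀ z, map (.αs z) ∘ₗ map (.α z) = map (.βs z) ∘ₗ map (.β z)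
  comm_two : ∀ z, map (.α (z - 1)) ∘ₗ map (.αs z) = map (.β (z - 1)) ∘ₗ map (.βs z)
  zero_one : ∀ z, map (.αs z) ∘ₗ map (.β z) = 0
  zero_one' : ∀ z, map (.βs z) ∘ₗ map (.α z) = 0
  zero_two : ∀ z, map (.α (z - 1)) ∘ₗ map (.βs z) = 0
  zero_two' : ∀ z, map (.β (z - 1)) ∘ₗ map (.αs z) = 0

attribute [instance] Rep.grp Rep.mod

section Basic

variable {R : Type u} [CommRing R]

/-- Homomorphisms of representations. -/
@[ext]
structure Hom (M N : Rep R) : Type u where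
  app : ∀ v, M.obj v →ₗ[R] N.obj v
  comm : ∀ a : Arrow, app a.tgt ∘ₗ M.map a = N.map a ∘ₗ app a.src

/-- The identity homomorphism. -/
def Hom.id (M : Rep R) : Hom M M where
  app _ := LinearMap.id
  comm _ := rfl

/-- `Hom.comp g f` is `f` followed by `g`. -/
def Hom.comp {M N L : Rep R} (g : Hom N L) (f : Hom M N) : Hom M L where
  app v := g.app v ∘ₗ f.app v
  comm a := by
    rw [LinearMap.comp_assoc, f.comm, ← LinearMap.comp_assoc, g.comm, LinearMap.comp_assoc]

/-- Isomorphisms of representations. -/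
@[ext]
structure Iso (M N : Rep R) : Type u where
  app : ∀ v, M.obj v ≃ₗ[R] N.obj v
  comm : ∀ a : Arrow, (app a.tgt).toLinearMap ∘ₗ M.map a = N.map a ∘ₗ (app a.src).toLinearMap

/-- The identity isomorphism. -/
def Iso.refl (M : Rep R) : Iso M M where
  app _ := LinearEquiv.refl R _
  comm _ := rfl

/-- The inverse isomorphism. -/
def Iso.symm {M N : Rep R} (e : Iso M N) : Iso N M where
  app v := (e.app v).symm
  comm a := by
    ext x
    have h := LinearMap.congr_fun (e.comm a) ((e.app a.src).symm x)
    simp only [LinearMap.comp_apply, LinearEquiv.coe_coe, LinearEquiv.apply_symm_apply] at h ⊢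
    rw [← h, LinearEquiv.symm_apply_apply]

/-- `e.trans e'` is `e` followed by `e'`. -/
def Iso.trans {M N L : Rep R} (e : Iso M N) (e' : Iso N L) : Iso M L where
  app v := (e.app v).trans (e'.app v)
  comm a := by
    ext x
    have h := LinearMap.congr_fun (e.comm a) x
    have h' := LinearMap.congr_fun (e'.comm a) (e.app a.src x)
    simp only [LinearMap.comp_apply, LinearEquiv.coe_coe, LinearEquiv.trans_apply] at h h' ⊢
    rw [h, h']

/-- All components are finitely generated and only finitely many of them are nonzero. For `R = k`
a field this says that the representation has finite dimension over `k`. -/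
def Rep.IsFinite (M : Rep R) : Prop :=
  (∀ v, Module.Finite R (M.obj v)) ∧ {v | Nontrivial (M.obj v)}.Finite

/-- The representation is nonzero. -/
def Rep.IsNonzero (M : Rep R) : Prop := ∃ v, Nontrivial (M.obj v)

/-- A family of submodules that is stable under all arrows. -/
def Rep.IsSubrep (M : Rep R) (N : ∀ v, Submodule R (M.obj v)) : Prop :=
  ∀ a : Arrow, N a.src ≤ (N a.tgt).comap (M.map a)

/-- Simple representations. -/
def Rep.IsSimple (M : Rep R) : Prop :=
  M.IsNonzero ∧ ∀ N, M.IsSubrep N → (∀ v, N v = ⊥) ∨ (∀ v, N v = ⊤)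

/-- Indecomposable representations: nonzero, and in every decomposition into a direct sum of two
subrepresentations one of the summands is zero. -/
def Rep.IsIndecomposable (M : Rep R) : Prop :=
  M.IsNonzero ∧ ∀ N N', M.IsSubrep N → M.IsSubrep N' → (∀ v, IsCompl (N v) (N' v)) →
    (∀ v, N v = ⊥) ∨ (∀ v, N' v = ⊥)

/-- Projective objects: homomorphisms to `Y` lift along every surjection `X → Y`
of finite modules. -/
def Rep.IsProjective (P : Rep R) : Prop :=
  ∀ X Y : Rep R, X.IsFinite → Y.IsFinite → ∀ g : Hom X Y, (∀ v, Function.Surjective (g.app v)) →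
    ∀ f : Hom P Y, ∃ h : Hom P X, g.comp h = f

/-- Split monomorphisms. -/
def Hom.IsSplitMono {M N : Rep R} (f : Hom M N) : Prop := ∃ r : Hom N M, r.comp f = Hom.id M

/-- Split epimorphisms. -/
def Hom.IsSplitEpi {M N : Rep R} (f : Hom M N) : Prop := ∃ s : Hom N M, f.comp s = Hom.id N

/-- Irreducible homomorphisms in the category of finite modules. -/
def Hom.IsIrreducible {M N : Rep R} (f : Hom M N) : Prop :=
  ¬ f.IsSplitMono ∧ ¬ f.IsSplitEpi ∧
    ∀ (Z : Rep R), Z.IsFinite → ∀ (h : Hom M Z) (g : Hom Z N),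
      g.comp h = f → h.IsSplitMono ∨ g.IsSplitEpi

/-- Vertices of the stable Auslander-Reiten quiver are (isomorphism classes of) finite
indecomposable nonprojective modules. -/
def Rep.IsStableVertex (M : Rep R) : Prop :=
  M.IsFinite ∧ M.IsIndecomposable ∧ ¬ M.IsProjective

/-- `M` and `N` represent the same vertex of the stable Auslander-Reiten quiver, or there is
an arrow from the vertex of `M` to the vertex of `N`. -/
def StableLink (M N : Rep R) : Prop :=
  M.IsStableVertex ∧ N.IsStableVertex ∧
    (Nonempty (Iso M N) ∨ ∃ f : Hom M N, f.IsIrreducible)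

/-- `M` and `N` belong to the same connected component of the stable Auslander-Reiten quiver. -/
def SameStableComponent (M N : Rep R) : Prop :=
  M.IsStableVertex ∧ N.IsStableVertex ∧ Relation.EqvGen StableLink M N

/-! ### Stable endomorphism algebras -/

/-- The direct sum of two representations. -/
def Rep.sum (M N : Rep R) : Rep R where
  obj v := M.obj v × N.obj v
  map a := (M.map a).prodMap (N.map a)
  comm_one z := LinearMap.ext fun x => Prod.ext
    (LinearMap.congr_fun (M.comm_one z) x.1) (LinearMap.congr_fun (N.comm_one z) x.2)
  comm_two z := LinearMap.ext fun x => Prod.ext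
    (LinearMap.congr_fun (M.comm_two z) x.1) (LinearMap.congr_fun (N.comm_two z) x.2)
  zero_one z := LinearMap.ext fun x => Prod.ext
    (LinearMap.congr_fun (M.zero_one z) x.1) (LinearMap.congr_fun (N.zero_one z) x.2)
  zero_one' z := LinearMap.ext fun x => Prod.ext
    (LinearMap.congr_fun (M.zero_one' z) x.1) (LinearMap.congr_fun (N.zero_one' z) x.2)
  zero_two z := LinearMap.ext fun x => Prod.ext
    (LinearMap.congr_fun (M.zero_two z) x.1) (LinearMap.congr_fun (N.zero_two z) x.2)
  zero_two' z := LinearMap.ext fun x => Prod.ext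
    (LinearMap.congr_fun (M.zero_two' z) x.1) (LinearMap.congr_fun (N.zero_two' z) x.2)

/-- The zero representation. -/
def Rep.zero : Rep R where
  obj _ := PUnit
  map _ := 0
  comm_one _ := rfl
  comm_two _ := rfl
  zero_one _ := rfl
  zero_one' _ := rfl
  zero_two _ := rfl
  zero_two' _ := rfl

theorem Rep.IsFinite.sum {M N : Rep R} (hM : M.IsFinite) (hN : N.IsFinite) :
    (M.sum N).IsFinite := by
  refine ⟨fun v => ?_, ?_⟩
  · have := hM.1 v
    have := hN.1 v
    exact (inferInstance : Module.Finite R (M.obj v × N.obj v))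
  · refine (hM.2.union hN.2).subset fun v hv => ?_
    change Nontrivial (M.obj v × N.obj v) at hv
    by_contra hcon
    simp only [Set.mem_union, Set.mem_ofPred_eq, not_or, not_nontrivial_iff_subsingleton] at hcon
    obtain ⟨h1, h2⟩ := hcon
    exact not_nontrivial _ hv

/-- The first inclusion into a direct sum. -/
def Rep.inl (M N : Rep R) : Hom M (M.sum N) where
  app v := LinearMap.inl R (M.obj v) (N.obj v)
  comm a := LinearMap.ext fun _ => Prod.ext rfl (map_zero (N.map a)).symm

/-- The second inclusion into a direct sum. -/
def Rep.inr (M N : Rep R) : Hom N (M.sum N) where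
  app v := LinearMap.inr R (M.obj v) (N.obj v)
  comm a := LinearMap.ext fun _ => Prod.ext (map_zero (M.map a)).symm rfl

/-- The homomorphism from a direct sum given by two homomorphisms. -/
def Hom.coprod {M N L : Rep R} (f : Hom M L) (g : Hom N L) : Hom (M.sum N) L where
  app v := (f.app v).coprod (g.app v)
  comm a := LinearMap.ext fun x => by
    have q₁ := LinearMap.congr_fun (f.comm a) x.1
    have q₂ := LinearMap.congr_fun (g.comm a) x.2
    change f.app a.tgt (M.map a x.1) + g.app a.tgt (N.map a x.2) =
      L.map a (f.app a.src x.1 + g.app a.src x.2)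
    rw [map_add]
    exact congrArg₂ (· + ·) q₁ q₂

/-- The homomorphism to a direct sum given by two homomorphisms. -/
def Hom.prod {M N L : Rep R} (f : Hom L M) (g : Hom L N) : Hom L (M.sum N) where
  app v := (f.app v).prod (g.app v)
  comm a := LinearMap.ext fun x => Prod.ext
    (LinearMap.congr_fun (f.comm a) x) (LinearMap.congr_fun (g.comm a) x)

theorem Hom.ext_apply {M N : Rep R} {f g : Hom M N} (h : ∀ v x, f.app v x = g.app v x) : f = g :=
  Hom.ext (funext fun v => LinearMap.ext (h v))

theorem Hom.congr_apply {M N : Rep R} {f g : Hom M N} (h : f = g) (v : Vertex) (x : M.obj v) :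
    f.app v x = g.app v x := by rw [h]

theorem Rep.IsProjective.sum {M N : Rep R} (hM : M.IsProjective) (hN : N.IsProjective) :
    (M.sum N).IsProjective := by
  intro X Y hX hY g hg f
  obtain ⟨h₁, e₁⟩ := hM X Y hX hY g hg (f.comp (M.inl N))
  obtain ⟨h₂, e₂⟩ := hN X Y hX hY g hg (f.comp (M.inr N))
  refine ⟨h₁.coprod h₂, Hom.ext_apply fun v x => ?_⟩
  have q₁ := Hom.congr_apply e₁ v x.1
  have q₂ := Hom.congr_apply e₂ v x.2
  change g.app v (h₁.app v x.1 + h₂.app v x.2) = _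
  rw [map_add]
  refine (congrArg₂ (· + ·) q₁ q₂).trans ?_
  refine ((f.app v).map_add ((M.inl N).app v x.1) ((M.inr N).app v x.2)).symm.trans ?_
  exact congrArg (f.app v) (Prod.ext (add_zero x.1) (zero_add x.2))

/-- The endomorphism algebra of a representation. -/
def endAlg (V : Rep R) : Subalgebra R (∀ v, Module.End R (V.obj v)) where
  carrier := {f | ∀ a : Arrow, f a.tgt ∘ₗ V.map a = V.map a ∘ₗ f a.src}
  mul_mem' {f g} hf hg a := by
    change (f a.tgt ∘ₗ g a.tgt) ∘ₗ _ = _ ∘ₗ (f a.src ∘ₗ g a.src)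
    rw [LinearMap.comp_assoc, hg, ← LinearMap.comp_assoc, hf, LinearMap.comp_assoc]
  add_mem' {f g} hf hg a := by
    change (f a.tgt + g a.tgt) ∘ₗ _ = _ ∘ₗ (f a.src + g a.src)
    rw [LinearMap.add_comp, LinearMap.comp_add, hf, hg]
  algebraMap_mem' r a := by
    ext x
    simp [Pi.algebraMap_apply, Module.algebraMap_end_apply]

/-- An element of the endomorphism algebra as a homomorphism. -/
def endAlg.toHom {V : Rep R} (f : endAlg V) : Hom V V where
  app := f.1
  comm := f.2

/-- The endomorphism factors through a finite projective module. -/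
def FactorsThroughProjective {V : Rep R} (f : endAlg V) : Prop :=
  ∃ P : Rep R, P.IsFinite ∧ P.IsProjective ∧
    ∃ (i : Hom V P) (p : Hom P V), endAlg.toHom f = p.comp i

/-- The two-sided ideal of all endomorphisms that factor through a finite projective module. -/
def projIdeal (V : Rep R) : TwoSidedIdeal (endAlg V) :=
  TwoSidedIdeal.mk' {f | FactorsThroughProjective f}
    (by
      refine ⟨Rep.zero, ⟨fun v => ?_, ?_⟩, fun X Y _ _ g _ f => ?_,
        ⟨fun _ => 0, fun a => ?_⟩, ⟨fun _ => 0, fun a => ?_⟩, ?_⟩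
      · exact (inferInstance : Module.Finite R PUnit.{u + 1})
      · convert Set.finite_empty
        exact Set.eq_empty_of_forall_notMem fun v hv => not_nontrivial PUnit.{u + 1} hv
      · refine ⟨⟨fun _ => 0, fun a => by simp⟩, Hom.ext_apply fun v x => ?_⟩
        have hx : x = 0 := Subsingleton.elim (α := PUnit.{u + 1}) _ _
        rw [hx, map_zero, map_zero]
      · simp
      · simp
      · exact Hom.ext_apply fun v x => rfl)
    (by
      rintro f g ⟨P, hP, hP', i, p, hf⟩ ⟨Q, hQ, hQ', j, q, hg⟩
      exact ⟨P.sum Q, hP.sum hQ, hP'.sum hQ', i.prod j, p.coprod q, Hom.ext_apply fun v x =>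
        congrArg₂ (· + ·) (Hom.congr_apply hf v x) (Hom.congr_apply hg v x)⟩)
    (by
      rintro f ⟨P, hP, hP', i, p, hf⟩
      refine ⟨P, hP, hP', i, ⟨fun v => -p.app v, fun a => ?_⟩, Hom.ext_apply fun v x => ?_⟩
      · rw [LinearMap.neg_comp, LinearMap.comp_neg, p.comm]
      · exact congrArg (- ·) (Hom.congr_apply hf v x))
    (by
      rintro f g ⟨P, hP, hP', i, p, hg⟩
      exact ⟨P, hP, hP', i, (endAlg.toHom f).comp p, Hom.ext_apply fun v x =>
        congrArg (f.1 v) (Hom.congr_apply hg v x)⟩)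
    (by
      rintro f g ⟨P, hP, hP', i, p, hf⟩
      exact ⟨P, hP, hP', i.comp (endAlg.toHom g), p, Hom.ext_apply fun v x =>
        Hom.congr_apply hf v (g.1 v x)⟩)

/-- The stable endomorphism algebra of a representation. -/
abbrev StableEnd (V : Rep R) : Type u := (projIdeal V).ringCon.Quotient

end Basic

/-! ### String modules -/

/-- `InRelation a b`: the path "first `a`, then `b`" occurs in one of the relations. -/
inductive InRelation : Arrow → Arrow → Prop
  | comm_one (z : ℤ) : InRelation (.α z) (.αs z)
  | comm_one' (z : ℤ) : InRelation (.β z) (.βs z)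
  | comm_two (z : ℤ) : InRelation (.αs z) (.α (z - 1))
  | comm_two' (z : ℤ) : InRelation (.βs z) (.β (z - 1))
  | zero_one (z : ℤ) : InRelation (.β z) (.αs z)
  | zero_one' (z : ℤ) : InRelation (.α z) (.βs z)
  | zero_two (z : ℤ) : InRelation (.βs z) (.α (z - 1))
  | zero_two' (z : ℤ) : InRelation (.αs z) (.β (z - 1))

/-- Letters: arrows and formal inverses of arrows. -/
inductive Letter : Type
  | dir (a : Arrow)
  | inv (a : Arrow)

/-- The vertex at which a letter starts. -/
def Letter.source : Letter → Vertex
  | .dir a => a.src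
  | .inv a => a.tgt

/-- The vertex at which a letter ends. -/
def Letter.target : Letter → Vertex
  | .dir a => a.tgt
  | .inv a => a.src

/-- The inverse of a letter. -/
def Letter.inverse : Letter → Letter
  | .dir a => .inv a
  | .inv a => .dir a

/-- Strings: finite reduced walks (of length `≥ 0`) `v₀ - v₁ - ⋯ - vₙ` in arrows and inverse
arrows, such that neither the walk nor the inverse walk contains a path that occurs in one of the
relations. The string of length `0` at `v` is the trivial string at `v`. -/
structure StringWord : Type where
  length : ℕ
  vert : Fin (length + 1) → Vertex
  letter : Fin length → Letter
  source_eq : ∀ i, (letter i).source = vert i.castSucc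
  target_eq : ∀ i, (letter i).target = vert i.succ
  reduced : ∀ i j : Fin length, (j : ℕ) = i + 1 → letter j ≠ (letter i).inverse
  not_dir : ∀ i j : Fin length, (j : ℕ) = i + 1 →
    ∀ a b, letter i = .dir a → letter j = .dir b → ¬ InRelation a b
  not_inv : ∀ i j : Fin length, (j : ℕ) = i + 1 →
    ∀ a b, letter i = .inv b → letter j = .inv a → ¬ InRelation a b

namespace StringWord

/-- The string of length one given by an arrow. -/
def ofArrow (a : Arrow) : StringWord where
  length := 1
  vert := ![a.src, a.tgt]
  letter _ := .dir a
  source_eq i := by fin_cases i; rfl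
  target_eq i := by fin_cases i; rfl
  reduced i j h := by omega
  not_dir i j h := by omega
  not_inv i j h := by omega

/-- `w.Acts a i j`: the arrow `a` maps the `i`-th to the `j`-th basis vector of the string module
of `w`, that is, `i` and `j` are joined in the walk by the letter `a` or its inverse. -/
def Acts (w : StringWord) (a : Arrow) (i j : Fin (w.length + 1)) : Prop :=
  ∃ l : Fin w.length, (w.letter l = .dir a ∧ i = l.castSucc ∧ j = l.succ) ∨
    (w.letter l = .inv a ∧ i = l.succ ∧ j = l.castSucc)

theorem not_acts_acts (w : StringWord) {a b : Arrow} (hab : InRelation a b)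
    {i m j : Fin (w.length + 1)} (h : w.Acts a i m) (h' : w.Acts b m j) : False := by
  obtain ⟨l, ⟨h1, -, h2⟩ | ⟨h1, -, h2⟩⟩ := h <;>
  obtain ⟨l', ⟨h3, h4, -⟩ | ⟨h3, h4, -⟩⟩ := h' <;>
  have h5 := congrArg Fin.val (h2.symm.trans h4)
  · exact w.not_dir l l' h5.symm a b h1 h3 hab
  · have : l = l' := Fin.ext (Nat.succ.inj h5)
    subst this
    rw [h1] at h3
    cases h3
  · have : l = l' := Fin.ext h5
    subst this
    rw [h1] at h3
    cases h3
  · exact w.not_inv l' l h5 a b h3 h1 hab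

open Classical in
/-- The linear map by which the arrow `a` acts on the string module of `w`. -/
noncomputable def act (R : Type u) [CommRing R] (w : StringWord) (a : Arrow) (v v' : Vertex) :
    ({i // w.vert i = v} → R) →ₗ[R] ({i // w.vert i = v'} → R) :=
  (Matrix.of fun (j : {i // w.vert i = v'}) (i : {i // w.vert i = v}) =>
    if w.Acts a i.1 j.1 then (1 : R) else 0).mulVecLin

theorem act_comp_act (R : Type u) [CommRing R] (w : StringWord) {a b : Arrow}
    (hab : InRelation a b) (v v' v'' : Vertex) :
    w.act R b v' v'' ∘ₗ w.act R a v v' = 0 := by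
  classical
  unfold act
  rw [← Matrix.mulVecLin_mul]
  refine Eq.trans (congrArg _ ?_) Matrix.mulVecLin_zero
  ext j i
  simp only [Matrix.mul_apply, Matrix.of_apply, Matrix.zero_apply]
  refine Finset.sum_eq_zero fun m _ => ?_
  by_cases h1 : w.Acts b m.1 j.1
  · by_cases h2 : w.Acts a i.1 m.1
    · exact (w.not_acts_acts hab h2 h1).elim
    · rw [if_neg h2, mul_zero]
  · rw [if_neg h1, zero_mul]

/-- The string module of `w`: it has one basis vector for each vertex `vᵢ` of the walk, and each
letter of the walk makes its arrow map the basis vector at its source to the one at its target;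
all other actions of arrows on basis vectors are zero. -/
noncomputable def module (R : Type u) [CommRing R] (w : StringWord) : Rep R where
  obj v := {i // w.vert i = v} → R
  map a := w.act R a a.src a.tgt
  comm_one z := (w.act_comp_act R (.comm_one z) _ _ _).trans
    (w.act_comp_act R (.comm_one' z) _ _ _).symm
  comm_two z := (w.act_comp_act R (.comm_two z) _ _ _).trans
    (w.act_comp_act R (.comm_two' z) _ _ _).symm
  zero_one z := w.act_comp_act R (.zero_one z) _ _ _
  zero_one' z := w.act_comp_act R (.zero_one' z) _ _ _
  zero_two z := w.act_comp_act R (.zero_two z) _ _ _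
  zero_two' z := w.act_comp_act R (.zero_two' z) _ _ _

end StringWord

/-- `V` is (isomorphic to) a string module. -/
def Rep.IsStringModule {k : Type u} [Field k] (V : Rep k) : Prop :=
  ∃ w : StringWord, Nonempty (Iso V (w.module k))

/-! ### Extension of scalars -/

section Extend

variable {R S T : Type u} [CommRing R] [CommRing S] [CommRing T]

/-- Extension of scalars `S ⊗_R M` along a ring homomorphism `f : R → S`. -/
noncomputable def Rep.extend (f : R →+* S) (M : Rep R) : Rep S :=
  letI := f.toAlgebra
  { obj := fun v => S ⊗[R] M.obj v
    map := fun a => (M.map a).baseChange S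
    comm_one := fun z => by
      rw [← LinearMap.baseChange_comp, ← LinearMap.baseChange_comp, M.comm_one]
    comm_two := fun z => by
      rw [← LinearMap.baseChange_comp, ← LinearMap.baseChange_comp, M.comm_two]
    zero_one := fun z => by
      rw [← LinearMap.baseChange_comp, M.zero_one, LinearMap.baseChange_zero]
    zero_one' := fun z => by
      rw [← LinearMap.baseChange_comp, M.zero_one', LinearMap.baseChange_zero]
    zero_two := fun z => by
      rw [← LinearMap.baseChange_comp, M.zero_two, LinearMap.baseChange_zero]
    zero_two' := fun z => by
      rw [← LinearMap.baseChange_comp, M.zero_two', LinearMap.baseChange_zero] }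

/-- Extension of scalars of an isomorphism. -/
noncomputable def Iso.extend (f : R →+* S) {M N : Rep R} (e : Iso M N) :
    Iso (M.extend f) (N.extend f) :=
  letI := f.toAlgebra
  { app := fun v => (e.app v).baseChange R S _ _
    comm := fun a => by
      change ((e.app a.tgt).toLinearMap).baseChange S ∘ₗ (M.map a).baseChange S =
        (N.map a).baseChange S ∘ₗ ((e.app a.src).toLinearMap).baseChange S
      rw [← LinearMap.baseChange_comp, ← LinearMap.baseChange_comp, e.comm] }

/-- The natural isomorphism `T ⊗_S (S ⊗_R M) ≅ T ⊗_R M`. -/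
noncomputable def Rep.extendComp (f : R →+* S) (g : S →+* T) (h : R →+* T) (hgf : g.comp f = h)
    (M : Rep R) : Iso ((M.extend f).extend g) (M.extend h) :=
  letI := f.toAlgebra
  letI := g.toAlgebra
  letI := h.toAlgebra
  haveI : IsScalarTower R S T := IsScalarTower.of_algebraMap_eq' hgf.symm
  { app := fun v => TensorProduct.AlgebraTensorModule.cancelBaseChange R S T T (M.obj v)
    comm := fun a => by
      change (TensorProduct.AlgebraTensorModule.cancelBaseChange R S T T _).toLinearMap ∘ₗ
        ((M.map a).baseChange S).baseChange T = (M.map a).baseChange T ∘ₗ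
        (TensorProduct.AlgebraTensorModule.cancelBaseChange R S T T _).toLinearMap
      rw [LinearMap.baseChange_baseChange]
      exact LinearMap.ext fun x => LinearEquiv.apply_symm_apply
        (TensorProduct.AlgebraTensorModule.cancelBaseChange R S T T (M.obj a.tgt)) _ }

end Extend

/-! ### Deformations -/

section Deformation

/-- Complete local commutative Noetherian `k`-algebras with residue field `k`. The residue map
`aug : R → k` is a `k`-algebra homomorphism, so its kernel is the maximal ideal and it identifies
the residue field of `R` with `k`; it is uniquely determined by `R`. -/
structure CHat (k : Type u) [Field k] : Type (u + 1) where
  carrier : Type u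
  [ring : CommRing carrier]
  [alg : Algebra k carrier]
  [isLocal : IsLocalRing carrier]
  [noeth : IsNoetherianRing carrier]
  [complete : IsAdicComplete (IsLocalRing.maximalIdeal carrier) carrier]
  aug : carrier →ₐ[k] k

attribute [instance] CHat.ring CHat.alg CHat.isLocal CHat.noeth CHat.complete

variable {k : Type u} [Field k]

/-- Morphisms: `k`-algebra homomorphisms that induce the identity on the residue field `k`. Such
a homomorphism maps the maximal ideal into the maximal ideal, so it is continuous. -/
structure CHat.Mor (R S : CHat k) : Type u where
  hom : R.carrier →ₐ[k] S.carrier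
  comp_aug : S.aug.comp hom = R.aug

/-- The ring of dual numbers `k[ε]`, `ε² = 0`. -/
noncomputable def CHat.dual (k : Type u) [Field k] : CHat k :=
  haveI hsq : (IsLocalRing.maximalIdeal (DualNumber k)) ^ 2 = ⊥ := by
    rw [DualNumber.maximalIdeal_eq_span_singleton_eps, Ideal.span_singleton_pow,
      Ideal.span_singleton_eq_bot, pow_two, DualNumber.eps_mul_eps]
  haveI : IsAdicComplete (IsLocalRing.maximalIdeal (DualNumber k)) (DualNumber k) :=
    { haus' := fun x hx => by
        have := hx 2
        rwa [hsq, Submodule.bot_smul, SModEq.bot] at this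
      prec' := fun f hf => ⟨f 2, fun n => by
        rcases le_total n 2 with h | h
        · exact hf h
        · have := hf h
          rw [hsq, Submodule.bot_smul, SModEq.bot] at this
          rw [this]
          exact SModEq.refl _⟩ }
  { carrier := DualNumber k
    aug := TrivSqZeroExt.fstHom k k k }

/-- Lifts of `V` over `R`: finitely generated `R ⊗ Λ̂`-modules `M` that are free over `R`, together
with an isomorphism `φ : k ⊗_R M → V`. (As `R` is local, `M` is free over `R` if and only if
all its components are.) -/
structure Lift (V : Rep k) (R : CHat k) : Type (u + 1) where
  M : Rep R.carrier
  finite : M.IsFinite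
  free : ∀ v, Module.Free R.carrier (M.obj v)
  φ : Iso (M.extend R.aug.toRingHom) V

/-- Isomorphism of lifts: an isomorphism `e : M → M'` with `φ' ∘ (k ⊗ e) = φ`. -/
def Lift.IsIsomorphic {V : Rep k} {R : CHat k} (L L' : Lift V R) : Prop :=
  ∃ e : Iso L.M L'.M, (e.extend R.aug.toRingHom).trans L'.φ = L.φ

/-- Isomorphism of lifts is an equivalence relation. -/
instance Lift.setoid (V : Rep k) (R : CHat k) : Setoid (Lift V R) where
  r := Lift.IsIsomorphic
  iseqv :=
    { refl := fun L => by
        refine ⟨Iso.refl _, Iso.ext (funext fun v => LinearEquiv.ext fun x => ?_)⟩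
        let _ := R.aug.toRingHom.toAlgebra
        change L.φ.app v ((LinearEquiv.refl R.carrier (L.M.obj v)).baseChange R.carrier k _ _ x) = _
        congr 1
        exact DFunLike.congr_fun (LinearEquiv.baseChange_one R.carrier k (L.M.obj v)) x
      symm := fun {L L'} ⟨e, he⟩ => by
        refine ⟨e.symm, Iso.ext (funext fun v => LinearEquiv.ext fun x => ?_)⟩
        let _ := R.aug.toRingHom.toAlgebra
        rw [← he]
        change L'.φ.app v ((e.app v).baseChange R.carrier k _ _
          ((e.app v).symm.baseChange R.carrier k _ _ x)) = _
        congr 1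
        exact LinearEquiv.apply_symm_apply ((e.app v).baseChange R.carrier k _ _) x
      trans := fun {L L' L''} ⟨e, he⟩ ⟨e', he'⟩ => by
        refine ⟨e.trans e', Iso.ext (funext fun v => LinearEquiv.ext fun x => ?_)⟩
        let _ := R.aug.toRingHom.toAlgebra
        rw [← he, ← he']
        change L''.φ.app v (((e.app v).trans (e'.app v)).baseChange R.carrier k _ _ x) =
          L''.φ.app v ((e'.app v).baseChange R.carrier k _ _
            ((e.app v).baseChange R.carrier k _ _ x))
        rw [LinearEquiv.baseChange_trans]
        rfl }

/-- The set of deformations of `V` over `R`: isomorphism classes of lifts. -/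
def Def (V : Rep k) (R : CHat k) : Type (u + 1) := Quotient (Lift.setoid V R)

/-- The lift `(R' ⊗_{R,θ} M, φ_θ)` over `R'`, where `φ_θ` is the composition
`k ⊗_{R'} (R' ⊗_R M) ≅ k ⊗_R M → V`. -/
noncomputable def Lift.push {V : Rep k} {R R' : CHat k} (θ : CHat.Mor R R') (L : Lift V R) :
    Lift V R' where
  M := L.M.extend θ.hom.toRingHom
  finite := by
    let _ := θ.hom.toRingHom.toAlgebra
    refine ⟨fun v => ?_, L.finite.2.subset fun v hv => ?_⟩
    · have := L.finite.1 v
      exact (inferInstance : Module.Finite R'.carrier (R'.carrier ⊗[R.carrier] L.M.obj v))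
    · change Nontrivial (R'.carrier ⊗[R.carrier] L.M.obj v) at hv
      change Nontrivial (L.M.obj v)
      by_contra hcon
      rw [not_nontrivial_iff_subsingleton] at hcon
      exact not_nontrivial _ hv
  free v := by
    let _ := θ.hom.toRingHom.toAlgebra
    have := L.free v
    exact (inferInstance : Module.Free R'.carrier (R'.carrier ⊗[R.carrier] L.M.obj v))
  φ := (L.M.extendComp θ.hom.toRingHom R'.aug.toRingHom R.aug.toRingHom
    (congrArg AlgHom.toRingHom θ.comp_aug)).trans L.φ

/-- The map `Mor(R, A) → Def(V, A)`, `θ ↦ [A ⊗_{R,θ} U]`, given by a lift `U` of `V` over `R`. -/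
noncomputable def Lift.classify {V : Rep k} {R : CHat k} (U : Lift V R) (A : CHat k)
    (θ : CHat.Mor R A) : Def V A :=
  Quotient.mk _ (U.push θ)

/-- `R` is a versal deformation ring of `V`: there is a lift `U` of `V` over `R` such that
`θ ↦ [A ⊗_{R,θ} U]` is a surjection `Mor(R, A) → Def(V, A)` for all `A`, and a bijection for
`A = k[ε]`. -/
def IsVersalDeformationRing (V : Rep k) (R : CHat k) : Prop :=
  ∃ U : Lift V R, (∀ A : CHat k, Function.Surjective (U.classify A)) ∧
    Function.Bijective (U.classify (CHat.dual k))

/-- The versal deformation ring of `V`, which is determined up to isomorphism, exists and is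
isomorphic to the `k`-algebra `B`. -/
def VersalDeformationRingIso (V : Rep k) (B : Type u) [CommRing B] [Algebra k B] : Prop :=
  (∃ R : CHat k, IsVersalDeformationRing V R) ∧
    ∀ R : CHat k, IsVersalDeformationRing V R → Nonempty (R.carrier ≃ₐ[k] B)

end Deformation

/-! ### The two classes of string modules -/

section Classes

variable {k : Type u} [Field k]

/-- `V` belongs to a component of the stable Auslander-Reiten quiver that contains a
simple module. -/
def Rep.InSimpleComponent (V : Rep k) : Prop :=
  ∃ S : Rep k, S.IsSimple ∧ SameStableComponent V S

/-- `V` is isomorphic to the string module of an arrow of the quiver. -/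
def Rep.IsArrowModule (V : Rep k) : Prop :=
  ∃ a : Arrow, Nonempty (Iso V ((StringWord.ofArrow a).module k))

end Classes

end KronRep

/-! Write `X` for the arrows `α`, `α*` and `Y` for the arrows `β`, `β*`; each moves one step along
the line of vertices. The relations become `XY = YX = 0` and `Y² = X²`, hence `X³ = 0`. The cofree
modules are both injective and projective. If `X² z ≠ 0`, a cofree module splits off, so an
indecomposable nonprojective module is killed by all paths of length two. It then sits at two
consecutive vertices and is a pair of parallel linear maps `x, y : V → W`, a Kronecker module
(`Rep.IsStableVertex.exists_gen`). If `W = xV + yV`, no nonzero endomorphism factors through a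
projective (`Kron.Gen.stablyFaithful`), so the stable endomorphism algebra is the ordinary one.

Every path of length two occurs in a relation, so a string is a zigzag in the two arrows that start
at one vertex. For even length the dimensions of `V` and `W` differ by one, and comparing matrix
entries shows that all endomorphisms are scalar. For odd length one of `x`, `y` is invertible.
Length one gives the arrow modules, with scalar endomorphisms; from length three on, `x⁻¹y` or
`y⁻¹x` is a nonscalar endomorphism. For the first claim it remains to see that a stable vertex lies
in the component of a simple module exactly if it is uneven, that is `dim V ≠ dim W`.

Syzygies do the work of Auslander–Reiten theory here. The syzygy `Ω` sends the dimensions `(a, b)`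
to `(2a - b, a)` and keeps `a - b`, so applying `Ω` or `Ω⁻¹` lowers the dimension of an uneven
module until it is simple (`place_uneven_induction`). Between stably faithful modules `Ω` respects
endomorphisms and irreducible maps in both directions. Hence uneven modules have scalar
endomorphisms, and it suffices to inspect the irreducible maps that start or end at a simple module.
Testing such a map against one explicit factorisation shows that at the other end one dimension is
twice the other, so that end is uneven as well. Conversely the syzygy of the simple module at `v`
has an irreducible map to the simple module at `v.succ`; this keeps the whole `Ω`-orbit of a simple
module in components of simple modules.

For the deformations of an uneven module consider `(F, G) ↦ (xF - Gx, yF - Gy)`. Its kernel consists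
of the scalars, and as the dimensions differ by one it is surjective: there are no self-extensions.
By Nakayama's lemma all lifts over any `R` are isomorphic, and `k` is universal. A lift of an arrow
module has rank one at both vertices, one of the two maps is invertible, and the lift is determined
by the ratio `c ∈ 𝔪` of the other map to it; so `k⟦t⟧` with `t ↦ c` is universal. Finally, if a
universal ring exists, every versal ring retracts onto it and has its maximal ideal generated by the
image of the universal one (`Lift.IsUniversal.exists_of_isVersal`), which identifies the versal
rings in both cases. -/

namespace KronRep
open scoped TensorProduct

/-! ### Uniform description of representations -/

/-- The common target of the two arrows that start at a vertex. -/
def Vertex.succ : Vertex → Vertex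
  | .one z => .two z
  | .two z => .one (z - 1)

theorem Vertex.succ_injective : Function.Injective Vertex.succ := by
  rintro (a | a) (b | b) h <;> simp [Vertex.succ] at h <;> simp [h]

theorem Vertex.exists_succ_eq (v : Vertex) : ∃ w : Vertex, w.succ = v := by
  rcases v with z | z
  · exact ⟨.two (z + 1), by simp [Vertex.succ]⟩
  · exact ⟨.one z, rfl⟩

/-- The vertices form a line that is infinite in both directions, so no iterate of `Vertex.succ` has
a fixed point. Three iterates are enough, since modules have Loewy length at most three. -/
theorem Vertex.succ_ne (v : Vertex) : v.succ ≠ v := by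
  rcases v with z | z <;> simp [Vertex.succ]

theorem Vertex.succ_succ_ne (v : Vertex) : v.succ.succ ≠ v := by
  rcases v with z | z <;> simp [Vertex.succ]

theorem Vertex.succ_succ_succ_ne (v : Vertex) : v.succ.succ.succ ≠ v := by
  rcases v with z | z <;> simp [Vertex.succ]

section Uniform

variable {R : Type u} [CommRing R]

/-- The action of the arrows `α_z` and `α*_z`. -/
def Rep.X (M : Rep R) : ∀ v : Vertex, M.obj v →ₗ[R] M.obj v.succ
  | .one z => M.map (.α z)
  | .two z => M.map (.αs z)

/-- The action of the arrows `β_z` and `β*_z`. -/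
def Rep.Y (M : Rep R) : ∀ v : Vertex, M.obj v →ₗ[R] M.obj v.succ
  | .one z => M.map (.β z)
  | .two z => M.map (.βs z)

theorem Rep.Y_Y (M : Rep R) (v : Vertex) (m : M.obj v) :
    M.Y _ (M.Y v m) = M.X _ (M.X v m) := by
  rcases v with z | z
  · exact (LinearMap.congr_fun (M.comm_one z) m).symm
  · exact (LinearMap.congr_fun (M.comm_two z) m).symm

theorem Rep.X_Y (M : Rep R) (v : Vertex) (m : M.obj v) : M.X _ (M.Y v m) = 0 := by
  rcases v with z | z
  · exact LinearMap.congr_fun (M.zero_one z) m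
  · exact LinearMap.congr_fun (M.zero_two z) m

theorem Rep.Y_X (M : Rep R) (v : Vertex) (m : M.obj v) : M.Y _ (M.X v m) = 0 := by
  rcases v with z | z
  · exact LinearMap.congr_fun (M.zero_one' z) m
  · exact LinearMap.congr_fun (M.zero_two' z) m

/-- `X³ = X Y² = (XY) Y = 0`. -/
theorem Rep.X_X_X (M : Rep R) (v : Vertex) (m : M.obj v) : M.X _ (M.X _ (M.X v m)) = 0 := by
  rw [← M.Y_Y v, M.X_Y]

/-- A representation given by its vector spaces and the actions of the arrows. -/
@[reducible] def Rep.ofXY (obj : Vertex → Type u) [∀ v, AddCommGroup (obj v)] [∀ v, Module R (obj v)]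
    (X Y : ∀ v, obj v →ₗ[R] obj v.succ) (hYY : ∀ v m, Y _ (Y v m) = X _ (X v m))
    (hXY : ∀ v m, X _ (Y v m) = 0) (hYX : ∀ v m, Y _ (X v m) = 0) : Rep R where
  obj := obj
  map
    | .α z => X (.one z)
    | .β z => Y (.one z)
    | .αs z => X (.two z)
    | .βs z => Y (.two z)
  comm_one _ := LinearMap.ext fun m => (hYY _ m).symm
  comm_two z := LinearMap.ext fun m => (hYY (.two z) m).symm
  zero_one z := LinearMap.ext fun m => hXY (.one z) m
  zero_one' z := LinearMap.ext fun m => hYX (.one z) m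
  zero_two z := LinearMap.ext fun m => hXY (.two z) m
  zero_two' z := LinearMap.ext fun m => hYX (.two z) m

section

variable (obj : Vertex → Type u) [∀ v, AddCommGroup (obj v)] [∀ v, Module R (obj v)]
    (X Y : ∀ v, obj v →ₗ[R] obj v.succ) (hYY : ∀ v m, Y _ (Y v m) = X _ (X v m))
    (hXY : ∀ v m, X _ (Y v m) = 0) (hYX : ∀ v m, Y _ (X v m) = 0)

theorem Rep.ofXY_X (v : Vertex) : (Rep.ofXY obj X Y hYY hXY hYX).X v = X v := by
  cases v <;> rfl

theorem Rep.ofXY_Y (v : Vertex) : (Rep.ofXY obj X Y hYY hXY hYX).Y v = Y v := by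
  cases v <;> rfl

end

theorem Hom.app_X {M N : Rep R} (f : Hom M N) (v : Vertex) (m : M.obj v) :
    f.app _ (M.X v m) = N.X v (f.app v m) := by
  rcases v with z | z
  · exact LinearMap.congr_fun (f.comm (.α z)) m
  · exact LinearMap.congr_fun (f.comm (.αs z)) m

theorem Hom.app_Y {M N : Rep R} (f : Hom M N) (v : Vertex) (m : M.obj v) :
    f.app _ (M.Y v m) = N.Y v (f.app v m) := by
  rcases v with z | z
  · exact LinearMap.congr_fun (f.comm (.β z)) m
  · exact LinearMap.congr_fun (f.comm (.βs z)) m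

/-- A homomorphism given by linear maps that are compatible with the two actions. -/
@[simps]
def Hom.ofXY {M N : Rep R} (app : ∀ v, M.obj v →ₗ[R] N.obj v)
    (hX : ∀ v m, app _ (M.X v m) = N.X v (app v m))
    (hY : ∀ v m, app _ (M.Y v m) = N.Y v (app v m)) : Hom M N where
  app := app
  comm
    | .α z => LinearMap.ext fun m => hX (.one z) m
    | .β z => LinearMap.ext fun m => hY (.one z) m
    | .αs z => LinearMap.ext fun m => hX (.two z) m
    | .βs z => LinearMap.ext fun m => hY (.two z) m

@[simp] theorem Hom.comp_app {M N L : Rep R} (g : Hom N L) (f : Hom M N) (v : Vertex)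
    (m : M.obj v) : (g.comp f).app v m = g.app v (f.app v m) := rfl

@[simp] theorem Hom.id_app {M : Rep R} (v : Vertex) (m : M.obj v) : (Hom.id M).app v m = m := rfl

theorem Hom.comp_assoc {M N L K : Rep R} (h : Hom L K) (g : Hom N L) (f : Hom M N) :
    (h.comp g).comp f = h.comp (g.comp f) := rfl

theorem Hom.comp_id {M N : Rep R} (f : Hom M N) : f.comp (Hom.id M) = f := rfl

instance (M N : Rep R) : Zero (Hom M N) :=
  ⟨Hom.ofXY (fun _ => 0) (fun v m => by simp) fun v m => by simp⟩

instance (M N : Rep R) : Sub (Hom M N) :=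
  ⟨fun f g => Hom.ofXY (fun v => f.app v - g.app v)
    (fun v m => by simp [Hom.app_X]) fun v m => by simp [Hom.app_Y]⟩

instance (M N : Rep R) : SMul R (Hom M N) :=
  ⟨fun c f => Hom.ofXY (fun v => c • f.app v)
    (fun v m => by simp [Hom.app_X]) fun v m => by simp [Hom.app_Y]⟩

@[simp] theorem Hom.zero_app {M N : Rep R} (v : Vertex) (m : M.obj v) :
    (0 : Hom M N).app v m = 0 := rfl

@[simp] theorem Hom.sub_app {M N : Rep R} (f g : Hom M N) (v : Vertex) (m : M.obj v) :
    (f - g).app v m = f.app v m - g.app v m := rfl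

@[simp] theorem Hom.smul_app {M N : Rep R} (c : R) (f : Hom M N) (v : Vertex) (m : M.obj v) :
    (c • f).app v m = c • f.app v m := rfl

/-- The homomorphism underlying an isomorphism. -/
@[simps]
def Iso.hom {M N : Rep R} (e : Iso M N) : Hom M N where
  app v := (e.app v).toLinearMap
  comm := e.comm

theorem Iso.symm_hom_comp {M N : Rep R} (e : Iso M N) : e.symm.hom.comp e.hom = Hom.id M :=
  Hom.ext_apply fun v x => (e.app v).symm_apply_apply x

theorem Iso.hom_comp_symm {M N : Rep R} (e : Iso M N) : e.hom.comp e.symm.hom = Hom.id N :=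
  Hom.ext_apply fun v x => (e.app v).apply_symm_apply x

theorem Iso.app_X {M N : Rep R} (e : Iso M N) (v : Vertex) (m : M.obj v) :
    e.app _ (M.X v m) = N.X v (e.app v m) := e.hom.app_X v m

theorem Iso.app_Y {M N : Rep R} (e : Iso M N) (v : Vertex) (m : M.obj v) :
    e.app _ (M.Y v m) = N.Y v (e.app v m) := e.hom.app_Y v m

/-- A bijective homomorphism as an isomorphism. -/
noncomputable def Hom.toIso {M N : Rep R} (f : Hom M N)
    (hf : ∀ v, Function.Bijective (f.app v)) : Iso M N where
  app v := LinearEquiv.ofBijective (f.app v) (hf v)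
  comm a := f.comm a

/-- Two mutually inverse homomorphisms as an isomorphism. -/
def Iso.ofHoms {M N : Rep R} (f : Hom M N) (g : Hom N M) (hgf : g.comp f = Hom.id M)
    (hfg : f.comp g = Hom.id N) : Iso M N where
  app v := LinearEquiv.ofLinearMap (f.app v) (g.app v)
    (LinearMap.ext fun x => Hom.congr_apply hfg v x)
    (LinearMap.ext fun x => Hom.congr_apply hgf v x)
  comm a := f.comm a

theorem Rep.IsSubrep.of_XY {M : Rep R} {N : ∀ v, Submodule R (M.obj v)}
    (hX : ∀ v, ∀ m ∈ N v, M.X v m ∈ N v.succ) (hY : ∀ v, ∀ m ∈ N v, M.Y v m ∈ N v.succ) :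
    M.IsSubrep N
  | .α z => fun m hm => hX (.one z) m hm
  | .β z => fun m hm => hY (.one z) m hm
  | .αs z => fun m hm => hX (.two z) m hm
  | .βs z => fun m hm => hY (.two z) m hm

theorem Rep.IsSubrep.X_mem {M : Rep R} {N : ∀ v, Submodule R (M.obj v)} (h : M.IsSubrep N)
    (v : Vertex) (m : M.obj v) (hm : m ∈ N v) : M.X v m ∈ N v.succ := by
  rcases v with z | z
  · exact h (.α z) hm
  · exact h (.αs z) hm

theorem Rep.IsSubrep.Y_mem {M : Rep R} {N : ∀ v, Submodule R (M.obj v)} (h : M.IsSubrep N)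
    (v : Vertex) (m : M.obj v) (hm : m ∈ N v) : M.Y v m ∈ N v.succ := by
  rcases v with z | z
  · exact h (.β z) hm
  · exact h (.βs z) hm

theorem Hom.range_isSubrep {M N : Rep R} (f : Hom M N) :
    N.IsSubrep fun v => LinearMap.range (f.app v) :=
  .of_XY (by rintro v _ ⟨m, rfl⟩; exact ⟨M.X v m, f.app_X v m⟩)
    (by rintro v _ ⟨m, rfl⟩; exact ⟨M.Y v m, f.app_Y v m⟩)

theorem Hom.ker_isSubrep {M N : Rep R} (f : Hom M N) :
    M.IsSubrep fun v => LinearMap.ker (f.app v) :=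
  .of_XY (fun v m hm => by rw [LinearMap.mem_ker] at hm ⊢; rw [f.app_X, hm, map_zero])
    (fun v m hm => by rw [LinearMap.mem_ker] at hm ⊢; rw [f.app_Y, hm, map_zero])

/-- A subrepresentation as a representation. -/
@[reducible] def Rep.sub (M : Rep R) (N : ∀ v, Submodule R (M.obj v)) (h : M.IsSubrep N) : Rep R :=
  Rep.ofXY (fun v => N v) (fun v => (M.X v).restrict (h.X_mem v))
    (fun v => (M.Y v).restrict (h.Y_mem v)) (fun v m => Subtype.ext (M.Y_Y v m))
    (fun v m => Subtype.ext (M.X_Y v m)) (fun v m => Subtype.ext (M.Y_X v m))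

/-- The inclusion of a subrepresentation. -/
def Rep.subHom (M : Rep R) (N : ∀ v, Submodule R (M.obj v)) (h : M.IsSubrep N) :
    Hom (M.sub N h) M :=
  Hom.ofXY (fun v => (N v).subtype) (fun v m => by rw [Rep.ofXY_X]; rfl)
    (fun v m => by rw [Rep.ofXY_Y]; rfl)

/-- The quotient by a subrepresentation. -/
@[reducible] def Rep.quot (M : Rep R) (N : ∀ v, Submodule R (M.obj v)) (h : M.IsSubrep N) : Rep R :=
  Rep.ofXY (fun v => M.obj v ⧸ N v) (fun v => (N v).mapQ _ (M.X v) (h.X_mem v))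
    (fun v => (N v).mapQ _ (M.Y v) (h.Y_mem v))
    (fun v m => by
      obtain ⟨m, rfl⟩ := Submodule.mkQ_surjective _ m
      simp [M.Y_Y])
    (fun v m => by
      obtain ⟨m, rfl⟩ := Submodule.mkQ_surjective _ m
      simp [M.X_Y])
    (fun v m => by
      obtain ⟨m, rfl⟩ := Submodule.mkQ_surjective _ m
      simp [M.Y_X])

/-- The projection to the quotient by a subrepresentation. -/
def Rep.quotHom (M : Rep R) (N : ∀ v, Submodule R (M.obj v)) (h : M.IsSubrep N) :
    Hom M (M.quot N h) :=
  Hom.ofXY (fun v => (N v).mkQ) (fun v m => by rw [Rep.ofXY_X]; rfl)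
    (fun v m => by rw [Rep.ofXY_Y]; rfl)

theorem Rep.IsFinite.quot {M : Rep R} (hM : M.IsFinite) (N : ∀ v, Submodule R (M.obj v))
    (h : M.IsSubrep N) : (M.quot N h).IsFinite := by
  refine ⟨fun v => ?_, hM.2.subset fun v hv => ?_⟩
  · have := hM.1 v
    exact (inferInstance : Module.Finite R (M.obj v ⧸ N v))
  · have : Nontrivial (M.obj v ⧸ N v) := hv
    exact (Submodule.mkQ_surjective (N v)).nontrivial

theorem Rep.IsFinite.of_injective [IsNoetherianRing R] {M N : Rep R} (hN : N.IsFinite)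
    (f : Hom M N) (hf : ∀ v, Function.Injective (f.app v)) : M.IsFinite := by
  refine ⟨fun v => ?_, hN.2.subset fun v hv => ?_⟩
  · have := hN.1 v
    exact Module.Finite.of_injective (f.app v) (hf v)
  · have : Nontrivial (M.obj v) := hv
    exact (hf v).nontrivial

theorem Rep.IsFinite.sub [IsNoetherianRing R] {M : Rep R} (hM : M.IsFinite)
    (N : ∀ v, Submodule R (M.obj v)) (h : M.IsSubrep N) : (M.sub N h).IsFinite :=
  hM.of_injective (M.subHom N h) fun _ => Subtype.val_injective

/-! ### Invariance under isomorphisms -/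

theorem Rep.IsFinite.of_iso {M N : Rep R} (e : Iso M N) (hM : M.IsFinite) : N.IsFinite := by
  refine ⟨fun v => ?_, hM.2.subset fun v hv => ?_⟩
  · have := hM.1 v
    exact Module.Finite.equiv (e.app v)
  · have : Nontrivial (N.obj v) := hv
    exact (e.app v).symm.injective.nontrivial

theorem Rep.IsNonzero.of_iso {M N : Rep R} (e : Iso M N) (hM : M.IsNonzero) : N.IsNonzero := by
  obtain ⟨v, hv⟩ := hM
  exact ⟨v, (e.app v).symm.surjective.nontrivial⟩

theorem Rep.IsIndecomposable.of_iso {M N : Rep R} (e : Iso M N) (hM : M.IsIndecomposable) :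
    N.IsIndecomposable := by
  refine ⟨hM.1.of_iso e, fun A B hA hB hAB => ?_⟩
  have key : ∀ C : ∀ v, Submodule R (N.obj v), N.IsSubrep C →
      M.IsSubrep fun v => (C v).comap (e.app v).toLinearMap := fun C hC =>
    .of_XY (fun v m hm => by
        simp only [Submodule.mem_comap, LinearEquiv.coe_coe] at hm ⊢
        rw [e.app_X]; exact hC.X_mem v _ hm)
      (fun v m hm => by
        simp only [Submodule.mem_comap, LinearEquiv.coe_coe] at hm ⊢
        rw [e.app_Y]; exact hC.Y_mem v _ hm)
  have bot : ∀ C : ∀ v, Submodule R (N.obj v),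
      (∀ v, (C v).comap (e.app v).toLinearMap = ⊥) → ∀ v, C v = ⊥ := fun C hC v => by
    have h1 := congrArg (Submodule.map (e.app v).toLinearMap) (hC v)
    rwa [Submodule.map_comap_eq_of_surjective (e.app v).surjective, Submodule.map_bot] at h1
  refine (hM.2 _ _ (key A hA) (key B hB) fun v => ?_).imp (bot A) (bot B)
  exact (Submodule.orderIsoMapComap (e.app v)).symm.isCompl (hAB v)

theorem Rep.IsProjective.of_retract {P Q : Rep R} (hP : P.IsProjective) (i : Hom Q P) (p : Hom P Q)
    (h : p.comp i = Hom.id Q) : Q.IsProjective := by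
  intro A B hA hB g hg f
  obtain ⟨t, ht⟩ := hP A B hA hB g hg (f.comp p)
  refine ⟨t.comp i, ?_⟩
  rw [← Hom.comp_assoc, ht, Hom.comp_assoc, h, Hom.comp_id]

theorem Rep.IsProjective.of_iso {M N : Rep R} (e : Iso M N) (hM : M.IsProjective) :
    N.IsProjective := hM.of_retract e.symm.hom e.hom e.hom_comp_symm

theorem Rep.IsStableVertex.of_iso {M N : Rep R} (e : Iso M N) (hM : M.IsStableVertex) :
    N.IsStableVertex :=
  ⟨hM.1.of_iso e, hM.2.1.of_iso e, fun h => hM.2.2 (h.of_iso e.symm)⟩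

/-- `M` is the direct sum of the image of `i` and the kernel of `q`, and the image is nonzero. -/
theorem Rep.IsIndecomposable.iso_of_split {M P : Rep R} (hM : M.IsIndecomposable)
    (hP : P.IsNonzero) (i : Hom P M) (q : Hom M P) (h : q.comp i = Hom.id P) :
    Nonempty (Iso P M) := by
  have hqi : ∀ v x, q.app v (i.app v x) = x := Hom.congr_apply h
  have hc : ∀ v, IsCompl (LinearMap.range (i.app v)) (LinearMap.ker (q.app v)) := fun v => by
    refine ⟨Submodule.disjoint_def.2 ?_, codisjoint_iff.2 (eq_top_iff.2 fun m _ => ?_)⟩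
    · rintro _ ⟨x, rfl⟩ hx
      rw [LinearMap.mem_ker, hqi] at hx
      rw [hx, map_zero]
    · rw [← add_sub_cancel (i.app v (q.app v m)) m]
      exact Submodule.add_mem_sup ⟨_, rfl⟩ (by simp [hqi])
  rcases hM.2 _ _ i.range_isSubrep q.ker_isSubrep hc with h1 | h1
  · obtain ⟨v, hv⟩ := hP
    obtain ⟨x, hx⟩ := exists_ne (0 : P.obj v)
    refine absurd ?_ hx
    have h2 : i.app v x ∈ LinearMap.range (i.app v) := ⟨x, rfl⟩
    rw [h1 v, Submodule.mem_bot] at h2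
    rw [← hqi v x, h2, map_zero]
  · refine ⟨i.toIso fun v => ⟨Function.LeftInverse.injective (hqi v), fun m => ?_⟩⟩
    refine ⟨q.app v m, LinearMap.ker_eq_bot.1 (h1 v) (hqi v _)⟩

theorem Hom.IsIrreducible.comp_iso {M N M' N' : Rep R} {f : Hom M N} (hf : f.IsIrreducible)
    (e : Iso M M') (d : Iso N N') : (d.hom.comp (f.comp e.symm.hom)).IsIrreducible := by
  obtain ⟨h1, h2, h3⟩ := hf
  refine ⟨fun ⟨r, hr⟩ => h1 ⟨e.symm.hom.comp (r.comp d.hom), ?_⟩,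
    fun ⟨s, hs⟩ => h2 ⟨e.symm.hom.comp (s.comp d.hom), ?_⟩, fun Z hZ h g hgh => ?_⟩
  · refine Hom.ext_apply fun v x => (e.app v).injective ?_
    have := Hom.congr_apply hr v (e.app v x)
    simp only [Hom.comp_app, Iso.hom_app, LinearEquiv.coe_coe] at this
    simp only [Hom.comp_app, Iso.hom_app, LinearEquiv.coe_coe, Hom.id_app]
    change e.app v ((e.app v).symm _) = _
    rw [LinearEquiv.apply_symm_apply]
    change r.app v (d.app v (f.app v ((e.app v).symm (e.app v x)))) = _ at this
    rwa [LinearEquiv.symm_apply_apply] at this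
  · refine Hom.ext_apply fun v x => (d.app v).injective ?_
    exact Hom.congr_apply hs v (d.app v x)
  · have := h3 Z hZ (h.comp e.hom) (d.symm.hom.comp g) (Hom.ext_apply fun v x => ?_)
    · refine this.imp (fun ⟨r, hr⟩ => ⟨e.hom.comp r, Hom.ext_apply fun v x => ?_⟩)
        fun ⟨s, hs⟩ => ⟨s.comp d.symm.hom, Hom.ext_apply fun v x => ?_⟩
      · have := Hom.congr_apply hr v ((e.app v).symm x)
        change r.app v (h.app v (e.app v ((e.app v).symm x))) = _ at this
        rw [LinearEquiv.apply_symm_apply] at this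
        change e.app v (r.app v (h.app v x)) = x
        rw [this]
        exact (e.app v).apply_symm_apply x
      · have := Hom.congr_apply hs v ((d.app v).symm x)
        exact (d.app v).symm.injective this
    · have := Hom.congr_apply hgh v (e.app v x)
      change g.app v (h.app v (e.app v x)) = d.app v (f.app v ((e.app v).symm (e.app v x))) at this
      rw [LinearEquiv.symm_apply_apply] at this
      change (d.app v).symm (g.app v (h.app v (e.app v x))) = _
      rw [this, LinearEquiv.symm_apply_apply]

end Uniform


/-! ### Cofree representations -/

section Cofree

/-- A family indexed by all vertices from a family indexed by the targets of arrows. -/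
noncomputable def Vertex.succRec {C : Vertex → Sort*} (f : ∀ u : Vertex, C u.succ) (w : Vertex) :
    C w :=
  w.exists_succ_eq.choose_spec ▸ f w.exists_succ_eq.choose

/-- The predecessor chosen for `u.succ` equals `u` only propositionally; injectivity of
`Vertex.succ` removes the transport. -/
theorem Vertex.succRec_succ {C : Vertex → Sort*} (f : ∀ u : Vertex, C u.succ) (u : Vertex) :
    Vertex.succRec f u.succ = f u := by
  have key : ∀ (u' : Vertex) (h : u'.succ = u.succ), (h ▸ f u' : C u.succ) = f u := by
    intro u' h
    obtain rfl := Vertex.succ_injective h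
    rfl
  exact key _ _

variable {k : Type u} [Field k] (B : Vertex → Type u) [∀ v, AddCommGroup (B v)]
  [∀ v, Module k (B v)]

/-- The representation such that homomorphisms from `N` to it are families of linear maps
`N v → B v`. -/
def cofree : Rep k :=
  -- The coordinates of a point are the values of a family of linear maps at `n`, `X n`, `Y n` and
  -- `X² n`. The zeros in the two actions express `XY = YX = 0` and `X³ = 0`.
  Rep.ofXY (fun w => B w × (B w.succ × B w.succ) × B w.succ.succ)
    (fun _ =>
      { toFun := fun p => (p.2.1.1, (p.2.2, 0), 0)
        map_add' := fun p q => by simp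
        map_smul' := fun c p => by simp })
    (fun _ =>
      { toFun := fun p => (p.2.1.2, (0, p.2.2), 0)
        map_add' := fun p q => by simp
        map_smul' := fun c p => by simp })
    (fun _ _ => rfl) (fun _ _ => rfl) (fun _ _ => rfl)

variable {B}

/-- Elements of a cofree representation. -/
def cofree.mk {w : Vertex} (b₀ : B w) (b₁ b₂ : B w.succ) (b₃ : B w.succ.succ) :
    (cofree (k := k) B).obj w := (b₀, (b₁, b₂), b₃)

theorem cofree.X_mk {w : Vertex} (b₀ : B w) (b₁ b₂ : B w.succ) (b₃ : B w.succ.succ) :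
    (cofree (k := k) B).X w (cofree.mk b₀ b₁ b₂ b₃) = cofree.mk b₁ b₃ 0 0 := by
  cases w <;> rfl

theorem cofree.Y_mk {w : Vertex} (b₀ : B w) (b₁ b₂ : B w.succ) (b₃ : B w.succ.succ) :
    (cofree (k := k) B).Y w (cofree.mk b₀ b₁ b₂ b₃) = cofree.mk b₂ 0 b₃ 0 := by
  cases w <;> rfl

theorem cofree.mk_inj {w : Vertex} {b₀ c₀ : B w} {b₁ b₂ c₁ c₂ : B w.succ} {b₃ c₃ : B w.succ.succ}
    (h : (cofree.mk b₀ b₁ b₂ b₃ : (cofree (k := k) B).obj w) = cofree.mk c₀ c₁ c₂ c₃) :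
    b₀ = c₀ ∧ b₁ = c₁ ∧ b₂ = c₂ ∧ b₃ = c₃ := by
  have h' : (b₀, (b₁, b₂), b₃) = (c₀, (c₁, c₂), c₃) := h
  simpa [and_assoc] using h'

theorem cofree.mk_zero {w : Vertex} :
    (cofree.mk 0 0 0 0 : (cofree (k := k) B).obj w) = 0 := rfl

theorem cofree.mk_add {w : Vertex} (b₀ c₀ : B w) (b₁ b₂ c₁ c₂ : B w.succ) (b₃ c₃ : B w.succ.succ) :
    (cofree.mk b₀ b₁ b₂ b₃ + cofree.mk c₀ c₁ c₂ c₃ : (cofree (k := k) B).obj w) =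
      cofree.mk (b₀ + c₀) (b₁ + c₁) (b₂ + c₂) (b₃ + c₃) := rfl

theorem cofree.exists_mk {w : Vertex} (p : (cofree (k := k) B).obj w) :
    ∃ b₀ b₁ b₂ b₃, p = cofree.mk b₀ b₁ b₂ b₃ := ⟨p.1, p.2.1.1, p.2.1.2, p.2.2, rfl⟩

/-- The components of `toCofree`. -/
def toCofreeApp {N : Rep k} (β : ∀ v, N.obj v →ₗ[k] B v) (w : Vertex) :
    N.obj w →ₗ[k] (cofree (k := k) B).obj w :=
  (β w).prod (((β _ ∘ₗ N.X w).prod (β _ ∘ₗ N.Y w)).prod (β _ ∘ₗ N.X _ ∘ₗ N.X w))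

theorem toCofreeApp_apply {N : Rep k} (β : ∀ v, N.obj v →ₗ[k] B v) (w : Vertex) (n : N.obj w) :
    toCofreeApp β w n =
      cofree.mk (β w n) (β _ (N.X w n)) (β _ (N.Y w n)) (β _ (N.X _ (N.X w n))) :=
  rfl

/-- The homomorphism to a cofree representation given by a family of linear maps. -/
def toCofree {N : Rep k} (β : ∀ v, N.obj v →ₗ[k] B v) : Hom N (cofree B) :=
  Hom.ofXY (toCofreeApp β)
    (fun v m => by
      rw [toCofreeApp_apply, toCofreeApp_apply, cofree.X_mk, N.Y_X, N.X_X_X, map_zero, map_zero])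
    (fun v m => by
      rw [toCofreeApp_apply, toCofreeApp_apply, cofree.Y_mk, N.X_Y, N.Y_Y, map_zero, map_zero,
        map_zero])

theorem toCofree_app {N : Rep k} (β : ∀ v, N.obj v →ₗ[k] B v) (w : Vertex) (n : N.obj w) :
    (toCofree β).app w n = cofree.mk (β w n) (β _ (N.X w n)) (β _ (N.Y w n)) (β _ (N.X _ (N.X w n))) :=
  rfl

/-- The family of linear maps that corresponds to a homomorphism to a cofree representation. -/
def ofCofree {N : Rep k} (f : Hom N (cofree B)) (v : Vertex) : N.obj v →ₗ[k] B v :=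
  LinearMap.fst k (B v) ((B v.succ × B v.succ) × B v.succ.succ) ∘ₗ f.app v

/-- The later coordinates of `f n` are the first coordinates of `f (X n)`, `f (Y n)` and `f (X² n)`,
so nothing is lost by keeping only the first one. -/
theorem toCofree_ofCofree {N : Rep k} (f : Hom N (cofree B)) : toCofree (ofCofree f) = f := by
  refine Hom.ext_apply fun v n => ?_
  obtain ⟨b₀, b₁, b₂, b₃, h⟩ := cofree.exists_mk (f.app v n)
  have h1 := f.app_X v n
  have h2 := f.app_Y v n
  have h3 := f.app_X _ (N.X v n)
  rw [h, cofree.X_mk] at h1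
  rw [h, cofree.Y_mk] at h2
  rw [h1, cofree.X_mk] at h3
  rw [toCofree_app, h]
  congr 1
  · exact congrArg Prod.fst h
  · exact congrArg Prod.fst h1
  · exact congrArg Prod.fst h2
  · exact congrArg Prod.fst h3

/-- Homomorphisms to a cofree representation extend along monomorphisms. -/
theorem cofree_injective {M N : Rep k} (i : Hom M N) (hi : ∀ v, Function.Injective (i.app v))
    (f : Hom M (cofree B)) : ∃ g : Hom N (cofree B), g.comp i = f := by
  choose r hr using fun v => (i.app v).exists_leftInverse_of_injective
    (LinearMap.ker_eq_bot.2 (hi v))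
  have hβ' : ∀ v n, (ofCofree f v ∘ₗ r v) (i.app v n) = ofCofree f v n := fun v n =>
    congrArg (ofCofree f v) (LinearMap.congr_fun (hr v) n)
  refine ⟨toCofree fun v => ofCofree f v ∘ₗ r v, ?_⟩
  conv_rhs => rw [← toCofree_ofCofree f]
  refine Hom.ext_apply fun v n => ?_
  rw [Hom.comp_app, toCofree_app, toCofree_app, ← i.app_X, ← i.app_X, ← i.app_Y, hβ', hβ', hβ', hβ']

/-- The components of `fromCofree`, at vertices that are written as `u.succ.succ`. -/
def fromCofreeAux {N : Rep k} (ψ : ∀ v, B v.succ.succ →ₗ[k] N.obj v) (u : Vertex) :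
    (cofree (k := k) B).obj u.succ.succ →ₗ[k] N.obj u.succ.succ where
  -- The last coordinate is the top of the module; the others are the coefficients of the images of
  -- the top under `X`, `Y` and `X²`.
  toFun p := ψ _ p.2.2 + N.X _ (ψ _ p.2.1.1) + N.Y _ (ψ _ p.2.1.2) + N.X _ (N.X _ (ψ u p.1))
  map_add' p q := by
    change ψ _ (p.2.2 + q.2.2) + N.X _ (ψ _ (p.2.1.1 + q.2.1.1)) +
      N.Y _ (ψ _ (p.2.1.2 + q.2.1.2)) + N.X _ (N.X _ (ψ u (p.1 + q.1))) = _
    simp only [map_add]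
    abel
  map_smul' c p := by
    change ψ _ (c • p.2.2) + N.X _ (ψ _ (c • p.2.1.1)) +
      N.Y _ (ψ _ (c • p.2.1.2)) + N.X _ (N.X _ (ψ u (c • p.1))) = _
    simp only [map_smul, smul_add, RingHom.id_apply]

/-- The components of `fromCofree`. -/
noncomputable def fromCofreeApp {N : Rep k} (ψ : ∀ v, B v.succ.succ →ₗ[k] N.obj v) (w : Vertex) :
    (cofree (k := k) B).obj w →ₗ[k] N.obj w :=
  Vertex.succRec (C := fun w => (cofree (k := k) B).obj w →ₗ[k] N.obj w) (fun u' =>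
    Vertex.succRec (C := fun w => (cofree (k := k) B).obj w.succ →ₗ[k] N.obj w.succ)
      (fromCofreeAux ψ) u') w

theorem fromCofreeApp_mk {N : Rep k} (ψ : ∀ v, B v.succ.succ →ₗ[k] N.obj v) (u : Vertex)
    (b₀ : B u.succ.succ) (b₁ b₂ : B u.succ.succ.succ) (b₃ : B u.succ.succ.succ.succ) :
    fromCofreeApp ψ u.succ.succ (cofree.mk b₀ b₁ b₂ b₃) =
      ψ _ b₃ + N.X _ (ψ _ b₁) + N.Y _ (ψ _ b₂) + N.X _ (N.X _ (ψ u b₀)) := by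
  rw [fromCofreeApp, Vertex.succRec_succ, Vertex.succRec_succ]
  rfl

/-- The homomorphism from a cofree representation given by a family of linear maps on its top. -/
noncomputable def fromCofree {N : Rep k} (ψ : ∀ v, B v.succ.succ →ₗ[k] N.obj v) :
    Hom (cofree B) N :=
  Hom.ofXY (fromCofreeApp ψ)
    (fun v m => by
      obtain ⟨v, rfl⟩ := v.exists_succ_eq
      obtain ⟨v, rfl⟩ := v.exists_succ_eq
      obtain ⟨b₀, b₁, b₂, b₃, rfl⟩ := cofree.exists_mk m
      rw [cofree.X_mk, fromCofreeApp_mk, fromCofreeApp_mk]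
      simp only [map_add, map_zero, N.X_Y, N.X_X_X]
      abel)
    (fun v m => by
      obtain ⟨v, rfl⟩ := v.exists_succ_eq
      obtain ⟨v, rfl⟩ := v.exists_succ_eq
      obtain ⟨b₀, b₁, b₂, b₃, rfl⟩ := cofree.exists_mk m
      rw [cofree.Y_mk, fromCofreeApp_mk, fromCofreeApp_mk]
      simp only [map_add, map_zero, N.Y_X, N.Y_Y]
      abel)

theorem fromCofree_app {N : Rep k} (ψ : ∀ v, B v.succ.succ →ₗ[k] N.obj v) (u : Vertex)
    (b₀ : B u.succ.succ) (b₁ b₂ : B u.succ.succ.succ) (b₃ : B u.succ.succ.succ.succ) :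
    (fromCofree ψ).app u.succ.succ (cofree.mk b₀ b₁ b₂ b₃) =
      ψ _ b₃ + N.X _ (ψ _ b₁) + N.Y _ (ψ _ b₂) + N.X _ (N.X _ (ψ u b₀)) := by
  exact fromCofreeApp_mk ψ u b₀ b₁ b₂ b₃

theorem fromCofree_top {N : Rep k} (ψ : ∀ v, B v.succ.succ →ₗ[k] N.obj v) (v : Vertex)
    (b : B v.succ.succ) : (fromCofree ψ).app v (cofree.mk 0 0 0 b) = ψ v b := by
  obtain ⟨v, rfl⟩ := v.exists_succ_eq
  obtain ⟨v, rfl⟩ := v.exists_succ_eq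
  simp [fromCofree_app]

/-- Homomorphisms from a cofree representation are determined by their values on the top. -/
theorem cofree_hom_ext {N : Rep k} {f g : Hom (cofree B) N}
    (h : ∀ v (b : B v.succ.succ), f.app v (cofree.mk 0 0 0 b) = g.app v (cofree.mk 0 0 0 b)) : f = g := by
  refine Hom.ext_apply fun v p => ?_
  obtain ⟨v, rfl⟩ := v.exists_succ_eq
  obtain ⟨v, rfl⟩ := v.exists_succ_eq
  obtain ⟨b₀, b₁, b₂, b₃, rfl⟩ := cofree.exists_mk p
  have : (cofree.mk b₀ b₁ b₂ b₃ : (cofree (k := k) B).obj v.succ.succ) =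
      cofree.mk 0 0 0 b₃ + (cofree B).X _ (cofree.mk 0 0 0 b₁) + (cofree B).Y _ (cofree.mk 0 0 0 b₂) +
        (cofree B).X _ ((cofree B).X _ (cofree.mk 0 0 0 b₀)) := by
    simp only [cofree.X_mk, cofree.Y_mk, cofree.mk_add, add_zero, zero_add]
  rw [this]
  simp only [map_add, Hom.app_X, Hom.app_Y, h]

-- A cofree module is also free on its last coordinates, and linear maps lift along surjections of
-- vector spaces. So these modules are projective as well as injective.
variable (B) in
theorem cofree_isProjective : (cofree (k := k) B).IsProjective := by
  intro X Y _ _ g hg f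
  choose s hs using fun v => (g.app v).exists_rightInverse_of_surjective
    (LinearMap.range_eq_top.2 (hg v))
  refine ⟨fromCofree fun v => s v ∘ₗ f.app v ∘ₗ
    (LinearMap.inr k (B v) ((B v.succ × B v.succ) × B v.succ.succ) ∘ₗ
      LinearMap.inr k (B v.succ × B v.succ) (B v.succ.succ)), cofree_hom_ext fun v b => ?_⟩
  rw [Hom.comp_app, fromCofree_top]
  exact LinearMap.congr_fun (hs v) _

theorem cofree_isFinite (hB : ∀ v, Module.Finite k (B v)) (hs : {v | Nontrivial (B v)}.Finite) :
    (cofree (k := k) B).IsFinite := by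
  refine ⟨fun v => ?_, ?_⟩
  · have := hB v
    have := hB v.succ
    have := hB v.succ.succ
    exact (inferInstance : Module.Finite k (B v × (B v.succ × B v.succ) × B v.succ.succ))
  · have h1 := hs.preimage (f := Vertex.succ) Vertex.succ_injective.injOn
    have h2 := h1.preimage (f := Vertex.succ) Vertex.succ_injective.injOn
    refine ((hs.union h1).union h2).subset fun v hv => ?_
    change Nontrivial (B v × (B v.succ × B v.succ) × B v.succ.succ) at hv
    by_contra hcon
    simp only [Set.mem_union, Set.mem_preimage, Set.mem_ofPred_eq, not_or,
      not_nontrivial_iff_subsingleton] at hcon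
    obtain ⟨⟨_, _⟩, _⟩ := hcon
    exact not_nontrivial _ hv

end Cofree

/-! ### Cofree representations at a single vertex -/

section Single

variable {k : Type u} [Field k]

/-- The family that is concentrated at a single vertex. -/
abbrev Single (t : Vertex) (A : Type u) (w : Vertex) : Type u := PLift (w = t) → A

theorem single_ext {A : Type u} {t : Vertex} {a b : Single t A t} (h : a ⟨rfl⟩ = b ⟨rfl⟩) :
    a = b :=
  funext fun _ => h

variable (A : Type u) [AddCommGroup A] [Module k A]

theorem single_cofree_isFinite (t : Vertex) [Module.Finite k A] :
    (cofree (k := k) (Single t A)).IsFinite := by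
  refine cofree_isFinite (fun v => ?_) ((Set.finite_singleton t).subset fun v hv => ?_)
  · exact (inferInstance : Module.Finite k (PLift (v = t) → A))
  · by_contra hcon
    obtain ⟨a, b, hab⟩ := hv
    exact hab (funext fun h => absurd h.down hcon)

end Single


/-! ### Kronecker modules -/

/-- Two parallel linear maps. -/
structure Kron (R : Type u) [CommRing R] : Type (u + 1) where
  V : Type u
  W : Type u
  [grpV : AddCommGroup V]
  [modV : Module R V]
  [grpW : AddCommGroup W]
  [modW : Module R W]
  x : V →ₗ[R] W
  y : V →ₗ[R] W

attribute [instance] Kron.grpV Kron.modV Kron.grpW Kron.modW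

section Place

variable {R : Type u} [CommRing R]

/-- The transport between the components of a representation at equal vertices. -/
def Rep.castObj (N : Rep R) {v w : Vertex} (h : v = w) : N.obj v →ₗ[R] N.obj w :=
  h ▸ LinearMap.id

@[simp] theorem Rep.castObj_rfl (N : Rep R) {v : Vertex} (h : v = v) (n : N.obj v) :
    N.castObj h n = n := rfl

/-- A Kronecker module as a representation that is concentrated at `v` and its successor. -/
def place (v : Vertex) (K : Kron R) : Rep R :=
  -- A function on `PLift (w = v)` is a vector if `w = v` and carries nothing otherwise; this places
  -- both spaces without transporting types.
  Rep.ofXY (fun w => (PLift (w = v) → K.V) × (PLift (w = v.succ) → K.W))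
    (fun _ =>
      { toFun := fun p => (0, fun h => K.x (p.1 ⟨Vertex.succ_injective h.down⟩))
        map_add' := fun p q => Prod.ext (by simp) (by ext; simp)
        map_smul' := fun c p => Prod.ext (by simp) (by ext; simp) })
    (fun _ =>
      { toFun := fun p => (0, fun h => K.y (p.1 ⟨Vertex.succ_injective h.down⟩))
        map_add' := fun p q => Prod.ext (by simp) (by ext; simp)
        map_smul' := fun c p => Prod.ext (by simp) (by ext; simp) })
    (fun _ _ => Prod.ext rfl (funext fun _ => (map_zero K.y).trans (map_zero K.x).symm))
    (fun _ _ => Prod.ext rfl (funext fun _ => map_zero K.x))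
    (fun _ _ => Prod.ext rfl (funext fun _ => map_zero K.y))

namespace place

variable (v : Vertex) (K : Kron R)

/-- The component at the first vertex. -/
def fst : (place v K).obj v ≃ₗ[R] K.V where
  toFun p := p.1 ⟨rfl⟩
  map_add' _ _ := rfl
  map_smul' _ _ := rfl
  invFun a := (fun _ => a, 0)
  left_inv _ := Prod.ext rfl (funext fun h => absurd h.down v.succ_ne.symm)
  right_inv _ := rfl

/-- The component at the second vertex. -/
def snd : (place v K).obj v.succ ≃ₗ[R] K.W where
  toFun p := p.2 ⟨rfl⟩
  map_add' _ _ := rfl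
  map_smul' _ _ := rfl
  invFun b := (0, fun _ => b)
  left_inv _ := Prod.ext (funext fun h => absurd h.down v.succ_ne) rfl
  right_inv _ := rfl

variable {v K}

theorem snd_X (p : (place v K).obj v) : snd v K ((place v K).X v p) = K.x (fst v K p) := by
  cases v <;> rfl

theorem snd_Y (p : (place v K).obj v) : snd v K ((place v K).Y v p) = K.y (fst v K p) := by
  cases v <;> rfl

theorem subsingleton {w : Vertex} (h : w ≠ v) (h' : w ≠ v.succ) :
    Subsingleton ((place v K).obj w) :=
  ⟨fun _ _ => Prod.ext (funext fun i => absurd i.down h) (funext fun i => absurd i.down h')⟩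

theorem eq_zero {w : Vertex} (h : w ≠ v) (h' : w ≠ v.succ) (p : (place v K).obj w) : p = 0 :=
  (subsingleton h h').elim _ _

/-- Every vertex is the first one, the second one, or carries nothing. -/
theorem ext_iff {w : Vertex} {p q : (place v K).obj w} :
    p = q ↔ (∀ h : w = v, fst v K ((place v K).castObj h p) = fst v K ((place v K).castObj h q)) ∧
      ∀ h : w = v.succ, snd v K ((place v K).castObj h p) = snd v K ((place v K).castObj h q) := by
  refine ⟨by rintro rfl; simp, fun ⟨h1, h2⟩ => ?_⟩
  by_cases h : w = v
  · subst h
    exact (fst _ K).injective (h1 rfl)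
  · by_cases h' : w = v.succ
    · subst h'
      exact (snd _ K).injective (h2 rfl)
    · exact (subsingleton h h').elim _ _

end place

theorem place_isFinite (v : Vertex) (K : Kron R) [Module.Finite R K.V] [Module.Finite R K.W] :
    (place v K).IsFinite := by
  refine ⟨fun w => ?_, ((Set.finite_singleton v.succ).insert v).subset fun w hw => ?_⟩
  · exact (inferInstance : Module.Finite R
      ((PLift (w = v) → K.V) × (PLift (w = v.succ) → K.W)))
  · by_contra hcon
    simp only [Set.mem_insert_iff, Set.mem_singleton_iff, not_or] at hcon
    have := place.subsingleton (K := K) hcon.1 hcon.2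
    exact not_nontrivial _ hw

/-- Homomorphisms to a Kronecker module. -/
def toPlace {N : Rep R} {v : Vertex} {K : Kron R} (f₀ : N.obj v →ₗ[R] K.V)
    (f₁ : N.obj v.succ →ₗ[R] K.W) (hx : ∀ n, f₁ (N.X v n) = K.x (f₀ n))
    (hy : ∀ n, f₁ (N.Y v n) = K.y (f₀ n))
    (hX : ∀ u (h : Vertex.succ u = v) n, f₀ (N.castObj h (N.X u n)) = 0)
    (hY : ∀ u (h : Vertex.succ u = v) n, f₀ (N.castObj h (N.Y u n)) = 0) : Hom N (place v K) :=
  Hom.ofXY (fun w => (LinearMap.pi fun h => f₀ ∘ₗ N.castObj h.down).prod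
      (LinearMap.pi fun h => f₁ ∘ₗ N.castObj h.down))
    (fun w n => by
      refine place.ext_iff.2 ⟨fun h => ?_, fun h => ?_⟩
      · subst h
        refine (hX w rfl n).trans ?_
        cases w <;> rfl
      · obtain rfl := Vertex.succ_injective h
        refine (hx n).trans ?_
        cases w <;> rfl)
    (fun w n => by
      refine place.ext_iff.2 ⟨fun h => ?_, fun h => ?_⟩
      · subst h
        refine (hY w rfl n).trans ?_
        cases w <;> rfl
      · obtain rfl := Vertex.succ_injective h
        refine (hy n).trans ?_
        cases w <;> rfl)

section toPlace

variable {N : Rep R} {v : Vertex} {K : Kron R} (f₀ : N.obj v →ₗ[R] K.V)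
    (f₁ : N.obj v.succ →ₗ[R] K.W) (hx : ∀ n, f₁ (N.X v n) = K.x (f₀ n))
    (hy : ∀ n, f₁ (N.Y v n) = K.y (f₀ n))
    (hX : ∀ u (h : Vertex.succ u = v) n, f₀ (N.castObj h (N.X u n)) = 0)
    (hY : ∀ u (h : Vertex.succ u = v) n, f₀ (N.castObj h (N.Y u n)) = 0)

theorem fst_toPlace (n : N.obj v) :
    place.fst v K ((toPlace f₀ f₁ hx hy hX hY).app v n) = f₀ n := rfl

end toPlace

open Classical in
/-- Homomorphisms from a Kronecker module. -/
noncomputable def fromPlace {N : Rep R} {v : Vertex} {K : Kron R} (f₀ : K.V →ₗ[R] N.obj v)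
    (f₁ : K.W →ₗ[R] N.obj v.succ) (hx : ∀ a, N.X v (f₀ a) = f₁ (K.x a))
    (hy : ∀ a, N.Y v (f₀ a) = f₁ (K.y a)) (hX : ∀ b, N.X _ (f₁ b) = 0)
    (hY : ∀ b, N.Y _ (f₁ b) = 0) : Hom (place v K) N :=
  have h₀ : ∀ p : (place v K).obj v, (if h : v = v then
      N.castObj h.symm ∘ₗ f₀ ∘ₗ (place.fst v K).toLinearMap ∘ₗ (place v K).castObj h
      else if h : v = v.succ then
        N.castObj h.symm ∘ₗ f₁ ∘ₗ (place.snd v K).toLinearMap ∘ₗ (place v K).castObj h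
      else 0) p = f₀ (place.fst v K p) := fun p => by rw [dif_pos rfl]; rfl
  have h₁ : ∀ p : (place v K).obj v.succ, (if h : v.succ = v then
      N.castObj h.symm ∘ₗ f₀ ∘ₗ (place.fst v K).toLinearMap ∘ₗ (place v K).castObj h
      else if h : v.succ = v.succ then
        N.castObj h.symm ∘ₗ f₁ ∘ₗ (place.snd v K).toLinearMap ∘ₗ (place v K).castObj h
      else 0) p = f₁ (place.snd v K p) := fun p => by
    rw [dif_neg v.succ_ne, dif_pos rfl]; rfl
  Hom.ofXY (fun w => if h : w = v then
      N.castObj h.symm ∘ₗ f₀ ∘ₗ (place.fst v K).toLinearMap ∘ₗ (place v K).castObj h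
      else if h : w = v.succ then
        N.castObj h.symm ∘ₗ f₁ ∘ₗ (place.snd v K).toLinearMap ∘ₗ (place v K).castObj h
      else 0)
    (fun w p => by
      by_cases h : w = v
      · subst h
        rw [h₀, h₁, place.snd_X, hx]
      · by_cases h' : w = v.succ
        · subst h'
          rw [h₁, hX, place.eq_zero v.succ_succ_ne
            (fun h => v.succ_ne (Vertex.succ_injective h)) ((place v K).X _ p), map_zero]
        · rw [place.eq_zero h h' p]
          simp only [map_zero])
    (fun w p => by
      by_cases h : w = v
      · subst h
        rw [h₀, h₁, place.snd_Y, hy]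
      · by_cases h' : w = v.succ
        · subst h'
          rw [h₁, hY, place.eq_zero v.succ_succ_ne
            (fun h => v.succ_ne (Vertex.succ_injective h)) ((place v K).Y _ p), map_zero]
        · rw [place.eq_zero h h' p]
          simp only [map_zero])

section fromPlace

variable {N : Rep R} {v : Vertex} {K : Kron R} (f₀ : K.V →ₗ[R] N.obj v)
    (f₁ : K.W →ₗ[R] N.obj v.succ) (hx : ∀ a, N.X v (f₀ a) = f₁ (K.x a))
    (hy : ∀ a, N.Y v (f₀ a) = f₁ (K.y a)) (hX : ∀ b, N.X _ (f₁ b) = 0)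
    (hY : ∀ b, N.Y _ (f₁ b) = 0)

open Classical in
theorem fromPlace_fst (p : (place v K).obj v) :
    (fromPlace f₀ f₁ hx hy hX hY).app v p = f₀ (place.fst v K p) := by
  unfold fromPlace
  change (dite _ _ _ : _ →ₗ[R] _) p = _
  rw [dif_pos rfl]; rfl

end fromPlace

theorem place_hom_ext {N : Rep R} {v : Vertex} {K : Kron R} {f g : Hom (place v K) N}
    (h₀ : ∀ p, f.app v p = g.app v p) (h₁ : ∀ p, f.app v.succ p = g.app v.succ p) : f = g := by
  refine Hom.ext_apply fun w p => ?_
  by_cases h : w = v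
  · subst h; exact h₀ p
  · by_cases h' : w = v.succ
    · subst h'; exact h₁ p
    · rw [place.eq_zero h h' p, map_zero, map_zero]

theorem hom_place_ext {N : Rep R} {v : Vertex} {K : Kron R} {f g : Hom N (place v K)}
    (h₀ : ∀ p, f.app v p = g.app v p) (h₁ : ∀ p, f.app v.succ p = g.app v.succ p) : f = g := by
  refine Hom.ext_apply fun w p => ?_
  by_cases h : w = v
  · subst h; exact h₀ p
  · by_cases h' : w = v.succ
    · subst h'; exact h₁ p
    · exact (place.subsingleton h h').elim _ _

/-- Homomorphisms between Kronecker modules at the same vertex. -/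
def placeHom {v : Vertex} {K L : Kron R} (f₀ : K.V →ₗ[R] L.V) (f₁ : K.W →ₗ[R] L.W)
    (hx : ∀ a, f₁ (K.x a) = L.x (f₀ a)) (hy : ∀ a, f₁ (K.y a) = L.y (f₀ a)) :
    Hom (place v K) (place v L) :=
  toPlace (f₀ ∘ₗ (place.fst v K).toLinearMap) (f₁ ∘ₗ (place.snd v K).toLinearMap)
    (fun n => by
      simp only [LinearMap.comp_apply, LinearEquiv.coe_coe]
      rw [place.snd_X, hx])
    (fun n => by
      simp only [LinearMap.comp_apply, LinearEquiv.coe_coe]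
      rw [place.snd_Y, hy])
    (fun u h n => by
      subst h
      rw [place.eq_zero u.succ_ne.symm u.succ_succ_ne.symm n, map_zero, map_zero, map_zero])
    (fun u h n => by
      subst h
      rw [place.eq_zero u.succ_ne.symm u.succ_succ_ne.symm n, map_zero, map_zero, map_zero])

/-- A homomorphism to a Kronecker module that is bijective at its two vertices is bijective, if
nothing lives at the other vertices. -/
theorem toPlace_bijective {N : Rep R} {v : Vertex} {K : Kron R} (f : Hom N (place v K))
    (hN : ∀ w, w ≠ v → w ≠ v.succ → Subsingleton (N.obj w)) (h₀ : Function.Bijective (f.app v))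
    (h₁ : Function.Bijective (f.app v.succ)) (w : Vertex) : Function.Bijective (f.app w) := by
  by_cases h : w = v
  · subst h; exact h₀
  · by_cases h' : w = v.succ
    · subst h'; exact h₁
    · have := hN w h h'
      have := place.subsingleton (K := K) h h'
      exact ⟨fun _ _ _ => Subsingleton.elim _ _, fun b => ⟨0, Subsingleton.elim _ _⟩⟩

/-- The Kronecker module given by the components of a representation at a vertex and its
successor. -/
@[reducible] def Rep.kron (N : Rep R) (v : Vertex) : Kron R :=
  ⟨N.obj v, N.obj v.succ, N.X v, N.Y v⟩

/-- A representation that is concentrated at a vertex and its successor. -/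
noncomputable def isoPlace (N : Rep R) (v : Vertex)
    (hN : ∀ w, w ≠ v → w ≠ v.succ → Subsingleton (N.obj w)) {K : Kron R}
    (e₀ : N.obj v ≃ₗ[R] K.V) (e₁ : N.obj v.succ ≃ₗ[R] K.W) (hx : ∀ n, e₁ (N.X v n) = K.x (e₀ n))
    (hy : ∀ n, e₁ (N.Y v n) = K.y (e₀ n)) : Iso N (place v K) :=
  have hu : ∀ u : Vertex, u.succ = v → ∀ n : N.obj u, n = 0 := fun u h n => by
    subst h
    exact (hN u u.succ_ne.symm u.succ_succ_ne.symm).elim _ _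
  (toPlace e₀.toLinearMap e₁.toLinearMap hx hy
    (fun u h n => by rw [hu u h n, map_zero, map_zero, map_zero])
    (fun u h n => by rw [hu u h n, map_zero, map_zero, map_zero])).toIso
    (toPlace_bijective _ hN ((Function.Bijective.of_comp_iff' (place.fst v K).bijective _).1 e₀.bijective)
      ((Function.Bijective.of_comp_iff' (place.snd v K).bijective _).1 e₁.bijective))

/-- A Kronecker module whose first component vanishes is concentrated at one vertex. -/
noncomputable def placeShift (v : Vertex) (K : Kron R) [Subsingleton K.W] :
    Iso (place v.succ K) (place v ⟨PUnit.{u + 1}, K.V, 0, 0⟩) :=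
  have h0 : ∀ w, w ≠ v.succ → Subsingleton ((place v.succ K).obj w) := fun w h => by
    by_cases h' : w = v.succ.succ
    · subst h'
      exact (place.snd v.succ K).injective.subsingleton
    · exact place.subsingleton h h'
  have := h0 v v.succ_ne.symm
  isoPlace _ v (fun w _ h' => h0 w h')
    { toFun := fun _ => PUnit.unit, invFun := fun _ => 0, map_add' := fun _ _ => rfl,
      map_smul' := fun _ _ => rfl, left_inv := fun _ => Subsingleton.elim _ _,
      right_inv := fun _ => rfl }
    (place.fst v.succ K)
    (fun n => by rw [Subsingleton.elim n 0, map_zero, map_zero]; rfl)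
    (fun n => by rw [Subsingleton.elim n 0, map_zero, map_zero]; rfl)

end Place


section Structure

variable {k : Type u} [Field k]

/-! ### Generated and cogenerated Kronecker modules -/

/-- The second space is generated by the images of the first one. -/
def Kron.Gen (K : Kron k) : Prop := ∀ b, ∃ a a', b = K.x a + K.y a'

/-- No nonzero vector is annihilated by both maps. -/
def Kron.Cogen (K : Kron k) : Prop := ∀ a, K.x a = 0 → K.y a = 0 → a = 0

/-- Every endomorphism that factors through a finite projective module vanishes. -/
def Rep.StablyFaithful (N : Rep k) : Prop :=
  ∀ P : Rep k, P.IsFinite → P.IsProjective → ∀ (i : Hom N P) (p : Hom P N), p.comp i = 0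

theorem Rep.StablyFaithful.of_iso {M N : Rep k} (e : Iso M N) (h : M.StablyFaithful) :
    N.StablyFaithful := by
  intro P hP hP' i p
  have := h P hP hP' (i.comp e.hom) (e.symm.hom.comp p)
  refine Hom.ext_apply fun v n => (e.app v).symm.injective ?_
  have h2 := Hom.congr_apply this v ((e.app v).symm n)
  change (e.app v).symm (p.app v (i.app v (e.app v ((e.app v).symm n)))) = 0 at h2
  rw [LinearEquiv.apply_symm_apply] at h2
  exact h2.trans (map_zero (e.app v).symm).symm

/-- Otherwise the identity of `N` would factor through the projective module `N`. -/
theorem Rep.StablyFaithful.not_isProjective {N : Rep k} (h : N.StablyFaithful) (hN : N.IsFinite)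
    (h0 : N.IsNonzero) : ¬ N.IsProjective := by
  intro hp
  obtain ⟨v, hv⟩ := h0
  obtain ⟨n, hn⟩ := exists_ne (0 : N.obj v)
  exact hn (Hom.congr_apply (h N hN hp (Hom.id N) (Hom.id N)) v n)

/-- Elements of a projective module that are annihilated by the paths of length two lie in the
radical. -/
theorem Rep.IsProjective.mem_rad {P : Rep k} (hP : P.IsProjective) (u : Vertex)
    (q : P.obj u.succ) (hq : P.X _ (P.X _ q) = 0) : ∃ a b, q = P.X u a + P.Y u b := by
  by_contra hcon
  have hq' : q ∉ LinearMap.range (P.X u) ⊔ LinearMap.range (P.Y u) := by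
    intro h
    obtain ⟨_, ⟨a, rfl⟩, _, ⟨b, rfl⟩, h⟩ := Submodule.mem_sup.1 h
    exact hcon ⟨a, b, h.symm⟩
  -- A linear form that separates `q` from the radical is a homomorphism `f` to the simple module
  -- `S` at `u.succ`.
  obtain ⟨l, hl, hl'⟩ := Submodule.exists_le_ker_of_notMem hq'
  let S : Rep k := place u.succ ⟨k, PUnit.{u + 1}, 0, 0⟩
  let C : Rep k := cofree (Single u.succ.succ.succ k)
  let f : Hom P S := toPlace (K := ⟨k, PUnit.{u + 1}, 0, 0⟩) l 0 (fun _ => rfl) (fun _ => rfl)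
    (fun w h n => by
      obtain rfl := Vertex.succ_injective h
      exact hl' (Submodule.mem_sup_left ⟨n, rfl⟩))
    (fun w h n => by
      obtain rfl := Vertex.succ_injective h
      exact hl' (Submodule.mem_sup_right ⟨n, rfl⟩))
  let π : C.obj u.succ →ₗ[k] k :=
    { toFun := fun p => p.2.2 ⟨rfl⟩
      map_add' := fun _ _ => rfl
      map_smul' := fun _ _ => rfl }
  let g : Hom C S := toPlace (K := ⟨k, PUnit.{u + 1}, 0, 0⟩) π 0 (fun _ => rfl) (fun _ => rfl)
    (fun w h n => by
      obtain rfl := Vertex.succ_injective h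
      obtain ⟨b₀, b₁, b₂, b₃, rfl⟩ := cofree.exists_mk n
      change π (C.X _ _) = 0
      rw [cofree.X_mk]
      rfl)
    (fun w h n => by
      obtain rfl := Vertex.succ_injective h
      obtain ⟨b₀, b₁, b₂, b₃, rfl⟩ := cofree.exists_mk n
      change π (C.Y _ _) = 0
      rw [cofree.Y_mk]
      rfl)
  have hS : S.IsFinite := by
    have : Module.Finite k (⟨k, PUnit.{u + 1}, 0, 0⟩ : Kron k).V :=
      (inferInstance : Module.Finite k k)
    have : Module.Finite k (⟨k, PUnit.{u + 1}, 0, 0⟩ : Kron k).W :=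
      (inferInstance : Module.Finite k PUnit.{u + 1})
    exact place_isFinite _ _
  have hg : ∀ v, Function.Surjective (g.app v) := by
    intro v p
    by_cases h : v = u.succ
    · subst h
      refine ⟨cofree.mk 0 0 0 fun _ => place.fst _ _ p, (place.fst _ _).injective ?_⟩
      exact fst_toPlace (K := ⟨k, PUnit.{u + 1}, 0, 0⟩) ..
    · by_cases h' : v = u.succ.succ
      · subst h'
        exact ⟨0, (place.snd u.succ ⟨k, PUnit.{u + 1}, 0, 0⟩).injective rfl⟩
      · exact ⟨0, (place.subsingleton h h').elim _ _⟩
  -- Lift `f` along the projective cover `C` of `S`. The lift sends `q` to an element with nonzero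
  -- top coordinate, which `X²` does not kill, contrary to `X² q = 0`.
  obtain ⟨t, ht⟩ := hP C S (single_cofree_isFinite k _) hS g hg f
  obtain ⟨b₀, b₁, b₂, b₃, hb⟩ := cofree.exists_mk (t.app u.succ q)
  have h1 : b₃ ⟨rfl⟩ = l q := by
    have h2 := congrArg (place.fst u.succ ⟨k, PUnit.{u + 1}, 0, 0⟩) (Hom.congr_apply ht u.succ q)
    rw [Hom.comp_app, hb] at h2
    exact h2
  have h3 : t.app _ (P.X _ (P.X _ q)) = cofree.mk b₃ 0 0 0 := by
    rw [t.app_X, t.app_X, hb, cofree.X_mk, cofree.X_mk]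
  rw [hq, map_zero, ← cofree.mk_zero] at h3
  have h4 := congrFun (cofree.mk_inj h3).1 ⟨rfl⟩
  exact hl (h1.symm.trans h4.symm)

/-- An element `n` at `v` has `X² n = 0`, so its image in `P` lies in the radical, that is, it comes
from the vertex before `v`. There the Kronecker module vanishes, so the map back kills it. The
elements at `v` generate the module. -/
theorem Kron.Gen.stablyFaithful {K : Kron k} (hK : K.Gen) (v : Vertex) :
    (place v K).StablyFaithful := by
  intro P hP hP' i p
  have h0 : ∀ n : (place v K).obj v, p.app v (i.app v n) = 0 := by
    intro n
    obtain ⟨u, rfl⟩ := v.exists_succ_eq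
    have h1 : P.X _ (P.X _ (i.app _ n)) = 0 := by
      rw [← i.app_X, ← i.app_X, place.eq_zero u.succ.succ_succ_ne
        (fun h => u.succ.succ_ne (Vertex.succ_injective h)) ((place u.succ K).X _ _), map_zero]
    obtain ⟨a, b, hab⟩ := hP'.mem_rad u _ h1
    rw [hab, map_add, p.app_X, p.app_Y, place.eq_zero u.succ_ne.symm u.succ_succ_ne.symm (p.app u a),
      place.eq_zero u.succ_ne.symm u.succ_succ_ne.symm (p.app u b), map_zero, map_zero, add_zero]
  refine place_hom_ext h0 fun n => ?_
  obtain ⟨a, a', h⟩ := hK (place.snd v K n)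
  have hn : n = (place v K).X v ((place.fst v K).symm a) +
      (place v K).Y v ((place.fst v K).symm a') := by
    apply (place.snd v K).injective
    rw [map_add, place.snd_X, place.snd_Y, LinearEquiv.apply_symm_apply,
      LinearEquiv.apply_symm_apply, h]
  change p.app _ (i.app _ n) = 0
  rw [hn]
  simp only [map_add, Hom.app_X, Hom.app_Y, h0, map_zero, add_zero]

/-! ### Indecomposability -/

/-- The projection onto a direct summand is an endomorphism. If it is the scalar `c`, the summand
vanishes for `c = 0` and its complement vanishes for `c ≠ 0`. -/
theorem Rep.isIndecomposable_of_endo_scalar {N : Rep k} (h0 : N.IsNonzero)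
    (h : ∀ f : Hom N N, ∃ c : k, ∀ v n, f.app v n = c • n) : N.IsIndecomposable := by
  refine ⟨h0, fun A B hA hB hAB => ?_⟩
  have hpX : ∀ v n, (A v.succ).projection _ (hAB v.succ) (N.X v n) =
      N.X v ((A v).projection _ (hAB v) n) := fun v n => by
    obtain ⟨a, ha, b, hb, rfl⟩ := Submodule.mem_sup.1
      ((hAB v).sup_eq_top ▸ Submodule.mem_top : n ∈ A v ⊔ B v)
    simp only [map_add, Submodule.projection_apply_of_mem_left (hAB v) ha,
      Submodule.projection_apply_of_mem_right (hAB v) hb,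
      Submodule.projection_apply_of_mem_left (hAB v.succ) (hA.X_mem v _ ha),
      Submodule.projection_apply_of_mem_right (hAB v.succ) (hB.X_mem v _ hb), map_zero]
  have hpY : ∀ v n, (A v.succ).projection _ (hAB v.succ) (N.Y v n) =
      N.Y v ((A v).projection _ (hAB v) n) := fun v n => by
    obtain ⟨a, ha, b, hb, rfl⟩ := Submodule.mem_sup.1
      ((hAB v).sup_eq_top ▸ Submodule.mem_top : n ∈ A v ⊔ B v)
    simp only [map_add, Submodule.projection_apply_of_mem_left (hAB v) ha,
      Submodule.projection_apply_of_mem_right (hAB v) hb,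
      Submodule.projection_apply_of_mem_left (hAB v.succ) (hA.Y_mem v _ ha),
      Submodule.projection_apply_of_mem_right (hAB v.succ) (hB.Y_mem v _ hb), map_zero]
  obtain ⟨c, hc⟩ := h (Hom.ofXY (fun v => (A v).projection _ (hAB v)) hpX hpY)
  simp only [Hom.ofXY_app] at hc
  by_cases h1 : c = 0
  · refine .inl fun v => (Submodule.eq_bot_iff _).2 fun a ha => ?_
    rw [← Submodule.projection_apply_of_mem_left (hAB v) ha, hc, h1, zero_smul]
  · refine .inr fun v => (Submodule.eq_bot_iff _).2 fun b hb => ?_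
    have := hc v b
    rw [Submodule.projection_apply_of_mem_right (hAB v) hb] at this
    exact (smul_eq_zero.1 this.symm).resolve_left h1

/-- This turns decompositions of the two spaces that are respected by both maps into decompositions
of the representation. -/
theorem place_decomp {v : Vertex} {K : Kron k} (h : (place v K).IsIndecomposable)
    {A A' : Submodule k K.V} {B B' : Submodule k K.W} (hA : IsCompl A A') (hB : IsCompl B B')
    (hx : ∀ a ∈ A, K.x a ∈ B) (hy : ∀ a ∈ A, K.y a ∈ B) (hx' : ∀ a ∈ A', K.x a ∈ B')
    (hy' : ∀ a ∈ A', K.y a ∈ B') : (A = ⊥ ∧ B = ⊥) ∨ (A' = ⊥ ∧ B' = ⊥) := by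
  let N : Submodule k K.V → Submodule k K.W → ∀ w, Submodule k ((place v K).obj w) :=
    fun A B w => (Submodule.pi Set.univ fun _ => A).prod (Submodule.pi Set.univ fun _ => B)
  have mem : ∀ A B w p, p ∈ N A B w ↔ (∀ h, p.1 h ∈ A) ∧ ∀ h, p.2 h ∈ B :=
    fun A B w p => ⟨fun hp => ⟨fun h => hp.1 h trivial, fun h => hp.2 h trivial⟩,
      fun hp => ⟨fun h _ => hp.1 h, fun h _ => hp.2 h⟩⟩
  have sub : ∀ A B, (∀ a ∈ A, K.x a ∈ B) → (∀ a ∈ A, K.y a ∈ B) → (place v K).IsSubrep (N A B) := by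
    intro A B hx hy
    refine .of_XY (fun w p hp => ?_) (fun w p hp => ?_)
    · rw [mem] at hp ⊢
      refine ⟨fun h => ?_, fun h => ?_⟩
      · convert A.zero_mem
        cases w <;> rfl
      · convert hx _ (hp.1 ⟨Vertex.succ_injective h.down⟩)
        cases w <;> rfl
    · rw [mem] at hp ⊢
      refine ⟨fun h => ?_, fun h => ?_⟩
      · convert A.zero_mem
        cases w <;> rfl
      · convert hy _ (hp.1 ⟨Vertex.succ_injective h.down⟩)
        cases w <;> rfl
  have bot : ∀ A B, (∀ w, N A B w = ⊥) → A = ⊥ ∧ B = ⊥ := by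
    intro A B h
    refine ⟨(Submodule.eq_bot_iff _).2 fun a ha => ?_, (Submodule.eq_bot_iff _).2 fun b hb => ?_⟩
    · have h1 : (place.fst v K).symm a ∈ N A B v :=
        (mem _ _ _ _).2 ⟨fun _ => ha, fun _ => B.zero_mem⟩
      rw [h v, Submodule.mem_bot] at h1
      exact (LinearEquiv.map_eq_zero_iff _).1 h1
    · have h1 : (place.snd v K).symm b ∈ N A B v.succ :=
        (mem _ _ _ _).2 ⟨fun _ => A.zero_mem, fun _ => hb⟩
      rw [h v.succ, Submodule.mem_bot] at h1
      exact (LinearEquiv.map_eq_zero_iff _).1 h1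
  refine (h.2 (N A B) (N A' B') (sub A B hx hy) (sub A' B' hx' hy') fun w => ?_).imp
    (bot A B) (bot A' B')
  refine ⟨Submodule.disjoint_def.2 fun p hp hp' => ?_,
    codisjoint_iff.2 (eq_top_iff.2 fun p _ => ?_)⟩
  · rw [mem] at hp hp'
    exact Prod.ext (funext fun h => Submodule.disjoint_def.1 hA.disjoint _ (hp.1 h) (hp'.1 h))
      (funext fun h => Submodule.disjoint_def.1 hB.disjoint _ (hp.2 h) (hp'.2 h))
  · have hA1 : ∀ a : K.V, ∃ a₁ ∈ A, ∃ a₂ ∈ A', a₁ + a₂ = a := fun a => Submodule.mem_sup.1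
      (hA.sup_eq_top ▸ Submodule.mem_top)
    have hB1 : ∀ b : K.W, ∃ b₁ ∈ B, ∃ b₂ ∈ B', b₁ + b₂ = b := fun b => Submodule.mem_sup.1
      (hB.sup_eq_top ▸ Submodule.mem_top)
    choose a₁ ha₁ a₂ ha₂ ha using hA1
    choose b₁ hb₁ b₂ hb₂ hb using hB1
    refine Submodule.mem_sup.2 ⟨(fun h => a₁ (p.1 h), fun h => b₁ (p.2 h)),
      (mem _ _ _ _).2 ⟨fun h => ha₁ _, fun h => hb₁ _⟩, (fun h => a₂ (p.1 h), fun h => b₂ (p.2 h)),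
      (mem _ _ _ _).2 ⟨fun h => ha₂ _, fun h => hb₂ _⟩, ?_⟩
    exact Prod.ext (funext fun h => ha _) (funext fun h => hb _)

variable {v : Vertex} {K : Kron k}

/-- A complement of `xV + yV` in `W` splits off as a summand with first space zero. -/
theorem Rep.IsIndecomposable.gen [Nontrivial K.V] (h : (place v K).IsIndecomposable) : K.Gen := by
  obtain ⟨B', hB'⟩ := Submodule.exists_isCompl (LinearMap.range K.x ⊔ LinearMap.range K.y)
  rcases place_decomp h isCompl_top_bot hB' (fun a _ => Submodule.mem_sup_left ⟨a, rfl⟩)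
    (fun a _ => Submodule.mem_sup_right ⟨a, rfl⟩)
    (fun a ha => by rw [(Submodule.mem_bot k).1 ha, map_zero]; exact B'.zero_mem)
    (fun a ha => by rw [(Submodule.mem_bot k).1 ha, map_zero]; exact B'.zero_mem) with h1 | h1
  · exact absurd h1.1 top_ne_bot
  · intro b
    have hb : b ∈ LinearMap.range K.x ⊔ LinearMap.range K.y := by
      have := hB'.sup_eq_top
      rw [h1.2, sup_bot_eq] at this
      rw [this]; trivial
    obtain ⟨_, ⟨a, rfl⟩, _, ⟨b, rfl⟩, h⟩ := Submodule.mem_sup.1 hb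
    exact ⟨a, b, h.symm⟩

/-- The common kernel of `x` and `y` splits off as a summand with second space zero. -/
theorem Rep.IsIndecomposable.cogen [Nontrivial K.W] (h : (place v K).IsIndecomposable) :
    K.Cogen := by
  obtain ⟨A', hA'⟩ := Submodule.exists_isCompl (LinearMap.ker K.x ⊓ LinearMap.ker K.y)
  rcases place_decomp h hA' isCompl_bot_top (fun a ha => ha.1)
    (fun a ha => ha.2) (fun a _ => trivial) (fun a _ => trivial) with h1 | h1
  · intro a hx hy
    have : a ∈ LinearMap.ker K.x ⊓ LinearMap.ker K.y := ⟨hx, hy⟩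
    rwa [h1.1] at this
  · exact absurd h1.2 top_ne_bot

/-- With `V = 0` every line in `W` is a direct summand. -/
theorem Rep.IsIndecomposable.finrank_snd [Subsingleton K.V] (h : (place v K).IsIndecomposable) :
    Module.finrank k K.W = 1 := by
  have hz : ∀ a : K.V, a = 0 := fun a => Subsingleton.elim _ _
  have hW : ∃ b : K.W, b ≠ 0 := by
    by_contra hcon
    push Not at hcon
    obtain ⟨w, hw⟩ := h.1
    obtain ⟨p, hp⟩ := exists_ne (0 : (place v K).obj w)
    exact hp (Prod.ext (funext fun _ => hz _) (funext fun _ => hcon _))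
  obtain ⟨b, hb⟩ := hW
  obtain ⟨B', hB'⟩ := Submodule.exists_isCompl (k ∙ b)
  have hA : IsCompl (⊥ : Submodule k K.V) ⊥ := by
    rw [show (⊥ : Submodule k K.V) = ⊥ from rfl]
    exact ⟨disjoint_bot_left, codisjoint_iff.2 (Subsingleton.elim _ _)⟩
  rcases place_decomp h hA hB' (fun a _ => by rw [hz a, map_zero]; exact zero_mem _)
    (fun a _ => by rw [hz a, map_zero]; exact zero_mem _)
    (fun a _ => by rw [hz a, map_zero]; exact zero_mem _)
    (fun a _ => by rw [hz a, map_zero]; exact zero_mem _) with h1 | h1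
  · exact absurd (Submodule.span_singleton_eq_bot.1 h1.2) hb
  · have := hB'.sup_eq_top
    rw [h1.2, sup_bot_eq] at this
    rw [← finrank_top k K.W, ← this, finrank_span_singleton hb]

end Structure


section StableVertex

variable {k : Type u} [Field k]

/-! ### The shape of stable vertices -/

/-- Paths of length two act as zero on indecomposable nonprojective modules. -/
theorem Rep.IsIndecomposable.X_X_eq_zero {N : Rep k} (hN : N.IsIndecomposable)
    (hN' : ¬ N.IsProjective) (v : Vertex) (z : N.obj v) : N.X _ (N.X v z) = 0 := by
  classical
  by_contra hz
  obtain ⟨l, hl⟩ := Module.Projective.exists_dual_ne_zero k hz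
  let B := Single v.succ.succ k
  have key : ∀ w : Vertex, ∃ ψ : B w.succ.succ →ₗ[k] N.obj w, ∀ h : v = w, ∀ b,
      ψ b = b ⟨by rw [h]⟩ • N.castObj h z := by
    intro w
    by_cases h : v = w
    · subst h
      exact ⟨(LinearMap.toSpanSingleton k _ z) ∘ₗ LinearMap.proj ⟨rfl⟩, fun _ b => rfl⟩
    · exact ⟨0, fun h' => absurd h' h⟩
  choose ψ hψ using key
  -- `B` is chosen so that `cofree B` has its top at `v` and its socle at `v.succ.succ`. The map `i`
  -- sends the generator to `z`, and `q` is given by the form `l`, normalised to take the value `1`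
  -- at `X² z`. So `q ∘ i` fixes the top and is the identity.
  let i : Hom (cofree B) N := fromCofree ψ
  let q : Hom N (cofree B) := toCofree fun w =>
    LinearMap.pi fun h => (l (N.X _ (N.X v z)))⁻¹ • l ∘ₗ N.castObj h.down
  have hqi : q.comp i = Hom.id _ := by
    refine cofree_hom_ext fun w b => ?_
    rw [Hom.comp_app, fromCofree_top, toCofree_app, Hom.id_app]
    by_cases h : v = w
    · subst h
      rw [hψ v rfl b, N.castObj_rfl]
      congr 1
      · exact funext fun h => absurd h.down v.succ_succ_ne.symm
      · exact funext fun h => absurd h.down v.succ.succ_ne.symm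
      · exact funext fun h => absurd h.down v.succ.succ_ne.symm
      · refine single_ext ?_
        rw [map_smul, map_smul]
        change (l (N.X _ (N.X v z)))⁻¹ • l (b _ • N.X _ (N.X v z)) = _
        rw [map_smul, smul_comm, smul_eq_mul, smul_eq_mul, inv_mul_cancel₀ hl, mul_one]
    · have hb : b = 0 := funext fun h' =>
        absurd (Vertex.succ_injective (Vertex.succ_injective h'.down)).symm h
      subst hb
      simp only [map_zero]
  have hne : (cofree (k := k) B).IsNonzero := by
    refine ⟨v.succ.succ, ⟨cofree.mk (fun _ => 1) 0 0 0, 0, fun h => ?_⟩⟩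
    rw [← cofree.mk_zero] at h
    exact one_ne_zero (congrFun (cofree.mk_inj h).1 ⟨rfl⟩)
  obtain ⟨e⟩ := hN.iso_of_split hne i q hqi
  exact hN' ((cofree_isProjective B).of_iso e)

/-- A stable vertex is a Kronecker module that is generated by its first space. -/
theorem Rep.IsStableVertex.exists_gen {N : Rep k} (hN : N.IsStableVertex) :
    ∃ (v : Vertex) (K : Kron k), K.Gen ∧ Nontrivial K.V ∧ Nonempty (Iso N (place v K)) := by
  classical
  have hXX := hN.2.1.X_X_eq_zero hN.2.2
  have hYY : ∀ v n, N.Y _ (N.Y v n) = 0 := fun v n => by rw [N.Y_Y, hXX]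
  -- If the radical were all of `N`, then `N = rad² N = 0`, since paths of length two act as zero.
  obtain ⟨u, hu⟩ : ∃ u : Vertex, LinearMap.range (N.X u) ⊔ LinearMap.range (N.Y u) ≠ ⊤ := by
    by_contra hcon
    push Not at hcon
    obtain ⟨w, hw⟩ := hN.2.1.1
    obtain ⟨n, hn⟩ := exists_ne (0 : N.obj w)
    obtain ⟨w, rfl⟩ := w.exists_succ_eq
    obtain ⟨w, rfl⟩ := w.exists_succ_eq
    have h2 : ∀ m : N.obj w.succ, N.X _ m = 0 ∧ N.Y _ m = 0 := fun m => by
      obtain ⟨_, ⟨a, rfl⟩, _, ⟨b, rfl⟩, rfl⟩ :=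
        Submodule.mem_sup.1 (hcon w ▸ Submodule.mem_top : m ∈ _)
      simp only [map_add, hXX, hYY, N.X_Y, N.Y_X, add_zero, and_self]
    obtain ⟨_, ⟨a, rfl⟩, _, ⟨b, rfl⟩, rfl⟩ :=
      Submodule.mem_sup.1 (hcon w.succ ▸ Submodule.mem_top : n ∈ _)
    exact hn (by rw [(h2 a).1, (h2 b).2, add_zero])
  set rad := LinearMap.range (N.X u) ⊔ LinearMap.range (N.Y u) with hrad
  obtain ⟨C, hC⟩ := Submodule.exists_isCompl rad
  have hradX : ∀ m ∈ rad, N.X _ m = 0 ∧ N.Y _ m = 0 := fun m hm => by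
    obtain ⟨_, ⟨a, rfl⟩, _, ⟨b, rfl⟩, rfl⟩ := Submodule.mem_sup.1 hm
    simp only [map_add, hXX, hYY, N.X_Y, N.Y_X, add_zero, and_self]
  set E := C.map (N.X u.succ) ⊔ C.map (N.Y u.succ) with hE
  obtain ⟨D, hD⟩ := Submodule.exists_isCompl E
  have hEX : ∀ m ∈ E, N.X _ m = 0 ∧ N.Y _ m = 0 := fun m hm => by
    obtain ⟨_, ⟨a, _, rfl⟩, _, ⟨b, _, rfl⟩, rfl⟩ := Submodule.mem_sup.1 hm
    simp only [map_add, hXX, hYY, N.X_Y, N.Y_X, add_zero, and_self]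
  -- `A` is generated by a complement `C` of the radical at `u.succ`. Its complement `A'` consists
  -- of the radical at `u.succ`, a complement `D` of the image `E` of `C`, and everything at the
  -- other vertices. As `A ≠ 0`, indecomposability gives `N = A`.
  let A : ∀ v, Submodule k (N.obj v) :=
    Function.update (Function.update (fun _ => ⊥) u.succ C) u.succ.succ E
  let A' : ∀ v, Submodule k (N.obj v) :=
    Function.update (Function.update (fun _ => ⊤) u.succ rad) u.succ.succ D
  have A0 : A u.succ = C := by simp [A, Function.update_of_ne u.succ.succ_ne.symm]
  have A1 : A u.succ.succ = E := by simp [A]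
  have A2 : ∀ v, v ≠ u.succ → v ≠ u.succ.succ → A v = ⊥ := fun v h h' => by simp [A, h, h']
  have B0 : A' u.succ = rad := by simp [A', Function.update_of_ne u.succ.succ_ne.symm]
  have B1 : A' u.succ.succ = D := by simp [A']
  have B2 : ∀ v, v ≠ u.succ → v ≠ u.succ.succ → A' v = ⊤ := fun v h h' => by simp [A', h, h']
  have hA : N.IsSubrep A := by
    have key : ∀ v, ∀ m ∈ A v, N.X v m ∈ A v.succ ∧ N.Y v m ∈ A v.succ := by
      intro v m hm
      by_cases h : v = u.succ
      · subst h
        rw [A0] at hm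
        rw [A1]
        exact ⟨Submodule.mem_sup_left ⟨m, hm, rfl⟩, Submodule.mem_sup_right ⟨m, hm, rfl⟩⟩
      · by_cases h' : v = u.succ.succ
        · subst h'
          rw [A1] at hm
          rw [(hEX m hm).1, (hEX m hm).2]
          exact ⟨zero_mem _, zero_mem _⟩
        · rw [A2 v h h', Submodule.mem_bot] at hm
          rw [hm, map_zero, map_zero]
          exact ⟨zero_mem _, zero_mem _⟩
    exact .of_XY (fun v m hm => (key v m hm).1) fun v m hm => (key v m hm).2
  have hA' : N.IsSubrep A' := by
    have key : ∀ v, ∀ m ∈ A' v, N.X v m ∈ A' v.succ ∧ N.Y v m ∈ A' v.succ := by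
      intro v m hm
      by_cases h : v = u.succ
      · subst h
        rw [B0] at hm
        rw [(hradX m hm).1, (hradX m hm).2]
        exact ⟨zero_mem _, zero_mem _⟩
      · by_cases h' : v = u
        · subst h'
          rw [B0]
          exact ⟨Submodule.mem_sup_left ⟨m, rfl⟩, Submodule.mem_sup_right ⟨m, rfl⟩⟩
        · rw [B2 v.succ (fun h1 => h' (Vertex.succ_injective h1))
            (fun h1 => h (Vertex.succ_injective h1))]
          exact ⟨trivial, trivial⟩
    exact .of_XY (fun v m hm => (key v m hm).1) fun v m hm => (key v m hm).2
  have hAA' : ∀ v, IsCompl (A v) (A' v) := by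
    intro v
    by_cases h : v = u.succ
    · subst h
      rw [A0, B0]
      exact hC.symm
    · by_cases h' : v = u.succ.succ
      · subst h'
        rw [A1, B1]
        exact hD
      · rw [A2 v h h', B2 v h h']
        exact isCompl_bot_top
  have hrad0 : rad ≠ ⊤ := hu
  have hC0 : C ≠ ⊥ := by
    rintro rfl
    exact hrad0 (by simpa using hC.sup_eq_top)
  have hbot : ∀ v, A' v = ⊥ := by
    refine (hN.2.1.2 A A' hA hA' hAA').resolve_left fun h => hC0 ?_
    rw [← A0, h]
  have hsub : ∀ w, w ≠ u.succ → w ≠ u.succ.succ → Subsingleton (N.obj w) := fun w h h' => by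
    have := (B2 w h h').symm.trans (hbot w)
    exact (Submodule.subsingleton_iff k).1 (subsingleton_of_bot_eq_top this.symm)
  refine ⟨u.succ, N.kron u.succ, fun b => ?_, ?_, ⟨isoPlace N _ hsub (LinearEquiv.refl k _)
    (LinearEquiv.refl k _) (fun _ => rfl) fun _ => rfl⟩⟩
  · have hb : b ∈ E := by
      have h1 := hD.sup_eq_top
      rw [← B1, hbot, sup_bot_eq] at h1
      rw [h1]; trivial
    obtain ⟨_, ⟨a, _, rfl⟩, _, ⟨a', _, rfl⟩, h⟩ := Submodule.mem_sup.1 hb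
    exact ⟨a, a', h.symm⟩
  · obtain ⟨c, hc, hc0⟩ := C.ne_bot_iff.1 hC0
    exact ⟨c, 0, hc0⟩

/-- For stable vertices, stable endomorphisms are therefore ordinary endomorphisms. -/
theorem Rep.IsStableVertex.stablyFaithful {N : Rep k} (hN : N.IsStableVertex) :
    N.StablyFaithful := by
  obtain ⟨v, K, hK, -, ⟨e⟩⟩ := hN.exists_gen
  exact (hK.stablyFaithful v).of_iso e.symm

/-- A stable vertex is a Kronecker module that is cogenerated by its second space. -/
theorem Rep.IsStableVertex.exists_cogen {N : Rep k} (hN : N.IsStableVertex) :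
    ∃ (v : Vertex) (K : Kron k), K.Cogen ∧ Nontrivial K.W ∧ Nonempty (Iso N (place v K)) := by
  obtain ⟨v, K, hK, hV, ⟨e⟩⟩ := hN.exists_gen
  have hi := hN.2.1.of_iso e
  -- If `W = 0`, the module lives at one vertex only and is described instead as `(0, V)` at the
  -- preceding vertex.
  rcases subsingleton_or_nontrivial K.W with h | h
  · obtain ⟨v, rfl⟩ := v.exists_succ_eq
    exact ⟨v, _, fun a _ _ => rfl, hV, ⟨e.trans (placeShift v K)⟩⟩
  · exact ⟨v, K, hi.cogen, h, ⟨e⟩⟩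

/-- Only nonprojectivity is at stake. If `V ≠ 0`, the module is generated by `V` and hence stably
faithful. If `V = 0`, an element of a projective module that `X²` kills would lie in the radical,
which is zero here. -/
theorem place_isStableVertex {v : Vertex} {K : Kron k} [Module.Finite k K.V] [Module.Finite k K.W]
    (h : (place v K).IsIndecomposable) : (place v K).IsStableVertex := by
  refine ⟨place_isFinite v K, h, ?_⟩
  rcases subsingleton_or_nontrivial K.V with hV | hV
  · intro hp
    obtain ⟨w, hw⟩ := h.1
    obtain ⟨n, hn⟩ := exists_ne (0 : (place v K).obj w)
    have hz : ∀ w, w ≠ v.succ → ∀ n : (place v K).obj w, n = 0 := fun w hw n => by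
      by_cases h' : w = v
      · subst h'
        exact (place.fst w K).injective (Subsingleton.elim _ _)
      · exact place.eq_zero h' hw n
    by_cases hwv : w = v.succ
    · subst hwv
      obtain ⟨a, b, hab⟩ := hp.mem_rad v n (place.eq_zero (Vertex.succ_succ_succ_ne v)
        (fun h => v.succ.succ_succ_ne h) _)
      rw [hz v v.succ_ne.symm a, hz v v.succ_ne.symm b, map_zero, map_zero, add_zero] at hab
      exact hn hab
    · exact hn (hz w hwv n)
  · exact (h.gen.stablyFaithful v).not_isProjective (place_isFinite v K) h.1

theorem place_finite_fst {v : Vertex} {K : Kron k} (h : (place v K).IsFinite) :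
    Module.Finite k K.V := by
  have := h.1 v
  exact Module.Finite.equiv (place.fst v K)

theorem place_finite_snd {v : Vertex} {K : Kron k} (h : (place v K).IsFinite) :
    Module.Finite k K.W := by
  have := h.1 v.succ
  exact Module.Finite.equiv (place.snd v K)

end StableVertex


section Syzygy

variable {k : Type u} [Field k]

/-! ### Syzygies -/

/-- Short exact sequences `0 → M' → J → M → 0` with `J` finite, projective and injective. -/
structure Syz (M' M : Rep k) where
  J : Rep k
  finite : J.IsFinite
  proj : J.IsProjective
  inj : ∀ (A B : Rep k) (i : Hom A B), (∀ v, Function.Injective (i.app v)) → ∀ f : Hom A J,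
    ∃ g : Hom B J, g.comp i = f
  i : Hom M' J
  p : Hom J M
  i_inj : ∀ v, Function.Injective (i.app v)
  p_surj : ∀ v, Function.Surjective (p.app v)
  comp_zero : ∀ v m, p.app v (i.app v m) = 0
  exact : ∀ v x, p.app v x = 0 → ∃ m, i.app v m = x

/-- The factorisation is chosen linearly at every vertex; injectivity of `i` makes it commute with
the arrows. The next lemma is the dual. -/
theorem Hom.exists_factor_of_range_le {L M J : Rep k} (i : Hom M J)
    (hi : ∀ v, Function.Injective (i.app v)) (f : Hom L J)
    (h : ∀ v x, ∃ m, i.app v m = f.app v x) : ∃ g : Hom L M, i.comp g = f := by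
  choose r hr using fun v => (i.app v).exists_leftInverse_of_injective
    (LinearMap.ker_eq_bot.2 (hi v))
  have key : ∀ v x, i.app v (r v (f.app v x)) = f.app v x := fun v x => by
    obtain ⟨m, hm⟩ := h v x
    rw [← hm]
    exact congrArg _ (LinearMap.congr_fun (hr v) m)
  refine ⟨Hom.ofXY (fun v => r v ∘ₗ f.app v) (fun v m => hi _ ?_) (fun v m => hi _ ?_),
    Hom.ext_apply key⟩
  · simp only [LinearMap.comp_apply]
    rw [key, i.app_X, key, f.app_X]
  · simp only [LinearMap.comp_apply]
    rw [key, i.app_Y, key, f.app_Y]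

theorem Hom.exists_factor_of_ker_le {L M J : Rep k} (p : Hom J M)
    (hp : ∀ v, Function.Surjective (p.app v)) (f : Hom J L)
    (h : ∀ v x, p.app v x = 0 → f.app v x = 0) : ∃ g : Hom M L, g.comp p = f := by
  choose s hs using fun v => (p.app v).exists_rightInverse_of_surjective
    (LinearMap.range_eq_top.2 (hp v))
  have key : ∀ v x, f.app v (s v (p.app v x)) = f.app v x := fun v x => by
    rw [← sub_eq_zero, ← map_sub]
    refine h v _ ?_
    rw [map_sub, sub_eq_zero]
    exact LinearMap.congr_fun (hs v) _
  refine ⟨Hom.ofXY (fun v => f.app v ∘ₗ s v) (fun v m => ?_) (fun v m => ?_), Hom.ext_apply key⟩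
  · obtain ⟨x, rfl⟩ := hp v m
    simp only [LinearMap.comp_apply]
    rw [← p.app_X, key, key, f.app_X]
  · obtain ⟨x, rfl⟩ := hp v m
    simp only [LinearMap.comp_apply]
    rw [← p.app_Y, key, key, f.app_Y]

/-! ### Ladders: homomorphisms of short exact sequences with projective middle terms -/

namespace Syz

variable {M' M N' N Z' Z : Rep k}

/-- A homomorphism and a homomorphism between syzygies are compatible if they extend to a
homomorphism of short exact sequences. -/
def Ladder (s : Syz M' M) (t : Syz N' N) (f' : Hom M' N') (f : Hom M N) : Prop :=
  ∃ H : Hom s.J t.J, H.comp s.i = t.i.comp f' ∧ f.comp s.p = t.p.comp H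

/-- Lift `f ∘ s.p` along `t.p` by projectivity of `s.J`, then restrict to the kernels. -/
theorem exists_ladder_down (s : Syz M' M) (t : Syz N' N) (hN : N.IsFinite) (f : Hom M N) :
    ∃ f', s.Ladder t f' f := by
  obtain ⟨H, hH⟩ := s.proj t.J N t.finite hN t.p t.p_surj (f.comp s.p)
  obtain ⟨f', hf'⟩ := t.i.exists_factor_of_range_le t.i_inj (H.comp s.i) fun v x => by
    refine t.exact v _ ?_
    have := Hom.congr_apply hH v (s.i.app v x)
    simp only [Hom.comp_app] at this ⊢
    rw [this, s.comp_zero, map_zero]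
  exact ⟨f', H, hf'.symm, hH.symm⟩

/-- Extend `t.i ∘ f'` along `s.i` by injectivity of `t.J`, then pass to the quotients. -/
theorem exists_ladder_up (s : Syz M' M) (t : Syz N' N) (f' : Hom M' N') :
    ∃ f, s.Ladder t f' f := by
  obtain ⟨H, hH⟩ := t.inj M' s.J s.i s.i_inj (t.i.comp f')
  obtain ⟨f, hf⟩ := s.p.exists_factor_of_ker_le s.p_surj (t.p.comp H) fun v x hx => by
    obtain ⟨m, rfl⟩ := s.exact v x hx
    have := Hom.congr_apply hH v m
    simp only [Hom.comp_app] at this ⊢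
    rw [this, t.comp_zero]
  exact ⟨f, H, hH, hf⟩

theorem Ladder.comp {s : Syz M' M} {t : Syz N' N} {r : Syz Z' Z} {g' : Hom N' Z'} {g : Hom N Z}
    {f' : Hom M' N'} {f : Hom M N} (hg : t.Ladder r g' g) (hf : s.Ladder t f' f) :
    s.Ladder r (g'.comp f') (g.comp f) := by
  obtain ⟨G, hG, hG'⟩ := hg
  obtain ⟨H, hH, hH'⟩ := hf
  exact ⟨G.comp H, by rw [Hom.comp_assoc, hH, ← Hom.comp_assoc, hG, Hom.comp_assoc],
    by rw [Hom.comp_assoc, hH', ← Hom.comp_assoc, hG', Hom.comp_assoc]⟩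

theorem ladder_id (s : Syz M' M) : s.Ladder s (Hom.id M') (Hom.id M) := ⟨Hom.id _, rfl, rfl⟩

theorem Ladder.smul {s : Syz M' M} {t : Syz N' N} {f' : Hom M' N'} {f : Hom M N} (c : k)
    (h : s.Ladder t f' f) : s.Ladder t (c • f') (c • f) := by
  obtain ⟨H, hH, hH'⟩ := h
  refine ⟨c • H, Hom.ext_apply fun v x => ?_, Hom.ext_apply fun v x => ?_⟩
  · have := Hom.congr_apply hH v x
    simp only [Hom.comp_app, Hom.smul_app, map_smul] at this ⊢
    rw [this]
  · have := Hom.congr_apply hH' v x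
    simp only [Hom.comp_app, Hom.smul_app, map_smul] at this ⊢
    rw [this]

theorem Ladder.sub {s : Syz M' M} {t : Syz N' N} {f' g' : Hom M' N'} {f g : Hom M N}
    (hf : s.Ladder t f' f) (hg : s.Ladder t g' g) : s.Ladder t (f' - g') (f - g) := by
  obtain ⟨H, hH, hH'⟩ := hf
  obtain ⟨G, hG, hG'⟩ := hg
  refine ⟨H - G, Hom.ext_apply fun v x => ?_, Hom.ext_apply fun v x => ?_⟩
  · have h1 := Hom.congr_apply hH v x
    have h2 := Hom.congr_apply hG v x
    simp only [Hom.comp_app, Hom.sub_app, map_sub] at h1 h2 ⊢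
    rw [h1, h2]
  · have h1 := Hom.congr_apply hH' v x
    have h2 := Hom.congr_apply hG' v x
    simp only [Hom.comp_app, Hom.sub_app, map_sub] at h1 h2 ⊢
    rw [h1, h2]

/-- The middle map vanishes on `M'`, so it factors through `s.p`, and `f` factors through the
projective module `t.J`. -/
theorem Ladder.up_factors {s : Syz M' M} {t : Syz N' N} {f : Hom M N} (h : s.Ladder t 0 f) :
    ∃ θ : Hom M t.J, f = t.p.comp θ := by
  obtain ⟨H, hH, hH'⟩ := h
  obtain ⟨θ, hθ⟩ := s.p.exists_factor_of_ker_le s.p_surj H fun v x hx => by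
    obtain ⟨m, rfl⟩ := s.exact v x hx
    exact (Hom.congr_apply hH v m).trans (map_zero (t.i.app v))
  refine ⟨θ, Hom.ext_apply fun v m => ?_⟩
  obtain ⟨x, rfl⟩ := s.p_surj v m
  have h1 := Hom.congr_apply hH' v x
  have h2 := Hom.congr_apply hθ v x
  simp only [Hom.comp_app] at h1 h2 ⊢
  rw [h1, h2]

/-- The middle map lands in the kernel of `t.p`, so `f'` extends to the projective module `s.J`. -/
theorem Ladder.down_factors {s : Syz M' M} {t : Syz N' N} {f' : Hom M' N'} (h : s.Ladder t f' 0) :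
    ∃ θ : Hom s.J N', f' = θ.comp s.i := by
  obtain ⟨H, hH, hH'⟩ := h
  obtain ⟨θ, hθ⟩ := t.i.exists_factor_of_range_le t.i_inj H fun v x =>
    t.exact v _ (Hom.congr_apply hH' v x).symm
  refine ⟨θ, Hom.ext_apply fun v m => t.i_inj v ?_⟩
  have h1 := Hom.congr_apply hH v m
  have h2 := Hom.congr_apply hθ v (s.i.app v m)
  simp only [Hom.comp_app] at h1 h2 ⊢
  rw [← h1, h2]

theorem _root_.KronRep.Hom.eq_of_sub_eq_zero {f g : Hom M N} (h : f - g = 0) : f = g :=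
  Hom.ext_apply fun v m => sub_eq_zero.1 (Hom.congr_apply h v m)

theorem _root_.KronRep.Hom.sub_self (f : Hom M N) : f - f = 0 :=
  Hom.ext_apply fun v m => _root_.sub_self (f.app v m)

/-- Endomorphisms of a stably faithful module are determined by the induced endomorphisms of
the syzygy. -/
theorem Ladder.up_unique {s : Syz M' M} (hM : M.StablyFaithful) {f' : Hom M' M'} {f g : Hom M M}
    (hf : s.Ladder s f' f) (hg : s.Ladder s f' g) : f = g := by
  have h := hf.sub hg
  rw [Hom.sub_self] at h
  obtain ⟨θ, hθ⟩ := h.up_factors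
  exact Hom.eq_of_sub_eq_zero (hθ.trans (hM _ s.finite s.proj θ s.p))

theorem Ladder.down_unique {s : Syz M' M} (hM : M'.StablyFaithful) {f' g' : Hom M' M'}
    {f : Hom M M} (hf : s.Ladder s f' f) (hg : s.Ladder s g' f) : f' = g' := by
  have h := hf.sub hg
  rw [Hom.sub_self] at h
  obtain ⟨θ, hθ⟩ := h.down_factors
  exact Hom.eq_of_sub_eq_zero (hθ.trans (hM _ s.finite s.proj s.i θ))

/-- Every finite module is a syzygy. -/
theorem exists_cosyzygy (hM : M'.IsFinite) : ∃ M : Rep k, M.IsFinite ∧ Nonempty (Syz M' M) := by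
  let i : Hom M' (cofree M'.obj) := toCofree fun _ => LinearMap.id
  have hJ : (cofree (k := k) M'.obj).IsFinite := cofree_isFinite hM.1 hM.2
  refine ⟨Rep.quot _ _ i.range_isSubrep, hJ.quot _ _, ⟨⟨_, hJ, cofree_isProjective _,
    fun A B j hj f => cofree_injective j hj f, i, Rep.quotHom _ _ i.range_isSubrep,
    fun v a b hab => congrArg Prod.fst hab, fun v => Submodule.mkQ_surjective _, fun v m => ?_,
    fun v x hx => ?_⟩⟩⟩
  · exact (Submodule.Quotient.mk_eq_zero _).2 ⟨m, rfl⟩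
  · exact (Submodule.Quotient.mk_eq_zero _).1 hx

/-- Every finite module has a finite syzygy. -/
theorem exists_syzygy (hM : M.IsFinite) : ∃ M' : Rep k, M'.IsFinite ∧ Nonempty (Syz M' M) := by
  have hpp : ∀ w : Vertex, ∃ u : Vertex, u.succ.succ = w := fun w => by
    obtain ⟨w, rfl⟩ := w.exists_succ_eq
    obtain ⟨w, rfl⟩ := w.exists_succ_eq
    exact ⟨w, rfl⟩
  choose pp hpp using hpp
  have hpp' : ∀ w : Vertex, pp w.succ.succ = w := fun w =>
    Vertex.succ_injective (Vertex.succ_injective (hpp _))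
  have hinj : Function.Injective pp := fun a b h => by rw [← hpp a, h, hpp]
  -- The top of `cofree B` at `v` is `B v.succ.succ`, so `M` is shifted by two steps to make the top
  -- equal to `M`.
  let B : Vertex → Type u := fun w => M.obj (pp w)
  let p : Hom (cofree (k := k) B) M := fromCofree fun w => M.castObj (hpp' w)
  have hJ : (cofree (k := k) B).IsFinite :=
    cofree_isFinite (fun v => hM.1 _) (hM.2.preimage (f := pp) hinj.injOn)
  have hcast : ∀ {v w : Vertex} (h : v = w), Function.Surjective (M.castObj h) := fun h => by
    subst h
    exact fun x => ⟨x, rfl⟩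
  refine ⟨Rep.sub _ _ p.ker_isSubrep, hJ.sub _ _, ⟨⟨_, hJ, cofree_isProjective _,
    fun A B j hj f => cofree_injective j hj f, Rep.subHom _ _ p.ker_isSubrep, p,
    fun v => Subtype.val_injective, fun v m => ?_, fun v m => m.2,
    fun v x hx => ⟨⟨x, hx⟩, rfl⟩⟩⟩⟩
  obtain ⟨b, hb⟩ := hcast (hpp' v) m
  exact ⟨cofree.mk 0 0 0 b, (fromCofree_top (B := B) (fun w => M.castObj (hpp' w)) v b).trans hb⟩

variable {s : Syz M' M} {t : Syz N' N} {f' : Hom M' N'} {f : Hom M N}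

/-- Irreducible homomorphisms induce irreducible homomorphisms of syzygies. -/
theorem Ladder.isIrreducible_down (h : s.Ladder t f' f) (hM : M.StablyFaithful)
    (hN : N.StablyFaithful) (hM' : M'.StablyFaithful) (hN' : N'.StablyFaithful)
    (fM : M.IsFinite) (hf : f.IsIrreducible) : f'.IsIrreducible := by
  refine ⟨fun ⟨r', hr'⟩ => hf.1 ?_, fun ⟨r', hr'⟩ => hf.2.1 ?_, fun Z' hZ' h' g' hgh' => ?_⟩
  · obtain ⟨r, hr⟩ := t.exists_ladder_up s r'
    have h1 := hr.comp h
    rw [hr'] at h1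
    exact ⟨r, h1.up_unique hM s.ladder_id⟩
  · obtain ⟨r, hr⟩ := t.exists_ladder_up s r'
    have h1 := h.comp hr
    rw [hr'] at h1
    exact ⟨r, h1.up_unique hN t.ladder_id⟩
  -- The factorisation of `f'` through `Z'` induces one of `f` through `Z`, but only up to a map
  -- through the projective module `t.J`. Replacing `Z` by `Z ⊕ t.J` makes it exact.
  · obtain ⟨Z, hZ, ⟨z⟩⟩ := exists_cosyzygy hZ'
    obtain ⟨u, hu⟩ := s.exists_ladder_up z h'
    obtain ⟨g, hg⟩ := z.exists_ladder_up t g'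
    have h1 := hg.comp hu
    rw [hgh'] at h1
    have h2 := h.sub h1
    rw [Hom.sub_self] at h2
    obtain ⟨θ, hθ⟩ := h2.up_factors
    have h3 := hf.2.2 (Z.sum t.J) (hZ.sum t.finite) (u.prod θ) (g.coprod t.p)
      (Hom.ext_apply fun v m => by
        have := Hom.congr_apply hθ v m
        simp only [Hom.sub_app, Hom.comp_app] at this
        change g.app v (u.app v m) + t.p.app v (θ.app v m) = _
        rw [← this]
        abel)
    refine h3.imp (fun ⟨r, hr⟩ => ?_) fun ⟨r, hr⟩ => ?_
    · let r₁ : Hom Z M := r.comp (Z.inl t.J)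
      let r₂ : Hom t.J M := r.comp (Z.inr t.J)
      -- Stable faithfulness kills the composite through `t.J`, so the splitting already takes place
      -- on `Z`.
      have h4 := hM _ t.finite t.proj θ r₂
      have h5 : r₁.comp u = Hom.id M := Hom.ext_apply fun v m => by
        have h6 := Hom.congr_apply hr v m
        have h7 := Hom.congr_apply h4 v m
        have h8 : r.app v ((u.prod θ).app v m) =
            r.app v ((Z.inl t.J).app v (u.app v m)) + r.app v ((Z.inr t.J).app v (θ.app v m)) := by
          rw [← map_add]
          exact congrArg _ (Prod.ext (add_zero _).symm (zero_add _).symm)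
        refine Eq.trans ?_ (h8.symm.trans h6)
        exact (add_zero _).symm.trans (congrArg _ h7.symm)
      obtain ⟨r', hr'⟩ := z.exists_ladder_down s fM r₁
      have h6 := hr'.comp hu
      rw [h5] at h6
      exact ⟨r', h6.down_unique hM' s.ladder_id⟩
    · let r₁ : Hom N Z := ⟨fun v => LinearMap.fst k (Z.obj v) (t.J.obj v) ∘ₗ r.app v, fun a =>
        LinearMap.ext fun m => congrArg Prod.fst (LinearMap.congr_fun (r.comm a) m)⟩
      let r₂ : Hom N t.J := ⟨fun v => LinearMap.snd k (Z.obj v) (t.J.obj v) ∘ₗ r.app v, fun a =>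
        LinearMap.ext fun m => congrArg Prod.snd (LinearMap.congr_fun (r.comm a) m)⟩
      have h4 := hN _ t.finite t.proj r₂ t.p
      have h5 : g.comp r₁ = Hom.id N := Hom.ext_apply fun v m => by
        refine Eq.trans ?_ (Hom.congr_apply hr v m)
        exact (add_zero _).symm.trans (congrArg _ (Hom.congr_apply h4 v m).symm)
      obtain ⟨r', hr'⟩ := t.exists_ladder_down z hZ r₁
      have h6 := hg.comp hr'
      rw [h5] at h6
      exact ⟨r', h6.down_unique hN' t.ladder_id⟩

/-- Homomorphisms that induce irreducible homomorphisms of syzygies are irreducible. -/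
theorem Ladder.isIrreducible_up (h : s.Ladder t f' f) (hM : M.StablyFaithful)
    (hN : N.StablyFaithful) (hM' : M'.StablyFaithful) (hN' : N'.StablyFaithful)
    (fM : M.IsFinite) (fN : N.IsFinite) (hf : f'.IsIrreducible) : f.IsIrreducible := by
  refine ⟨fun ⟨r, hr⟩ => hf.1 ?_, fun ⟨r, hr⟩ => hf.2.1 ?_, fun Z hZ u g hgu => ?_⟩
  · obtain ⟨r', hr'⟩ := t.exists_ladder_down s fM r
    have h1 := hr'.comp h
    rw [hr] at h1
    exact ⟨r', h1.down_unique hM' s.ladder_id⟩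
  · obtain ⟨r', hr'⟩ := t.exists_ladder_down s fM r
    have h1 := h.comp hr'
    rw [hr] at h1
    exact ⟨r', h1.down_unique hN' t.ladder_id⟩
  -- Dually, the error of the induced factorisation of `f'` factors through `s.J`, which is added to
  -- `Z'`.
  · obtain ⟨Z', hZ', ⟨z⟩⟩ := exists_syzygy hZ
    obtain ⟨u', hu⟩ := s.exists_ladder_down z hZ u
    obtain ⟨g', hg⟩ := z.exists_ladder_down t fN g
    have h1 := hg.comp hu
    rw [hgu] at h1
    have h2 := h.sub h1
    rw [Hom.sub_self] at h2
    obtain ⟨θ, hθ⟩ := h2.down_factors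
    have h3 := hf.2.2 (Z'.sum s.J) (hZ'.sum s.finite) (u'.prod s.i) (g'.coprod θ)
      (Hom.ext_apply fun v m => by
        have := Hom.congr_apply hθ v m
        simp only [Hom.sub_app, Hom.comp_app] at this
        change g'.app v (u'.app v m) + θ.app v (s.i.app v m) = _
        rw [← this]
        abel)
    refine h3.imp (fun ⟨r, hr⟩ => ?_) fun ⟨r, hr⟩ => ?_
    · let r₁ : Hom Z' M' := r.comp (Z'.inl s.J)
      let r₂ : Hom s.J M' := r.comp (Z'.inr s.J)
      have h4 := hM' _ s.finite s.proj s.i r₂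
      have h5 : r₁.comp u' = Hom.id M' := Hom.ext_apply fun v m => by
        have h6 := Hom.congr_apply hr v m
        have h7 := Hom.congr_apply h4 v m
        have h8 : r.app v ((u'.prod s.i).app v m) =
            r.app v ((Z'.inl s.J).app v (u'.app v m)) +
              r.app v ((Z'.inr s.J).app v (s.i.app v m)) := by
          rw [← map_add]
          exact congrArg _ (Prod.ext (add_zero _).symm (zero_add _).symm)
        refine Eq.trans ?_ (h8.symm.trans h6)
        exact (add_zero _).symm.trans (congrArg _ h7.symm)
      obtain ⟨r'', hr''⟩ := z.exists_ladder_up s r₁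
      have h6 := hr''.comp hu
      rw [h5] at h6
      exact ⟨r'', h6.up_unique hM s.ladder_id⟩
    · let r₁ : Hom N' Z' := ⟨fun v => LinearMap.fst k (Z'.obj v) (s.J.obj v) ∘ₗ r.app v, fun a =>
        LinearMap.ext fun m => congrArg Prod.fst (LinearMap.congr_fun (r.comm a) m)⟩
      let r₂ : Hom N' s.J := ⟨fun v => LinearMap.snd k (Z'.obj v) (s.J.obj v) ∘ₗ r.app v, fun a =>
        LinearMap.ext fun m => congrArg Prod.snd (LinearMap.congr_fun (r.comm a) m)⟩
      have h4 := hN' _ s.finite s.proj r₂ θ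
      have h5 : g'.comp r₁ = Hom.id N' := Hom.ext_apply fun v m => by
        refine Eq.trans ?_ (Hom.congr_apply hr v m)
        exact (add_zero _).symm.trans (congrArg _ (Hom.congr_apply h4 v m).symm)
      obtain ⟨r'', hr''⟩ := t.exists_ladder_up z r₁
      have h6 := hg.comp hr''
      rw [h5] at h6
      exact ⟨r'', h6.up_unique hN t.ladder_id⟩

/-- If all endomorphisms of a module are scalar, then so are those of its syzygy. -/
theorem endo_scalar_down (s : Syz M' M) (hM' : M'.StablyFaithful)
    (h : ∀ f : Hom M M, ∃ c : k, ∀ v n, f.app v n = c • n) (f' : Hom M' M') :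
    ∃ c : k, ∀ v n, f'.app v n = c • n := by
  obtain ⟨f, hf⟩ := s.exists_ladder_up s f'
  obtain ⟨c, hc⟩ := h f
  refine ⟨c, fun v n => ?_⟩
  obtain rfl : f = c • Hom.id M := Hom.ext_apply hc
  exact Hom.congr_apply (hf.down_unique hM' (s.ladder_id.smul c)) v n

/-- If all endomorphisms of the syzygy of a module are scalar, then so are those of the module. -/
theorem endo_scalar_up (s : Syz M' M) (fM : M.IsFinite) (hM : M.StablyFaithful)
    (h : ∀ f : Hom M' M', ∃ c : k, ∀ v n, f.app v n = c • n) (f : Hom M M) :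
    ∃ c : k, ∀ v n, f.app v n = c • n := by
  obtain ⟨f', hf⟩ := s.exists_ladder_down s fM f
  obtain ⟨c, hc⟩ := h f'
  refine ⟨c, fun v n => ?_⟩
  obtain rfl : f' = c • Hom.id M' := Hom.ext_apply hc
  exact Hom.congr_apply (hf.up_unique hM (s.ladder_id.smul c)) v n

end Syz

end Syzygy


section Reflection

variable {k : Type u} [Field k]

/-! ### Syzygies of Kronecker modules -/

/-- Elements of a Kronecker module. -/
def place.mk {v w : Vertex} {K : Kron k} (a : PLift (w = v) → K.V) (b : PLift (w = v.succ) → K.W) :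
    (place v K).obj w := (a, b)

theorem place.X_mk {v w : Vertex} {K : Kron k} (a : PLift (w = v) → K.V)
    (b : PLift (w = v.succ) → K.W) : (place v K).X w (place.mk a b) =
      place.mk 0 fun h => K.x (a ⟨Vertex.succ_injective h.down⟩) := by
  cases w <;> rfl

theorem place.Y_mk {v w : Vertex} {K : Kron k} (a : PLift (w = v) → K.V)
    (b : PLift (w = v.succ) → K.W) : (place v K).Y w (place.mk a b) =
      place.mk 0 fun h => K.y (a ⟨Vertex.succ_injective h.down⟩) := by
  cases w <;> rfl

variable {U V W : Type u} [AddCommGroup U] [AddCommGroup V] [AddCommGroup W] [Module k U]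
  [Module k V] [Module k W] (v : Vertex) (x' y' : U →ₗ[k] V) (x y : V →ₗ[k] W)

/-- The embedding of a Kronecker module into a cofree module. -/
def placeToCofree : Hom (place v.succ ⟨U, V, x', y'⟩) (cofree (Single v.succ.succ V)) :=
  toCofree fun w => LinearMap.snd k (PLift (w = v.succ) → U) (PLift (w = v.succ.succ) → V)

theorem placeToCofree_mk {w : Vertex} (a : PLift (w = v.succ) → U)
    (b : PLift (w = v.succ.succ) → V) :
    (placeToCofree v x' y').app w (place.mk a b) =
      cofree.mk b (fun h => x' (a ⟨Vertex.succ_injective h.down⟩))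
        (fun h => y' (a ⟨Vertex.succ_injective h.down⟩)) 0 := by
  refine (toCofree_app _ _ _).trans ?_
  rw [place.X_mk, place.Y_mk, place.X_mk]
  congr 1
  exact funext fun h => map_zero x'

/-- The projection of a cofree module to a Kronecker module. -/
def cofreeToPlace : Hom (cofree (Single v.succ.succ V)) (place v ⟨V, W, x, y⟩) :=
  Hom.ofXY (fun w =>
    { toFun := fun q => place.mk (fun h => q.2.2 ⟨by rw [h.down]⟩)
        (fun h => x (q.2.1.1 ⟨by rw [h.down]⟩) + y (q.2.1.2 ⟨by rw [h.down]⟩))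
      map_add' := fun p q => Prod.ext rfl (funext fun h => by
        change x (_ + _) + y (_ + _) = _ + _ + (_ + _)
        rw [map_add, map_add]
        abel)
      map_smul' := fun c p => Prod.ext rfl (funext fun h => by
        change x (c • _) + y (c • _) = c • (_ + _)
        rw [map_smul, map_smul, smul_add]) })
    (fun w q => by
      obtain ⟨b₀, b₁, b₂, b₃, rfl⟩ := cofree.exists_mk q
      refine Eq.trans ?_ (place.X_mk _ _).symm
      rw [cofree.X_mk]
      refine Prod.ext rfl (funext fun h => ?_)
      change x (b₃ _) + y 0 = x (b₃ _)
      rw [map_zero, add_zero])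
    (fun w q => by
      obtain ⟨b₀, b₁, b₂, b₃, rfl⟩ := cofree.exists_mk q
      refine Eq.trans ?_ (place.Y_mk _ _).symm
      rw [cofree.Y_mk]
      refine Prod.ext rfl (funext fun h => ?_)
      change x 0 + y (b₃ _) = y (b₃ _)
      rw [map_zero, zero_add])

theorem cofreeToPlace_mk {w : Vertex} (b₀ : PLift (w = v.succ.succ) → V)
    (b₁ b₂ : PLift (w.succ = v.succ.succ) → V) (b₃ : PLift (w.succ.succ = v.succ.succ) → V) :
    (cofreeToPlace v x y).app w (cofree.mk b₀ b₁ b₂ b₃) =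
      place.mk (fun h => b₃ ⟨by rw [h.down]⟩)
        (fun h => x (b₁ ⟨by rw [h.down]⟩) + y (b₂ ⟨by rw [h.down]⟩)) := rfl

/-- A short exact sequence `0 → U → V × V → W → 0` makes one Kronecker module the syzygy of
another one. -/
def syzPlace [Module.Finite k V] (h0 : ∀ a, x (x' a) + y (y' a) = 0)
    (hinj : ∀ a, x' a = 0 → y' a = 0 → a = 0)
    (hex : ∀ a b, x a + y b = 0 → ∃ c, x' c = a ∧ y' c = b) (hsurj : ∀ b, ∃ a a', b = x a + y a') :
    Syz (place v.succ ⟨U, V, x', y'⟩) (place v ⟨V, W, x, y⟩) where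
  -- This module carries `V`, `V × V`, `V` at `v`, `v.succ`, `v.succ.succ`. Its top is the first
  -- space of the quotient, its socle is the second space of the syzygy, and the given exact
  -- sequence lives in the middle.
  J := cofree (Single v.succ.succ V)
  finite := single_cofree_isFinite V _
  proj := cofree_isProjective _
  inj A B i hi f := cofree_injective i hi f
  i := placeToCofree v x' y'
  p := cofreeToPlace v x y
  i_inj w := by
    refine (injective_iff_map_eq_zero _).2 ?_
    rintro ⟨a, b⟩ h
    have h := (placeToCofree_mk v x' y' a b).symm.trans (h.trans cofree.mk_zero.symm)
    obtain ⟨h1, h2, h3, -⟩ := cofree.mk_inj h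
    refine Prod.ext (funext fun i => ?_) h1
    have e : w.succ = v.succ.succ := by rw [i.down]
    exact hinj _ (congrFun h2 ⟨e⟩) (congrFun h3 ⟨e⟩)
  p_surj w := by
    rintro ⟨a, b⟩
    choose s s' hs using hsurj
    refine ⟨cofree.mk 0 (fun h => s (b ⟨Vertex.succ_injective h.down⟩))
      (fun h => s' (b ⟨Vertex.succ_injective h.down⟩))
      (fun h => a ⟨Vertex.succ_injective (Vertex.succ_injective h.down)⟩), ?_⟩
    rw [cofreeToPlace_mk]
    exact Prod.ext rfl (funext fun h => (hs _).symm)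
  comp_zero w := by
    rintro ⟨a, b⟩
    refine (congrArg _ (placeToCofree_mk v x' y' a b)).trans ?_
    rw [cofreeToPlace_mk]
    exact Prod.ext rfl (funext fun h => h0 _)
  exact w := by
    intro q hq
    obtain ⟨b₀, b₁, b₂, b₃, rfl⟩ := cofree.exists_mk q
    rw [cofreeToPlace_mk] at hq
    have h1 : ∀ h, b₃ h = 0 := fun h => congrFun (congrArg Prod.fst hq)
      ⟨Vertex.succ_injective (Vertex.succ_injective h.down)⟩
    have h2 : ∀ h : PLift (w = v.succ), x (b₁ ⟨by rw [h.down]⟩) + y (b₂ ⟨by rw [h.down]⟩) = 0 :=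
      fun h => congrFun (congrArg Prod.snd hq) h
    choose c hc hc' using fun h => hex _ _ (h2 h)
    refine ⟨place.mk c b₀, ?_⟩
    rw [placeToCofree_mk]
    congr 1
    · exact funext fun h => hc _
    · exact funext fun h => hc' _
    · exact (funext h1).symm

/-- The Kronecker module that is the syzygy of a given one. -/
def Kron.refl (K : Kron k) : Kron k :=
  ⟨LinearMap.ker (K.x.coprod K.y), K.V, LinearMap.fst k K.V K.V ∘ₗ Submodule.subtype _,
    LinearMap.snd k K.V K.V ∘ₗ Submodule.subtype _⟩

/-- The syzygy of a generated Kronecker module. -/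
def Kron.Gen.syz {K : Kron k} (hK : K.Gen) [Module.Finite k K.V] :
    Syz (place v.succ K.refl) (place v K) :=
  syzPlace v (LinearMap.fst k K.V K.V ∘ₗ Submodule.subtype (LinearMap.ker (K.x.coprod K.y)))
    (LinearMap.snd k K.V K.V ∘ₗ Submodule.subtype _) K.x K.y (fun a => a.2) (fun _ h h' => Subtype.ext (Prod.ext h h'))
    (fun a b h => ⟨⟨(a, b), h⟩, rfl, rfl⟩) hK

/-- Rank–nullity for `V × V → W`: the syzygy changes the dimensions `(a, b)` into `(2a - b, a)`. -/
theorem Kron.Gen.finrank_refl {K : Kron k} (hK : K.Gen) [Module.Finite k K.V] :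
    Module.finrank k K.refl.V + Module.finrank k K.W =
      Module.finrank k K.V + Module.finrank k K.V := by
  have h1 := (K.x.coprod K.y).finrank_range_add_finrank_ker
  rw [LinearMap.range_eq_top.2 fun b => ?_, finrank_top, Module.finrank_prod] at h1
  · rw [← h1, add_comm]
    rfl
  · obtain ⟨a, a', h⟩ := hK b
    exact ⟨(a, a'), h.symm⟩

/-- The Kronecker module whose syzygy is a given one. -/
def Kron.corefl (K : Kron k) : Kron k :=
  ⟨K.W, (K.W × K.W) ⧸ LinearMap.range (K.x.prod K.y),
    Submodule.mkQ _ ∘ₗ LinearMap.inl k K.W K.W, Submodule.mkQ _ ∘ₗ LinearMap.inr k K.W K.W⟩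

theorem Kron.mkQ_add (K : Kron k) (a b : K.W) :
    (Submodule.mkQ (LinearMap.range (K.x.prod K.y)) ∘ₗ LinearMap.inl k K.W K.W) a +
      (Submodule.mkQ (LinearMap.range (K.x.prod K.y)) ∘ₗ LinearMap.inr k K.W K.W) b =
      (LinearMap.range (K.x.prod K.y)).mkQ (a, b) := by
  refine (map_add (LinearMap.range (K.x.prod K.y)).mkQ (a, 0) (0, b)).symm.trans ?_
  rw [Prod.mk_add_mk, add_zero, zero_add]

theorem Kron.corefl_gen (K : Kron k) : K.corefl.Gen := fun b => by
  obtain ⟨⟨a, a'⟩, rfl⟩ := Submodule.mkQ_surjective _ b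
  exact ⟨a, a', (K.mkQ_add a a').symm⟩

/-- A cogenerated Kronecker module is a syzygy. -/
def Kron.Cogen.syz {K : Kron k} (hK : K.Cogen) [Module.Finite k K.W] :
    Syz (place v.succ K) (place v K.corefl) :=
  syzPlace v K.x K.y (Submodule.mkQ _ ∘ₗ LinearMap.inl k K.W K.W)
    (Submodule.mkQ _ ∘ₗ LinearMap.inr k K.W K.W)
    (fun a => by
      rw [Kron.mkQ_add]
      exact (Submodule.Quotient.mk_eq_zero _).2 ⟨a, rfl⟩) hK
    (fun a b h => by
      rw [Kron.mkQ_add] at h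
      obtain ⟨c, hc⟩ := (Submodule.Quotient.mk_eq_zero _).1 h
      exact ⟨c, congrArg Prod.fst hc, congrArg Prod.snd hc⟩) K.corefl_gen

/-- The inverse change of dimensions, `(a, b)` into `(b, 2b - a)`. -/
theorem Kron.Cogen.finrank_corefl {K : Kron k} (hK : K.Cogen) [Module.Finite k K.V]
    [Module.Finite k K.W] :
    Module.finrank k K.corefl.W + Module.finrank k K.V =
      Module.finrank k K.W + Module.finrank k K.W := by
  have h1 := (LinearMap.range (K.x.prod K.y)).finrank_quotient_add_finrank
  rw [LinearMap.finrank_range_of_inj, Module.finrank_prod] at h1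
  · exact h1
  · refine (injective_iff_map_eq_zero _).2 fun a ha => ?_
    exact hK a (congrArg Prod.fst ha) (congrArg Prod.snd ha)

/-! ### Reflections preserve indecomposability -/

variable {v} {K : Kron k}

theorem Kron.isNonzero_of_fst [Nontrivial K.V] : (place v K).IsNonzero :=
  ⟨v, (place.fst v K).symm.injective.nontrivial⟩

theorem Kron.isNonzero_of_snd [Nontrivial K.W] : (place v K).IsNonzero :=
  ⟨v.succ, (place.snd v K).symm.injective.nontrivial⟩

theorem place_mem_fst {N : ∀ w, Submodule k ((place v K).obj w)} (hN : (place v K).IsSubrep N)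
    (a : K.V) (ha : (place.fst v K).symm a ∈ N v) :
    (place.snd v K).symm (K.x a) ∈ N v.succ ∧ (place.snd v K).symm (K.y a) ∈ N v.succ := by
  have h1 := hN.X_mem v _ ha
  have h2 := hN.Y_mem v _ ha
  rw [← (place.snd v K).symm_apply_apply ((place v K).X v _), place.snd_X,
    LinearEquiv.apply_symm_apply] at h1
  rw [← (place.snd v K).symm_apply_apply ((place v K).Y v _), place.snd_Y,
    LinearEquiv.apply_symm_apply] at h2
  exact ⟨h1, h2⟩

/-- Indecomposability of a Kronecker module in terms of subspaces. -/
theorem place_isIndecomposable (h0 : (place v K).IsNonzero)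
    (h : ∀ (A A' : Submodule k K.V) (B B' : Submodule k K.W), IsCompl A A' → IsCompl B B' →
      (∀ a ∈ A, K.x a ∈ B ∧ K.y a ∈ B) → (∀ a ∈ A', K.x a ∈ B' ∧ K.y a ∈ B') →
      (A = ⊥ ∧ B = ⊥) ∨ (A' = ⊥ ∧ B' = ⊥)) : (place v K).IsIndecomposable := by
  refine ⟨h0, fun N N' hN hN' hc => ?_⟩
  let A : (∀ w, Submodule k ((place v K).obj w)) → Submodule k K.V := fun N =>
    (N v).comap (place.fst v K).symm.toLinearMap
  let B : (∀ w, Submodule k ((place v K).obj w)) → Submodule k K.W := fun N =>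
    (N v.succ).comap (place.snd v K).symm.toLinearMap
  have bot : ∀ N, A N = ⊥ ∧ B N = ⊥ → ∀ w, N w = ⊥ := by
    rintro N ⟨h1, h2⟩ w
    refine (Submodule.eq_bot_iff _).2 fun p hp => ?_
    by_cases hw : w = v
    · subst hw
      have : place.fst w K p ∈ A N := by
        change (place.fst w K).symm (place.fst w K p) ∈ N w
        rwa [LinearEquiv.symm_apply_apply]
      rw [h1, Submodule.mem_bot] at this
      exact (LinearEquiv.map_eq_zero_iff _).1 this
    · by_cases hw' : w = v.succ
      · subst hw'
        have : place.snd v K p ∈ B N := by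
          change (place.snd v K).symm (place.snd v K p) ∈ N v.succ
          rwa [LinearEquiv.symm_apply_apply]
        rw [h2, Submodule.mem_bot] at this
        exact (LinearEquiv.map_eq_zero_iff _).1 this
      · exact place.eq_zero hw hw' p
  refine (h (A N) (A N') (B N) (B N') ?_ ?_ (fun a ha => place_mem_fst hN a ha)
    (fun a ha => place_mem_fst hN' a ha)).imp (bot N) (bot N')
  · exact (Submodule.orderIsoMapComap (place.fst v K).symm).symm.isCompl (hc v)
  · exact (Submodule.orderIsoMapComap (place.snd v K).symm).symm.isCompl (hc v.succ)

section Exact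

variable {x' y' : U →ₗ[k] V} {x y : V →ₗ[k] W}

/-- A decomposition of `(U, V)` with `V = A ⊕ A'` induces one of `(V, W)`, where `A` is paired with
`xA + yA`. The two images generate `W`. A vector common to both gives a relation, which by exactness
comes from `U = C ⊕ C'`; splitting it there shows that the vector is zero. If `A = 0`, then `C = 0`
because `x'` and `y'` have no common kernel. -/
theorem syz_isIndecomposable [Nontrivial V] (h0 : ∀ a, x (x' a) + y (y' a) = 0)
    (hinj : ∀ a, x' a = 0 → y' a = 0 → a = 0)
    (hex : ∀ a b, x a + y b = 0 → ∃ c, x' c = a ∧ y' c = b) (hsurj : ∀ b, ∃ a a', b = x a + y a')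
    (h : (place v ⟨V, W, x, y⟩).IsIndecomposable)
    (w : Vertex) : (place w ⟨U, V, x', y'⟩).IsIndecomposable := by
  refine place_isIndecomposable (Kron.isNonzero_of_snd (K := ⟨U, V, x', y'⟩)) ?_
  intro (C : Submodule k U) (C' : Submodule k U) (A : Submodule k V) (A' : Submodule k V) hC hA
    (h1 : ∀ a ∈ C, x' a ∈ A ∧ y' a ∈ A) (h2 : ∀ a ∈ C', x' a ∈ A' ∧ y' a ∈ A')
  have key : ∀ (C : Submodule k U) (A : Submodule k V), A = ⊥ →
      (∀ a ∈ C, x' a ∈ A ∧ y' a ∈ A) → C = ⊥ ∧ A = ⊥ := fun C A hA h =>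
    ⟨(Submodule.eq_bot_iff _).2 fun c hc => by
      have := h c hc
      rw [hA, Submodule.mem_bot, Submodule.mem_bot] at this
      exact hinj c this.1 this.2, hA⟩
  have hsum : ∀ a : V, ∃ a₁ ∈ A, ∃ a₂ ∈ A', a₁ + a₂ = a := fun a => Submodule.mem_sup.1
    ((hA.sup_eq_top : A ⊔ A' = ⊤) ▸ Submodule.mem_top)
  let E : Submodule k V → Submodule k W := fun A => A.map x ⊔ A.map y
  have hE : IsCompl (E A) (E A') := by
    refine ⟨Submodule.disjoint_def.2 fun b hb hb' => ?_,
      codisjoint_iff.2 (eq_top_iff.2 fun b _ => ?_)⟩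
    · obtain ⟨_, ⟨a₁, ha₁, rfl⟩, _, ⟨a₂, ha₂, rfl⟩, rfl⟩ := Submodule.mem_sup.1 hb
      obtain ⟨_, ⟨b₁, hb₁, rfl⟩, _, ⟨b₂, hb₂, rfl⟩, hab⟩ := Submodule.mem_sup.1 hb'
      obtain ⟨e, he, he'⟩ := hex (a₁ - b₁) (a₂ - b₂) (by
        rw [map_sub, map_sub, sub_add_sub_comm, hab, sub_self])
      obtain ⟨c, hc, c', hc', rfl⟩ := Submodule.mem_sup.1
        ((hC.sup_eq_top : C ⊔ C' = ⊤) ▸ Submodule.mem_top : e ∈ C ⊔ C')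
      have split : ∀ {a b d d' : V}, a ∈ A → b ∈ A' → d ∈ A → d' ∈ A' → d + d' = a - b →
          a = d := by
        intro a b d d' ha hb hd hd' h
        have h3 : a - d = b + d' := by
          rw [sub_eq_iff_eq_add, add_assoc, add_comm d', h, add_sub_cancel]
        exact sub_eq_zero.1 (Submodule.disjoint_def.1 hA.disjoint _ (A.sub_mem ha hd)
          (h3 ▸ A'.add_mem hb hd'))
      have e₁ := split ha₁ hb₁ (h1 c hc).1 (h2 c' hc').1 ((map_add x' c c').symm.trans he)
      have e₂ := split ha₂ hb₂ (h1 c hc).2 (h2 c' hc').2 ((map_add y' c c').symm.trans he')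
      rw [e₁, e₂]
      exact h0 c
    · obtain ⟨a, a', rfl⟩ := hsurj b
      obtain ⟨a₁, h₁, a₂, h₂, rfl⟩ := hsum a
      obtain ⟨b₁, g₁, b₂, g₂, rfl⟩ := hsum a'
      refine Submodule.mem_sup.2 ⟨x a₁ + y b₁, Submodule.add_mem_sup ⟨_, h₁, rfl⟩ ⟨_, g₁, rfl⟩,
        x a₂ + y b₂, Submodule.add_mem_sup ⟨_, h₂, rfl⟩ ⟨_, g₂, rfl⟩, ?_⟩
      rw [map_add, map_add]
      abel
  exact (place_decomp h hA hE (fun a ha => Submodule.mem_sup_left ⟨a, ha, rfl⟩)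
    (fun a ha => Submodule.mem_sup_right ⟨a, ha, rfl⟩)
    (fun a ha => Submodule.mem_sup_left ⟨a, ha, rfl⟩)
    (fun a ha => Submodule.mem_sup_right ⟨a, ha, rfl⟩)).imp (fun h => key C A h.1 h1)
    fun h => key C' A' h.1 h2

/-- Dually, a decomposition of `(V, W)` is pulled back to `U`, where `A` is paired with the vectors
that `x'` and `y'` both send into `A`. For an element of `U`, the components of its relation in `B`
and in `B'` vanish separately, so by exactness the element splits. -/
theorem cosyz_isIndecomposable [Nontrivial V] (h0 : ∀ a, x (x' a) + y (y' a) = 0)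
    (hinj : ∀ a, x' a = 0 → y' a = 0 → a = 0)
    (hex : ∀ a b, x a + y b = 0 → ∃ c, x' c = a ∧ y' c = b) (hsurj : ∀ b, ∃ a a', b = x a + y a')
    (h : (place v ⟨U, V, x', y'⟩).IsIndecomposable)
    (w : Vertex) : (place w ⟨V, W, x, y⟩).IsIndecomposable := by
  refine place_isIndecomposable (Kron.isNonzero_of_fst (K := ⟨V, W, x, y⟩)) ?_
  intro (A : Submodule k V) (A' : Submodule k V) (B : Submodule k W) (B' : Submodule k W) hA hB
    (h1 : ∀ a ∈ A, x a ∈ B ∧ y a ∈ B) (h2 : ∀ a ∈ A', x a ∈ B' ∧ y a ∈ B')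
  have key : ∀ (A A' : Submodule k V) (B B' : Submodule k W), IsCompl A A' →
      IsCompl B B' → A = ⊥ → (∀ a ∈ A', x a ∈ B' ∧ y a ∈ B') → A = ⊥ ∧ B = ⊥ := by
    intro A A' B B' hA hB hA0 h
    refine ⟨hA0, (Submodule.eq_bot_iff _).2 fun b hb => ?_⟩
    subst hA0
    have hA' : A' = ⊤ := by simpa using hA.sup_eq_top
    subst hA'
    obtain ⟨a, a', rfl⟩ := hsurj b
    exact Submodule.disjoint_def.1 hB.disjoint _ hb (B'.add_mem (h a trivial).1 (h a' trivial).2)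
  have hsum : ∀ a : V, ∃ a₁ ∈ A, ∃ a₂ ∈ A', a₁ + a₂ = a := fun a => Submodule.mem_sup.1
    ((hA.sup_eq_top : A ⊔ A' = ⊤) ▸ Submodule.mem_top)
  let D : Submodule k V → Submodule k U := fun A => A.comap x' ⊓ A.comap y'
  have hD : IsCompl (D A) (D A') := by
    refine ⟨Submodule.disjoint_def.2 fun a ha ha' => ?_,
      codisjoint_iff.2 (eq_top_iff.2 fun a _ => ?_)⟩
    · exact hinj a (Submodule.disjoint_def.1 hA.disjoint _ ha.1 ha'.1)
        (Submodule.disjoint_def.1 hA.disjoint _ ha.2 ha'.2)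
    · obtain ⟨a₁, h₁, a₂, h₂, h₃⟩ := hsum (x' a)
      obtain ⟨b₁, g₁, b₂, g₂, g₃⟩ := hsum (y' a)
      have hs : (x a₁ + y b₁) + (x a₂ + y b₂) = 0 := by
        rw [← h0 a, ← h₃, ← g₃, map_add, map_add]
        abel
      have z1 : x a₁ + y b₁ = 0 := by
        refine Submodule.disjoint_def.1 hB.disjoint _ (B.add_mem (h1 a₁ h₁).1 (h1 b₁ g₁).2) ?_
        rw [eq_neg_of_add_eq_zero_left hs]
        exact B'.neg_mem (B'.add_mem (h2 a₂ h₂).1 (h2 b₂ g₂).2)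
      have z2 : x a₂ + y b₂ = 0 := by rwa [z1, zero_add] at hs
      obtain ⟨c, rfl, rfl⟩ := hex _ _ z1
      obtain ⟨d, rfl, rfl⟩ := hex _ _ z2
      refine Submodule.mem_sup.2 ⟨c, ⟨h₁, g₁⟩, d, ⟨h₂, g₂⟩, sub_eq_zero.1 (hinj _ ?_ ?_)⟩
      · rw [map_sub, map_add, h₃, sub_self]
      · rw [map_sub, map_add, g₃, sub_self]
  exact (place_decomp h hD hA (fun a ha => ha.1) (fun a ha => ha.2) (fun a ha => ha.1)
    (fun a ha => ha.2)).imp (fun h => key A A' B B' hA hB h.2 h2)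
    fun h => key A' A B' B hA.symm hB.symm h.2 h1

end Exact

theorem Kron.Gen.refl_isIndecomposable (hK : K.Gen) [Nontrivial K.V]
    (h : (place v K).IsIndecomposable) (w : Vertex) : (place w K.refl).IsIndecomposable :=
  syz_isIndecomposable (x' := LinearMap.fst k K.V K.V ∘ₗ Submodule.subtype
    (LinearMap.ker (K.x.coprod K.y))) (y' := LinearMap.snd k K.V K.V ∘ₗ Submodule.subtype _)
    (fun a => a.2) (fun _ h h' => Subtype.ext (Prod.ext h h'))
    (fun a b h => ⟨⟨(a, b), h⟩, rfl, rfl⟩) hK h w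

theorem Kron.Cogen.corefl_isIndecomposable (hK : K.Cogen) [Nontrivial K.W]
    (h : (place v K).IsIndecomposable) (w : Vertex) : (place w K.corefl).IsIndecomposable :=
  cosyz_isIndecomposable (x := Submodule.mkQ _ ∘ₗ LinearMap.inl k K.W K.W)
    (y := Submodule.mkQ _ ∘ₗ LinearMap.inr k K.W K.W)
    (fun a => by
      rw [Kron.mkQ_add]
      exact (Submodule.Quotient.mk_eq_zero _).2 ⟨a, rfl⟩) hK
    (fun a b h => by
      rw [Kron.mkQ_add] at h
      obtain ⟨c, hc⟩ := (Submodule.Quotient.mk_eq_zero _).1 h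
      exact ⟨c, congrArg Prod.fst hc, congrArg Prod.snd hc⟩) K.corefl_gen h w

end Reflection


section Even

variable {k : Type u} [Field k]

/-! ### Stable vertices whose two spaces have different dimensions -/

/-- The simple representation at the successor of `v`, as a Kronecker module at `v`. -/
@[reducible] def simpleAt (k : Type u) [Field k] (v : Vertex) : Rep k :=
  place v ⟨PUnit.{u + 1}, k, 0, 0⟩

/-- Stable vertices that are Kronecker modules with two spaces of different dimensions. -/
def Rep.IsUneven (N : Rep k) : Prop :=
  N.IsStableVertex ∧ ∃ (v : Vertex) (K : Kron k), Nonempty (Iso N (place v K)) ∧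
    Module.finrank k K.V ≠ Module.finrank k K.W

theorem Rep.IsUneven.of_iso {M N : Rep k} (e : Iso M N) (h : M.IsUneven) : N.IsUneven := by
  obtain ⟨h1, v, K, ⟨d⟩, h2⟩ := h
  exact ⟨h1.of_iso e, v, K, ⟨e.symm.trans d⟩, h2⟩

/-- The two supports meet only in `v.succ`, so the common module is concentrated there. -/
theorem place_iso_succ {v : Vertex} {K L : Kron k} (e : Iso (place v K) (place v.succ L)) :
    Module.finrank k K.V = 0 ∧ Module.finrank k K.W = Module.finrank k L.V ∧
      Module.finrank k L.W = 0 := by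
  refine ⟨?_, ?_, ?_⟩
  · have : Subsingleton ((place v.succ L).obj v) :=
      place.subsingleton v.succ_ne.symm v.succ_succ_ne.symm
    rw [← (place.fst v K).finrank_eq, (e.app v).finrank_eq, Module.finrank_zero_of_subsingleton]
  · rw [← (place.snd v K).finrank_eq, (e.app _).finrank_eq, (place.fst v.succ L).finrank_eq]
  · have : Subsingleton ((place v K).obj v.succ.succ) :=
      place.subsingleton v.succ_succ_ne v.succ.succ_ne
    rw [← (place.snd v.succ L).finrank_eq, ← (e.app _).finrank_eq,
      Module.finrank_zero_of_subsingleton]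

theorem place_iso_far {v w : Vertex} {K L : Kron k} (e : Iso (place v K) (place w L)) (h : v ≠ w)
    (h1 : v ≠ w.succ) (h2 : w ≠ v.succ) :
    Module.finrank k K.V = 0 ∧ Module.finrank k K.W = 0 := by
  have : Subsingleton ((place w L).obj v) := place.subsingleton h h1
  have : Subsingleton ((place w L).obj v.succ) :=
    place.subsingleton h2.symm fun h' => h (Vertex.succ_injective h')
  rw [← (place.fst v K).finrank_eq, (e.app v).finrank_eq, ← (place.snd v K).finrank_eq,
    (e.app _).finrank_eq]
  exact ⟨Module.finrank_zero_of_subsingleton, Module.finrank_zero_of_subsingleton⟩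

/-- A module at a single vertex has two descriptions, `(0, W)` and `(W, 0)`. This shows that
unevenness can be read off from any description. -/
theorem place_iso_finrank {v w : Vertex} {K L : Kron k} (e : Iso (place v K) (place w L)) :
    Module.finrank k K.V = Module.finrank k K.W ↔
      Module.finrank k L.V = Module.finrank k L.W := by
  by_cases h : v = w
  · subst h
    rw [← (place.fst v K).finrank_eq, (e.app v).finrank_eq, (place.fst v L).finrank_eq,
      ← (place.snd v K).finrank_eq, (e.app v.succ).finrank_eq, (place.snd v L).finrank_eq]
  by_cases h1 : v = w.succ
  · subst h1
    obtain ⟨a, b, c⟩ := place_iso_succ e.symm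
    omega
  by_cases h2 : w = v.succ
  · subst h2
    obtain ⟨a, b, c⟩ := place_iso_succ e
    omega
  have h3 := place_iso_far e h h1 h2
  have h4 := place_iso_far e.symm (Ne.symm h) h2 h1
  omega

theorem Rep.IsUneven.finrank_ne {v : Vertex} {K : Kron k} {N : Rep k} (h : N.IsUneven)
    (e : Iso N (place v K)) : Module.finrank k K.V ≠ Module.finrank k K.W := by
  obtain ⟨h1, w, L, ⟨d⟩, h2⟩ := h
  rwa [Ne, place_iso_finrank (e.symm.trans d)]

theorem place_stable_refl {v : Vertex} {K : Kron k} (h : (place v K).IsStableVertex)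
    [Nontrivial K.V] (hK : K.Gen) (w : Vertex) : (place w K.refl).IsStableVertex := by
  have : Module.Finite k K.V := place_finite_fst h.1
  have : Module.Finite k K.refl.V :=
    inferInstanceAs (Module.Finite k (LinearMap.ker (K.x.coprod K.y)))
  have : Module.Finite k K.refl.W := inferInstanceAs (Module.Finite k K.V)
  exact place_isStableVertex (hK.refl_isIndecomposable h.2.1 w)

theorem place_stable_corefl {v : Vertex} {K : Kron k} (h : (place v K).IsStableVertex)
    [Nontrivial K.W] (hK : K.Cogen) (w : Vertex) : (place w K.corefl).IsStableVertex := by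
  have : Module.Finite k K.W := place_finite_snd h.1
  have : Module.Finite k K.corefl.V := inferInstanceAs (Module.Finite k K.W)
  have : Module.Finite k K.corefl.W :=
    inferInstanceAs (Module.Finite k ((K.W × K.W) ⧸ LinearMap.range (K.x.prod K.y)))
  exact place_isStableVertex (hK.corefl_isIndecomposable h.2.1 w)

/-- A property that holds for simple modules and is invariant under syzygies and cosyzygies
holds for all uneven Kronecker modules. -/
theorem place_uneven_induction {P : Rep k → Prop} (hiso : ∀ {M N : Rep k}, Iso M N → P M → P N)
    (hsimple : ∀ v, P (simpleAt k v))
    (hdown : ∀ {M' M : Rep k}, Syz M' M → M'.IsStableVertex → M.IsStableVertex → P M → P M')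
    (hup : ∀ {M' M : Rep k}, Syz M' M → M'.IsStableVertex → M.IsStableVertex → P M' → P M)
    (n : ℕ) : ∀ (v : Vertex) (K : Kron k), Module.finrank k K.V + Module.finrank k K.W = n →
      (place v K).IsStableVertex → Module.finrank k K.V ≠ Module.finrank k K.W →
      P (place v K) ∧ (Module.finrank k K.V = Module.finrank k K.W + 1 ∨
        Module.finrank k K.W = Module.finrank k K.V + 1) := by
  induction n using Nat.strong_induction_on with
  | _ n ih =>
  intro v K hn hS hne
  have : Module.Finite k K.V := place_finite_fst hS.1
  have : Module.Finite k K.W := place_finite_snd hS.1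
  -- Modules with first space zero are simple and start the induction.
  have base : ∀ (v : Vertex) (K : Kron k), (place v K).IsIndecomposable → Subsingleton K.V →
      P (place v K) ∧ Module.finrank k K.W = 1 := fun v K hS hV => by
    have h1 := hS.finrank_snd
    have : Module.Finite k K.W := Module.finite_of_finrank_eq_succ h1
    have e₀ : PUnit.{u + 1} ≃ₗ[k] K.V :=
      { toFun := fun _ => 0, invFun := fun _ => PUnit.unit, map_add' := fun _ _ => (add_zero 0).symm,
        map_smul' := fun _ _ => (smul_zero _).symm, left_inv := fun _ => rfl,
        right_inv := fun _ => Subsingleton.elim _ _ }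
    have e₁ : k ≃ₗ[k] K.W := LinearEquiv.ofFinrankEq _ _ (by rw [h1, Module.finrank_self])
    refine ⟨hiso (isoPlace (simpleAt k v) v (fun w h h' => place.subsingleton h h')
      ((place.fst v _).trans e₀) ((place.snd v _).trans e₁) (fun p => ?_) fun p => ?_)
      (hsimple v), h1⟩
    · have : p = 0 := (place.fst v _).injective rfl
      rw [this, map_zero, map_zero, map_zero, map_zero]
    · have : p = 0 := (place.fst v _).injective rfl
      rw [this, map_zero, map_zero, map_zero, map_zero]
  -- For dimensions `(a, b)` with `a < b` the syzygy lowers the sum by `2(b - a)`; for `a > b` the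
  -- cosyzygy lowers it by `2(a - b)`. Both keep `a - b`, which is `1` or `-1` for the simple
  -- modules.
  rcases lt_or_gt_of_ne hne with hlt | hlt
  · rcases subsingleton_or_nontrivial K.V with hV | hV
    · have h1 := base v K hS.2.1 hV
      refine ⟨h1.1, Or.inr ?_⟩
      rw [h1.2, Module.finrank_zero_of_subsingleton]
    · have hK := hS.2.1.gen
      have hr := hK.finrank_refl
      have hW : Module.finrank k K.refl.W = Module.finrank k K.V := rfl
      have hS' := place_stable_refl hS hK v.succ
      obtain ⟨h1, h2⟩ := ih _ (by omega) v.succ K.refl rfl hS' (by omega)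
      exact ⟨hup (hK.syz v) hS' hS h1, by omega⟩
  · rcases subsingleton_or_nontrivial K.W with hW | hW
    · obtain ⟨v, rfl⟩ := v.exists_succ_eq
      have h1 := base v _ (hS.2.1.of_iso (placeShift v K)) inferInstance
      have h2 : Module.finrank k K.V = 1 := h1.2
      refine ⟨hiso (placeShift v K).symm h1.1, Or.inl ?_⟩
      rw [h2, Module.finrank_zero_of_subsingleton]
    · have hK := hS.2.1.cogen
      have hr := hK.finrank_corefl
      have hV : Module.finrank k K.corefl.V = Module.finrank k K.W := rfl
      obtain ⟨v, rfl⟩ := v.exists_succ_eq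
      have hS' := place_stable_corefl hS hK v
      obtain ⟨h1, h2⟩ := ih _ (by omega) v K.corefl rfl hS' (by omega)
      exact ⟨hdown (hK.syz v) hS hS' h1, by omega⟩

theorem Rep.IsUneven.induction {P : Rep k → Prop} (hiso : ∀ {M N : Rep k}, Iso M N → P M → P N)
    (hsimple : ∀ v, P (simpleAt k v))
    (hdown : ∀ {M' M : Rep k}, Syz M' M → M'.IsStableVertex → M.IsStableVertex → P M → P M')
    (hup : ∀ {M' M : Rep k}, Syz M' M → M'.IsStableVertex → M.IsStableVertex → P M' → P M)
    {N : Rep k} (hN : N.IsUneven) : P N := by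
  obtain ⟨h, v, K, ⟨e⟩, h2⟩ := hN
  exact hiso e.symm (place_uneven_induction hiso hsimple hdown hup _ v K rfl (h.of_iso e) h2).1

theorem Rep.IsUneven.finrank {v : Vertex} {K : Kron k} {N : Rep k} (h : N.IsUneven)
    (e : Iso N (place v K)) : Module.finrank k K.V = Module.finrank k K.W + 1 ∨
      Module.finrank k K.W = Module.finrank k K.V + 1 :=
  (place_uneven_induction (P := fun _ => True) (fun _ _ => trivial) (fun _ => trivial)
    (fun _ _ _ _ => trivial) (fun _ _ _ _ => trivial) _ v K rfl (h.1.of_iso e)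
    (h.finrank_ne e)).2

/-- Transport of a short exact sequence along isomorphisms. -/
def Syz.of_iso {M' M N' N : Rep k} (s : Syz M' M) (e' : Iso M' N') (e : Iso M N) : Syz N' N where
  J := s.J
  finite := s.finite
  proj := s.proj
  inj := s.inj
  i := s.i.comp e'.symm.hom
  p := e.hom.comp s.p
  i_inj v := (s.i_inj v).comp (e'.app v).symm.injective
  p_surj v := (e.app v).surjective.comp (s.p_surj v)
  comp_zero v m := by
    change e.app v (s.p.app v (s.i.app v _)) = 0
    rw [s.comp_zero, map_zero]
  exact v x hx := by
    obtain ⟨m, rfl⟩ := s.exact v x ((e.app v).map_eq_zero_iff.1 hx)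
    exact ⟨e'.app v m, congrArg (s.i.app v) ((e'.app v).symm_apply_apply m)⟩

/-- The syzygy keeps the difference of the two dimensions, so unevenness passes back from it to the
module. -/
theorem Rep.IsStableVertex.exists_syz {N : Rep k} (hN : N.IsStableVertex) :
    ∃ N' : Rep k, N'.IsStableVertex ∧ Nonempty (Syz N' N) ∧ (N'.IsUneven → N.IsUneven) := by
  obtain ⟨v, K, hK, hV, ⟨e⟩⟩ := hN.exists_gen
  have hS := hN.of_iso e
  have : Module.Finite k K.V := place_finite_fst hS.1
  refine ⟨_, place_stable_refl hS hK v.succ, ⟨(hK.syz v).of_iso (Iso.refl _) e.symm⟩, fun h => ?_⟩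
  have h1 := h.finrank_ne (Iso.refl _)
  have hr := hK.finrank_refl
  have hW : Module.finrank k K.refl.W = Module.finrank k K.V := rfl
  exact ⟨hN, v, K, ⟨e⟩, by omega⟩

theorem Rep.IsStableVertex.exists_cosyz {N : Rep k} (hN : N.IsStableVertex) :
    ∃ N' : Rep k, N'.IsStableVertex ∧ Nonempty (Syz N N') ∧ (N'.IsUneven → N.IsUneven) := by
  obtain ⟨v, K, hK, hV, ⟨e⟩⟩ := hN.exists_cogen
  have hS := hN.of_iso e
  have : Module.Finite k K.V := place_finite_fst hS.1
  have : Module.Finite k K.W := place_finite_snd hS.1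
  obtain ⟨v, rfl⟩ := v.exists_succ_eq
  refine ⟨_, place_stable_corefl hS hK v, ⟨(hK.syz v).of_iso e.symm (Iso.refl _)⟩, fun h => ?_⟩
  have h1 := h.finrank_ne (Iso.refl _)
  have hr := hK.finrank_corefl
  have hW : Module.finrank k K.corefl.V = Module.finrank k K.W := rfl
  exact ⟨hN, _, K, ⟨e⟩, by omega⟩

end Even


section PlaceMaps

variable {R : Type u} [CommRing R] {v : Vertex} {K L M : Kron R}

/-! ### The two linear maps that make up a homomorphism of Kronecker modules -/

/-- The first component of a homomorphism of Kronecker modules. -/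
def Hom.fst (f : Hom (place v K) (place v L)) : K.V →ₗ[R] L.V :=
  (place.fst v L).toLinearMap ∘ₗ f.app v ∘ₗ (place.fst v K).symm.toLinearMap

/-- The second component of a homomorphism of Kronecker modules. -/
def Hom.snd (f : Hom (place v K) (place v L)) : K.W →ₗ[R] L.W :=
  (place.snd v L).toLinearMap ∘ₗ f.app v.succ ∘ₗ (place.snd v K).symm.toLinearMap

theorem Hom.snd_x (f : Hom (place v K) (place v L)) (a : K.V) : f.snd (K.x a) = L.x (f.fst a) := by
  have h := f.app_X v ((place.fst v K).symm a)
  have h' : (place v K).X v ((place.fst v K).symm a) = (place.snd v K).symm (K.x a) := by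
    rw [LinearEquiv.eq_symm_apply, place.snd_X, LinearEquiv.apply_symm_apply]
  rw [h'] at h
  exact (congrArg (place.snd v L) h).trans (place.snd_X _)

theorem Hom.snd_y (f : Hom (place v K) (place v L)) (a : K.V) : f.snd (K.y a) = L.y (f.fst a) := by
  have h := f.app_Y v ((place.fst v K).symm a)
  have h' : (place v K).Y v ((place.fst v K).symm a) = (place.snd v K).symm (K.y a) := by
    rw [LinearEquiv.eq_symm_apply, place.snd_Y, LinearEquiv.apply_symm_apply]
  rw [h'] at h
  exact (congrArg (place.snd v L) h).trans (place.snd_Y _)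

theorem Hom.fst_app (f : Hom (place v K) (place v L)) (p : (place v K).obj v) :
    place.fst v L (f.app v p) = f.fst (place.fst v K p) := by
  conv_lhs => rw [← (place.fst v K).symm_apply_apply p]
  rfl

theorem Hom.snd_app (f : Hom (place v K) (place v L)) (p : (place v K).obj v.succ) :
    place.snd v L (f.app v.succ p) = f.snd (place.snd v K p) := by
  conv_lhs => rw [← (place.snd v K).symm_apply_apply p]
  rfl

theorem Hom.fst_comp (g : Hom (place v L) (place v M)) (f : Hom (place v K) (place v L)) (a : K.V) :
    (g.comp f).fst a = g.fst (f.fst a) :=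
  g.fst_app (f.app v ((place.fst v K).symm a))

theorem Hom.snd_comp (g : Hom (place v L) (place v M)) (f : Hom (place v K) (place v L)) (b : K.W) :
    (g.comp f).snd b = g.snd (f.snd b) :=
  g.snd_app (f.app v.succ ((place.snd v K).symm b))

theorem Hom.place_ext {f g : Hom (place v K) (place v L)} (h₀ : ∀ a, f.fst a = g.fst a)
    (h₁ : ∀ b, f.snd b = g.snd b) : f = g :=
  place_hom_ext (fun p => (place.fst v L).injective (by rw [Hom.fst_app, Hom.fst_app, h₀]))
    fun p => (place.snd v L).injective (by rw [Hom.snd_app, Hom.snd_app, h₁])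

theorem Hom.app_eq_smul_iff {f : Hom (place v K) (place v K)} {c : R} :
    (∀ w n, f.app w n = c • n) ↔ (∀ a, f.fst a = c • a) ∧ ∀ b, f.snd b = c • b := by
  constructor
  · intro h
    refine ⟨fun a => ?_, fun b => ?_⟩
    · refine (congrArg (place.fst v K) (h v _)).trans ?_
      rw [map_smul]
      exact congrArg (c • ·) ((place.fst v K).apply_symm_apply a)
    · refine (congrArg (place.snd v K) (h _ _)).trans ?_
      rw [map_smul]
      exact congrArg (c • ·) ((place.snd v K).apply_symm_apply b)
  · rintro ⟨h₀, h₁⟩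
    have : f = c • Hom.id _ := Hom.place_ext h₀ h₁
    intro w n
    rw [this]; rfl

end PlaceMaps

/-! ### Simple modules, scalar endomorphisms and the neighbours of simple modules -/

section Component

variable {k : Type u} [Field k] {v : Vertex}

/-- The simple representation at `v`, as a Kronecker module at `v`. -/
@[reducible] def simpleTop (k : Type u) [Field k] (v : Vertex) : Rep k :=
  place v ⟨k, PUnit.{u + 1}, 0, 0⟩

/-- The two descriptions of a simple representation as a Kronecker module. -/
noncomputable def simpleIso (k : Type u) [Field k] (v : Vertex) :
    Iso (simpleTop k v.succ) (simpleAt k v) :=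
  placeShift v ⟨k, PUnit.{u + 1}, 0, 0⟩

theorem endo_scalar_of_iso {M N : Rep k} (e : Iso M N)
    (h : ∀ f : Hom M M, ∃ c : k, ∀ v n, f.app v n = c • n) (f : Hom N N) :
    ∃ c : k, ∀ v n, f.app v n = c • n := by
  obtain ⟨c, hc⟩ := h (e.symm.hom.comp (f.comp e.hom))
  refine ⟨c, fun v n => ?_⟩
  have h1 := hc v ((e.app v).symm n)
  change (e.app v).symm (f.app v (e.app v ((e.app v).symm n))) = _ at h1
  rwa [LinearEquiv.apply_symm_apply, ← map_smul, (e.app v).symm.injective.eq_iff] at h1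

theorem simpleAt_endo_scalar (f : Hom (simpleAt k v) (simpleAt k v)) :
    ∃ c : k, ∀ w n, f.app w n = c • n := by
  refine ⟨f.snd (1 : k), Hom.app_eq_smul_iff.2 ⟨fun a => rfl, fun (b : k) => ?_⟩⟩
  have h := f.snd.map_smul b (1 : k)
  rw [smul_eq_mul, mul_one] at h
  rw [h]
  exact mul_comm _ _

theorem simpleAt_isStableVertex : (simpleAt k v).IsStableVertex := by
  have : Nontrivial (Kron.W (⟨PUnit.{u + 1}, k, 0, 0⟩ : Kron k)) := inferInstanceAs (Nontrivial k)
  have : Module.Finite k (Kron.W (⟨PUnit.{u + 1}, k, 0, 0⟩ : Kron k)) :=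
    inferInstanceAs (Module.Finite k k)
  have : Module.Finite k (Kron.V (⟨PUnit.{u + 1}, k, 0, 0⟩ : Kron k)) :=
    inferInstanceAs (Module.Finite k PUnit.{u + 1})
  exact place_isStableVertex
    (Rep.isIndecomposable_of_endo_scalar Kron.isNonzero_of_snd simpleAt_endo_scalar)

theorem simpleTop_isStableVertex : (simpleTop k v).IsStableVertex := by
  obtain ⟨v, rfl⟩ := v.exists_succ_eq
  exact simpleAt_isStableVertex.of_iso (simpleIso k v).symm

/-- True for simple modules, and carried along `Ω` and `Ω⁻¹` because endomorphisms of stably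
faithful modules correspond to those of their syzygies. -/
theorem Rep.IsUneven.endo_scalar {N : Rep k} (hN : N.IsUneven) (f : Hom N N) :
    ∃ c : k, ∀ v n, f.app v n = c • n :=
  hN.induction (P := fun N => ∀ f : Hom N N, ∃ c : k, ∀ v n, f.app v n = c • n)
    (fun e h => endo_scalar_of_iso e h) (fun _ => simpleAt_endo_scalar)
    (fun s h' _ h => Syz.endo_scalar_down s h'.stablyFaithful h)
    (fun s _ h' h => Syz.endo_scalar_up s h'.1 h'.stablyFaithful h) f

/-! ### Irreducible maps between simple and other modules -/

/-- The zero map factors into two zero maps, neither of which splits. -/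
theorem Hom.IsIrreducible.ne_zero {M N : Rep k} {f : Hom M N} (hf : f.IsIrreducible)
    (hM : M.IsNonzero) (hN : N.IsNonzero) (fN : N.IsFinite) : f ≠ 0 := by
  rintro rfl
  rcases hf.2.2 N fN 0 0 rfl with ⟨r, hr⟩ | ⟨r, hr⟩
  · obtain ⟨v, hv⟩ := hM
    obtain ⟨a, ha⟩ := exists_ne (0 : M.obj v)
    exact ha ((Hom.congr_apply hr v a).symm.trans (map_zero (r.app v)))
  · obtain ⟨v, hv⟩ := hN
    obtain ⟨a, ha⟩ := exists_ne (0 : N.obj v)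
    exact ha (Hom.congr_apply hr v a).symm

variable {L : Kron k}

/-- A linear form on `V`, extended by zero on `W`, is a homomorphism to the simple module at `v`;
one with value `1` on the image of the generator is a retraction of `f`. -/
theorem not_isIrreducible_simpleTop_place (f : Hom (simpleTop k v) (place v L)) (h0 : f ≠ 0) :
    ¬ f.IsIrreducible := fun hf => by
  refine hf.1 ?_
  have hn : f.fst (1 : k) ≠ 0 := fun h => h0 (Hom.place_ext (fun (a : k) => by
    have h1 := f.fst.map_smul a (1 : k)
    rw [h, smul_zero, smul_eq_mul, mul_one] at h1
    exact h1) fun b => map_zero f.snd)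
  obtain ⟨φ, hφ⟩ := Module.Projective.exists_dual_eq_one k hn
  refine ⟨placeHom φ 0 (fun _ => rfl) (fun _ => rfl), Hom.place_ext (fun (a : k) => ?_)
    fun b => rfl⟩
  have h1 := f.fst.map_smul a (1 : k)
  rw [smul_eq_mul, mul_one] at h1
  change φ (f.fst a) = a
  rw [h1, map_smul, hφ, smul_eq_mul, mul_one]

/-- Dually, a vector of `W` with nonzero image spans a simple submodule, which splits `f`. -/
theorem not_isIrreducible_place_simpleAt (f : Hom (place v L) (simpleAt k v)) (h0 : f ≠ 0) :
    ¬ f.IsIrreducible := fun hf => by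
  refine hf.2.1 ?_
  have hn : ∃ b, f.snd b ≠ (0 : k) := by
    by_contra! hcon
    exact h0 (Hom.place_ext (fun _ => rfl) hcon)
  obtain ⟨b, hb⟩ := hn
  refine ⟨placeHom 0 (LinearMap.toSpanSingleton k L.W ((f.snd b : k)⁻¹ • b)) (fun _ => by simp)
    (fun _ => by simp), Hom.place_ext (fun _ => rfl) fun (a : k) => ?_⟩
  change f.snd (a • (f.snd b : k)⁻¹ • b) = a
  rw [map_smul, map_smul]
  change a * ((f.snd b : k)⁻¹ * f.snd b) = a
  rw [inv_mul_cancel₀ hb, mul_one]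

/-- Write `f(1) = x a + y b` and factor `f` through the free Kronecker module `Z` on two generators
mapping to `a` and `b`. The map to `Z` lands in the radical and cannot split, so `Z → L` splits.
Then `xa + ya' = 0` only for `a = a' = 0`, as holds in `Z`, and `V × V → W` is bijective. -/
theorem finrank_of_isIrreducible_simpleAt_place (hL : L.Gen) [Module.Finite k L.V]
    (f : Hom (simpleAt k v) (place v L)) (hf : f.IsIrreducible) :
    Module.finrank k L.W = Module.finrank k L.V + Module.finrank k L.V := by
  obtain ⟨a, b, hab⟩ := hL (f.snd (1 : k))
  let Z : Kron k := ⟨k × k, (k × k) × (k × k), LinearMap.inl k _ _, LinearMap.inr k _ _⟩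
  let γ : (k × k) →ₗ[k] L.V :=
    (LinearMap.toSpanSingleton k L.V a).coprod (LinearMap.toSpanSingleton k L.V b)
  let h : Hom (simpleAt k v) (place v Z) :=
    placeHom 0 (LinearMap.toSpanSingleton k ((k × k) × (k × k)) ((1, 0), (0, 1)))
      (fun _ => by simp) (fun _ => by simp)
  let g : Hom (place v Z) (place v L) := placeHom γ ((L.x ∘ₗ γ).coprod (L.y ∘ₗ γ))
    (fun p => by simp [Z]) (fun p => by simp [Z])
  have hgh : g.comp h = f := Hom.place_ext (fun a => (map_zero f.fst).symm ▸ map_zero γ)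
    fun (c : k) => by
      have h1 := f.snd.map_smul c (1 : k)
      rw [smul_eq_mul, mul_one] at h1
      rw [h1, hab]
      change L.x (γ (c • (1, 0))) + L.y (γ (c • (0, 1))) = _
      simp [γ]
  have : Module.Finite k Z.V := inferInstanceAs (Module.Finite k (k × k))
  have : Module.Finite k Z.W := inferInstanceAs (Module.Finite k ((k × k) × (k × k)))
  rcases hf.2.2 _ (place_isFinite v Z) h g hgh with ⟨r, hr⟩ | ⟨s, hs⟩
  · have h1 : (r.comp h).snd (1 : k) = (1 : k) := by rw [hr]; rfl
    have h2 : r.snd (Z.x ((1, 0) : k × k) + Z.y ((0, 1) : k × k)) = (1 : k) := by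
      refine Eq.trans ?_ h1
      change _ = r.snd ((1 : k) • (((1, 0), (0, 1)) : (k × k) × (k × k)))
      simp [Z]
    rw [map_add, r.snd_x, r.snd_y] at h2
    exact absurd ((add_zero (0 : k)).symm.trans h2) zero_ne_one
  · have hg : ∀ a, g.fst (s.fst a) = a := fun a => by rw [← Hom.fst_comp, hs]; rfl
    have hinj : Function.Bijective (L.x.coprod L.y) := by
      refine ⟨(injective_iff_map_eq_zero _).2 ?_, fun b => ?_⟩
      · rintro ⟨a, a'⟩ haa
        have h1 : s.snd (L.x a + L.y a') = ((s.fst a, s.fst a') : (k × k) × (k × k)) := by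
          rw [map_add, s.snd_x, s.snd_y]
          change ((s.fst a, 0) : (k × k) × (k × k)) + ((0, s.fst a') : (k × k) × (k × k)) = _
          simp
        change L.x a + L.y a' = 0 at haa
        rw [haa, map_zero] at h1
        have h2 : s.fst a = (0 : k × k) := (congrArg Prod.fst h1).symm
        have h3 : s.fst a' = (0 : k × k) := (congrArg Prod.snd h1).symm
        have h4 := hg a
        have h5 := hg a'
        erw [h2, map_zero] at h4
        erw [h3, map_zero] at h5
        rw [← h4, ← h5]; rfl
      · obtain ⟨a, a', h⟩ := hL b
        exact ⟨(a, a'), h.symm⟩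
    rw [← (LinearEquiv.ofBijective _ hinj).finrank_eq, Module.finrank_prod]

/-- Dually, cogeneration writes the linear form `f` on `V` as `α x + β y`, which factors `f` through
a cofree Kronecker module `Z` with second space `k × k`. The map from `Z` cannot split, so `L → Z`
splits and `V → W × W` is bijective. -/
theorem finrank_of_isIrreducible_place_simpleTop (hL : L.Cogen) [Module.Finite k L.W]
    (f : Hom (place v L) (simpleTop k v)) (hf : f.IsIrreducible) :
    Module.finrank k L.V = Module.finrank k L.W + Module.finrank k L.W := by
  have hinj : Function.Injective (L.x.prod L.y) := (injective_iff_map_eq_zero _).2 fun a ha =>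
    hL a (congrArg Prod.fst ha) (congrArg Prod.snd ha)
  obtain ⟨ρ, hρ⟩ := (L.x.prod L.y).exists_leftInverse_of_injective (LinearMap.ker_eq_bot.2 hinj)
  let φ : L.V →ₗ[k] k := f.fst
  let α : L.W →ₗ[k] k := φ ∘ₗ ρ ∘ₗ LinearMap.inl k _ _
  let β : L.W →ₗ[k] k := φ ∘ₗ ρ ∘ₗ LinearMap.inr k _ _
  have hαβ : ∀ a, φ a = α (L.x a) + β (L.y a) := fun a => by
    change _ = φ (ρ (L.x a, 0)) + φ (ρ (0, L.y a))
    rw [← map_add, ← map_add, Prod.mk_add_mk, add_zero, zero_add]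
    exact congrArg φ (LinearMap.congr_fun hρ a).symm
  let Z : Kron k := ⟨(k × k) × (k × k), k × k, LinearMap.fst k _ _, LinearMap.snd k _ _⟩
  let γ : L.W →ₗ[k] k × k := α.prod β
  let h : Hom (place v L) (place v Z) :=
    placeHom ((γ ∘ₗ L.x).prod (γ ∘ₗ L.y)) γ (fun _ => rfl) (fun _ => rfl)
  let g : Hom (place v Z) (simpleTop k v) :=
    placeHom ((LinearMap.fst k k k).coprod (LinearMap.snd k k k)) 0 (fun _ => rfl) (fun _ => rfl)
  have hgh : g.comp h = f := Hom.place_ext (fun a => (hαβ a).symm) fun _ => rfl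
  have : Module.Finite k Z.V := inferInstanceAs (Module.Finite k ((k × k) × (k × k)))
  have : Module.Finite k Z.W := inferInstanceAs (Module.Finite k (k × k))
  rcases hf.2.2 _ (place_isFinite v Z) h g hgh with ⟨r, hr⟩ | ⟨s, hs⟩
  · have hr' : ∀ b, r.snd (h.snd b) = b := fun b => by rw [← Hom.snd_comp, hr]; rfl
    have hbij : Function.Bijective (L.x.prod L.y) := by
      refine ⟨hinj, fun ⟨b, b'⟩ => ⟨r.fst ((γ b, γ b') : (k × k) × (k × k)), Prod.ext ?_ ?_⟩⟩
      · change L.x (r.fst _) = b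
        rw [← r.snd_x]
        exact hr' b
      · change L.y (r.fst _) = b'
        rw [← r.snd_y]
        exact hr' b'
    rw [(LinearEquiv.ofBijective _ hbij).finrank_eq, Module.finrank_prod]
  · have h1 : s.fst (1 : k) = ((0, 0) : (k × k) × (k × k)) :=
      Prod.ext ((s.snd_x (1 : k)).symm.trans (map_zero s.snd))
        ((s.snd_y (1 : k)).symm.trans (map_zero s.snd))
    have h2 : (g.comp s).fst (1 : k) = (1 : k) := by rw [hs]; rfl
    rw [Hom.fst_comp, h1] at h2
    exact absurd ((map_zero g.fst).symm.trans h2) zero_ne_one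

theorem simpleAt_place_eq {w : Vertex} (f : Hom (simpleAt k v) (place w L)) (hf : f ≠ 0) :
    w = v ∨ w = v.succ := by
  by_contra! hcon
  refine hf (place_hom_ext (fun p => ?_) fun p => ?_)
  · have : p = 0 := (place.fst v _).injective rfl
    rw [this, map_zero, map_zero]
  · exact (place.subsingleton hcon.2.symm fun h => hcon.1 (Vertex.succ_injective h).symm).elim _ _

theorem place_simpleAt_eq {w : Vertex} (f : Hom (place w L) (simpleAt k v)) (hf : f ≠ 0) :
    w = v ∨ w = v.succ := by
  by_contra! hcon
  refine hf (hom_place_ext (fun p => (place.fst v _).injective rfl) fun p => ?_)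
  rw [place.eq_zero hcon.2.symm (fun h => hcon.1 (Vertex.succ_injective h).symm) p, map_zero,
    map_zero]

/-- If `N` sits at `v`, then `dim W = 2 dim V` with `V ≠ 0`. If it sits at `v.succ`, the map would
be a split monomorphism. -/
theorem isUneven_of_irreducible_simpleAt {N : Rep k} (hN : N.IsStableVertex)
    (f : Hom (simpleAt k v) N) (hf : f.IsIrreducible) : N.IsUneven := by
  obtain ⟨w, L, hL, hV, ⟨e⟩⟩ := hN.exists_gen
  have hS := hN.of_iso e
  have : Module.Finite k L.V := place_finite_fst hS.1
  have hf' := hf.comp_iso (Iso.refl _) e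
  have h0 := hf'.ne_zero simpleAt_isStableVertex.2.1.1 hS.2.1.1 hS.1
  rcases simpleAt_place_eq _ h0 with rfl | rfl
  · have h1 := finrank_of_isIrreducible_simpleAt_place hL _ hf'
    have h2 : 0 < Module.finrank k L.V := Module.finrank_pos
    exact ⟨hN, w, L, ⟨e⟩, by omega⟩
  · have hf'' := hf.comp_iso (simpleIso k v).symm e
    exact absurd hf'' (not_isIrreducible_simpleTop_place _
      (hf''.ne_zero simpleTop_isStableVertex.2.1.1 hS.2.1.1 hS.1))

theorem isUneven_of_irreducible_to_simpleAt {N : Rep k} (hN : N.IsStableVertex)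
    (f : Hom N (simpleAt k v)) (hf : f.IsIrreducible) : N.IsUneven := by
  obtain ⟨w, L, hL, hV, ⟨e⟩⟩ := hN.exists_cogen
  have hS := hN.of_iso e
  have : Module.Finite k L.W := place_finite_snd hS.1
  have hf' := hf.comp_iso e (Iso.refl _)
  have h0 := hf'.ne_zero hS.2.1.1 simpleAt_isStableVertex.2.1.1 simpleAt_isStableVertex.1
  rcases place_simpleAt_eq _ h0 with rfl | rfl
  · exact absurd hf' (not_isIrreducible_place_simpleAt _ h0)
  · have h1 := finrank_of_isIrreducible_place_simpleTop hL _ (hf.comp_iso e (simpleIso k v).symm)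
    have h2 : 0 < Module.finrank k L.W := Module.finrank_pos
    exact ⟨hN, _, L, ⟨e⟩, by omega⟩

/-- By induction along `Ω` and `Ω⁻¹`: the irreducible map is moved to the (co)syzygies, where the
claim is known, and unevenness of the far end passes back. -/
theorem Rep.IsUneven.of_irreducible_from {M : Rep k} (hM : M.IsUneven) {N : Rep k}
    (hN : N.IsStableVertex) (f : Hom M N) (hf : f.IsIrreducible) : N.IsUneven := by
  refine hM.induction (P := fun M => ∀ N : Rep k, N.IsStableVertex →
      ∀ f : Hom M N, f.IsIrreducible → N.IsUneven)
    (fun e h N hN f hf => h N hN _ (hf.comp_iso e.symm (Iso.refl _)))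
    (fun v N hN f hf => isUneven_of_irreducible_simpleAt hN f hf) ?_ ?_ N hN f hf
  · intro M' M s hM' hM ih N' hN' f' hf'
    obtain ⟨N, hN, ⟨t⟩, h⟩ := hN'.exists_cosyz
    obtain ⟨f, hf⟩ := s.exists_ladder_up t f'
    exact h (ih N hN f (hf.isIrreducible_up hM.stablyFaithful hN.stablyFaithful
      hM'.stablyFaithful hN'.stablyFaithful hM.1 hN.1 hf'))
  · intro M' M s hM' hM ih N hN f hf
    obtain ⟨N', hN', ⟨t⟩, h⟩ := hN.exists_syz
    obtain ⟨f', hf'⟩ := s.exists_ladder_down t hN.1 f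
    exact h (ih N' hN' f' (hf'.isIrreducible_down hM.stablyFaithful hN.stablyFaithful
      hM'.stablyFaithful hN'.stablyFaithful hM.1 hf))

theorem Rep.IsUneven.of_irreducible_to {M : Rep k} (hM : M.IsUneven) {N : Rep k}
    (hN : N.IsStableVertex) (f : Hom N M) (hf : f.IsIrreducible) : N.IsUneven := by
  refine hM.induction (P := fun M => ∀ N : Rep k, N.IsStableVertex →
      ∀ f : Hom N M, f.IsIrreducible → N.IsUneven)
    (fun e h N hN f hf => h N hN _ (hf.comp_iso (Iso.refl _) e.symm))
    (fun v N hN f hf => isUneven_of_irreducible_to_simpleAt hN f hf) ?_ ?_ N hN f hf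
  · intro M' M s hM' hM ih N' hN' f' hf'
    obtain ⟨N, hN, ⟨t⟩, h⟩ := hN'.exists_cosyz
    obtain ⟨f, hf⟩ := t.exists_ladder_up s f'
    exact h (ih N hN f (hf.isIrreducible_up hN.stablyFaithful hM.stablyFaithful
      hN'.stablyFaithful hM'.stablyFaithful hN.1 hM.1 hf'))
  · intro M' M s hM' hM ih N hN f hf
    obtain ⟨N', hN', ⟨t⟩, h⟩ := hN.exists_syz
    obtain ⟨f', hf'⟩ := t.exists_ladder_down s hM.1 f
    exact h (ih N' hN' f' (hf'.isIrreducible_down hN.stablyFaithful hM.stablyFaithful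
      hN'.stablyFaithful hM'.stablyFaithful hN.1 hf))

theorem StableLink.isUneven_iff {M N : Rep k} (h : StableLink M N) : M.IsUneven ↔ N.IsUneven := by
  obtain ⟨hM, hN, ⟨⟨e⟩⟩ | ⟨f, hf⟩⟩ := h
  · exact ⟨fun h => h.of_iso e, fun h => h.of_iso e.symm⟩
  · exact ⟨fun h => h.of_irreducible_from hN f hf, fun h => h.of_irreducible_to hM f hf⟩

theorem eqvGen_isUneven_iff {M N : Rep k} (h : Relation.EqvGen StableLink M N) :
    M.IsUneven ↔ N.IsUneven := by
  induction h with
  | rel _ _ h => exact h.isUneven_iff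
  | refl => exact Iff.rfl
  | symm _ _ _ h => exact h.symm
  | trans _ _ _ _ _ h h' => exact h.trans h'

theorem eqvGen_isStableVertex_iff {M N : Rep k} (h : Relation.EqvGen StableLink M N) :
    M.IsStableVertex ↔ N.IsStableVertex := by
  induction h with
  | rel _ _ h => exact ⟨fun _ => h.2.1, fun _ => h.1⟩
  | refl => exact Iff.rfl
  | symm _ _ _ h => exact h.symm
  | trans _ _ _ _ _ h h' => exact h.trans h'

end Component


section SimpleComponent

variable {k : Type u} [Field k]

/-! ### Components of simple modules -/

theorem Syz.iso_down {M' M N' N : Rep k} (s : Syz M' M) (t : Syz N' N) (hM' : M'.StablyFaithful)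
    (hN' : N'.StablyFaithful) (fM : M.IsFinite) (fN : N.IsFinite) (e : Iso M N) :
    Nonempty (Iso M' N') := by
  obtain ⟨f, hf⟩ := s.exists_ladder_down t fN e.hom
  obtain ⟨g, hg⟩ := t.exists_ladder_down s fM e.symm.hom
  have h1 := hg.comp hf
  have h2 := hf.comp hg
  rw [e.symm_hom_comp] at h1
  rw [e.hom_comp_symm] at h2
  exact ⟨Iso.ofHoms f g (h1.down_unique hM' s.ladder_id) (h2.down_unique hN' t.ladder_id)⟩

theorem Syz.iso_up {M' M N' N : Rep k} (s : Syz M' M) (t : Syz N' N) (hM : M.StablyFaithful)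
    (hN : N.StablyFaithful) (e : Iso M' N') : Nonempty (Iso M N) := by
  obtain ⟨f, hf⟩ := s.exists_ladder_up t e.hom
  obtain ⟨g, hg⟩ := t.exists_ladder_up s e.symm.hom
  have h1 := hg.comp hf
  have h2 := hf.comp hg
  rw [e.symm_hom_comp] at h1
  rw [e.hom_comp_symm] at h2
  exact ⟨Iso.ofHoms f g (h1.up_unique hM s.ladder_id) (h2.up_unique hN t.ladder_id)⟩

theorem StableLink.syz {M' M N' N : Rep k} (h : StableLink M N) (s : Syz M' M) (t : Syz N' N)
    (hM' : M'.IsStableVertex) (hN' : N'.IsStableVertex) : StableLink M' N' := by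
  obtain ⟨hM, hN, ⟨⟨e⟩⟩ | ⟨f, hf⟩⟩ := h
  · exact ⟨hM', hN', Or.inl (s.iso_down t hM'.stablyFaithful hN'.stablyFaithful hM.1 hN.1 e)⟩
  · obtain ⟨f', hf'⟩ := s.exists_ladder_down t hN.1 f
    exact ⟨hM', hN', Or.inr ⟨f', hf'.isIrreducible_down hM.stablyFaithful hN.stablyFaithful
      hM'.stablyFaithful hN'.stablyFaithful hM.1 hf⟩⟩

theorem StableLink.cosyz {M' M N' N : Rep k} (h : StableLink M' N') (s : Syz M' M) (t : Syz N' N)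
    (hM : M.IsStableVertex) (hN : N.IsStableVertex) : StableLink M N := by
  obtain ⟨hM', hN', ⟨⟨e⟩⟩ | ⟨f', hf'⟩⟩ := h
  · exact ⟨hM, hN, Or.inl (s.iso_up t hM.stablyFaithful hN.stablyFaithful e)⟩
  · obtain ⟨f, hf⟩ := s.exists_ladder_up t f'
    exact ⟨hM, hN, Or.inr ⟨f, hf.isIrreducible_up hM.stablyFaithful hN.stablyFaithful
      hM'.stablyFaithful hN'.stablyFaithful hM.1 hN.1 hf'⟩⟩

theorem Rep.IsStableVertex.stableLink_iso {M N : Rep k} (h : M.IsStableVertex) (e : Iso M N) :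
    StableLink M N :=
  ⟨h, h.of_iso e, Or.inl ⟨e⟩⟩

/-- `Ω` carries connected modules to connected modules; the intermediate vertices of a chain need
syzygies of their own, which exist as they are stable vertices. -/
theorem eqvGen_syz {M N : Rep k} (h : Relation.EqvGen StableLink M N) :
    ∀ {M' N' : Rep k}, Syz M' M → Syz N' N → M.IsStableVertex → M'.IsStableVertex →
      N'.IsStableVertex → Relation.EqvGen StableLink M' N' := by
  induction h with
  | rel _ _ h => exact fun s t _ h1 h2 => .rel _ _ (h.syz s t h1 h2)
  | refl => exact fun s t h h1 h2 => .rel _ _ ((h.stableLink_iso (Iso.refl _)).syz s t h1 h2)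
  | symm _ _ h ih =>
    exact fun s t hM h1 h2 => .symm _ _ (ih t s ((eqvGen_isStableVertex_iff h).2 hM) h2 h1)
  | trans _ _ _ h _ ih ih' =>
    intro M' N' s t hM h1 h2
    have hZ := (eqvGen_isStableVertex_iff h).1 hM
    obtain ⟨Z', hZ', ⟨r⟩, -⟩ := hZ.exists_syz
    exact .trans _ _ _ (ih s r hM h1 hZ') (ih' r t hZ hZ' h2)

theorem eqvGen_cosyz {M' N' : Rep k} (h : Relation.EqvGen StableLink M' N') :
    ∀ {M N : Rep k}, Syz M' M → Syz N' N → M'.IsStableVertex → M.IsStableVertex →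
      N.IsStableVertex → Relation.EqvGen StableLink M N := by
  induction h with
  | rel _ _ h => exact fun s t _ h1 h2 => .rel _ _ (h.cosyz s t h1 h2)
  | refl => exact fun s t h h1 h2 => .rel _ _ ((h.stableLink_iso (Iso.refl _)).cosyz s t h1 h2)
  | symm _ _ h ih =>
    exact fun s t hM h1 h2 => .symm _ _ (ih t s ((eqvGen_isStableVertex_iff h).2 hM) h2 h1)
  | trans _ _ _ h _ ih ih' =>
    intro M N s t hM h1 h2
    have hZ := (eqvGen_isStableVertex_iff h).1 hM
    obtain ⟨Z', hZ', ⟨r⟩, -⟩ := hZ.exists_cosyz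
    exact .trans _ _ _ (ih s r hM h1 hZ') (ih' r t hZ hZ' h2)

/-- The syzygy of a simple module, as a Kronecker module. -/
@[reducible] def simpleSyz (k : Type u) [Field k] (v : Vertex) : Rep k :=
  place v ⟨k × k, k, LinearMap.fst k k k, LinearMap.snd k k k⟩

variable {v : Vertex}

theorem simpleSyz_exact (a b : k)
    (_ : (0 : k →ₗ[k] PUnit.{u + 1}) a + (0 : k →ₗ[k] PUnit.{u + 1}) b = 0) :
    ∃ c, LinearMap.fst k k k c = a ∧ LinearMap.snd k k k c = b :=
  ⟨(a, b), rfl, rfl⟩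

/-- The radical of the projective cover of the simple module at `v`: two-dimensional at `v.succ`,
with one-dimensional socle. -/
def syzSimple (k : Type u) [Field k] (v : Vertex) : Syz (simpleSyz k v.succ) (simpleTop k v) :=
  syzPlace v (LinearMap.fst k k k) (LinearMap.snd k k k) 0 0 (fun _ => rfl)
    (fun _ h h' => Prod.ext h h') simpleSyz_exact (fun _ => ⟨0, 0, rfl⟩)

theorem simpleSyz_isStableVertex : (simpleSyz k v).IsStableVertex := by
  have h : (simpleSyz k v).IsIndecomposable :=
    syz_isIndecomposable (v := v) (x := (0 : k →ₗ[k] PUnit.{u + 1})) (y := 0) (fun _ => rfl)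
      (fun _ h h' => Prod.ext h h') simpleSyz_exact (fun _ => ⟨0, 0, rfl⟩)
      simpleTop_isStableVertex.2.1 v
  have : Module.Finite k (Kron.V (⟨k × k, k, LinearMap.fst k k k, LinearMap.snd k k k⟩ : Kron k)) :=
    inferInstanceAs (Module.Finite k (k × k))
  have : Module.Finite k (Kron.W (⟨k × k, k, LinearMap.fst k k k, LinearMap.snd k k k⟩ : Kron k)) :=
    inferInstanceAs (Module.Finite k k)
  exact place_isStableVertex h

/-- The projection of the syzygy of one simple module onto another simple module. -/
def simpleSyzHom (k : Type u) [Field k] (v : Vertex) : Hom (simpleSyz k v) (simpleTop k v) :=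
  placeHom (LinearMap.fst k k k) 0 (fun _ => rfl) (fun _ => rfl)

/-- Here the image of the socle is `X² z`. Subtracting `X z` from `h e` gives an element `a` that
`X` and `Y` kill. It has the same image under `g` as `h e`, because the target vanishes at `v`; so
`a` defines a section of `g`. -/
theorem simpleSyzHom_isSplitEpi {Z : Rep k} (h : Hom (simpleSyz k v.succ) Z)
    (g : Hom Z (simpleTop k v.succ)) (hgh : g.comp h = simpleSyzHom k v.succ) (z : Z.obj v)
    (hz : Z.X _ (Z.X _ z) = h.app _ ((place.snd v.succ _).symm (1 : k))) : g.IsSplitEpi := by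
  let e : (simpleSyz k v.succ).obj v.succ := (place.fst v.succ _).symm ((1, 0) : k × k)
  have hx : (simpleSyz k v.succ).X _ e = (place.snd v.succ _).symm (1 : k) := by
    rw [LinearEquiv.eq_symm_apply, place.snd_X, LinearEquiv.apply_symm_apply]; rfl
  have hy : (simpleSyz k v.succ).Y _ e = 0 := by
    rw [← (place.snd v.succ _).map_eq_zero_iff, place.snd_Y, LinearEquiv.apply_symm_apply]; rfl
  let a : Z.obj v.succ := h.app _ e - Z.X _ z
  have ha : place.fst v.succ _ (g.app _ a) = (1 : k) := by
    have h1 := Hom.congr_apply hgh v.succ e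
    have h2 : (simpleTop k v.succ).X v (g.app v z) = 0 := by
      rw [place.eq_zero v.succ_ne.symm v.succ_succ_ne.symm (g.app v z), map_zero]
    change g.app _ (h.app _ e) = _ at h1
    rw [map_sub, h1, g.app_X, h2, sub_zero]
    rfl
  have hXa : Z.X _ a = 0 := by rw [map_sub, hz, ← h.app_X, hx, sub_self]
  have hYa : Z.Y _ a = 0 := by rw [map_sub, Z.Y_X, ← h.app_Y, hy, map_zero, sub_zero]
  refine ⟨fromPlace (K := ⟨k, PUnit.{u + 1}, 0, 0⟩) (LinearMap.toSpanSingleton k _ a) 0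
    (fun c => ?_) (fun c => ?_) (fun _ => map_zero _) (fun _ => map_zero _),
    Hom.place_ext (fun (c : k) => ?_) fun _ => rfl⟩
  · rw [LinearMap.toSpanSingleton_apply, map_smul, hXa, smul_zero]; rfl
  · rw [LinearMap.toSpanSingleton_apply, map_smul, hYa, smul_zero]; rfl
  · change place.fst v.succ _ (g.app v.succ ((fromPlace _ _ _ _ _ _).app v.succ _)) = c
    rw [fromPlace_fst]
    change place.fst v.succ _ (g.app v.succ (c • a)) = c
    rw [map_smul, map_smul, ha]
    exact mul_one c

/-- Here a linear form `φ` vanishes on the image of `X²` and is `1` on the image of the socle. As `φ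
X² = φ Y² = 0`, the maps `(φ X, φ Y)` and `φ` form a homomorphism back. It is the identity on the
socle, hence everywhere, since the two coordinates at the top are detected by `X` and `Y`. -/
theorem simpleSyzHom_isSplitMono {Z : Rep k} (h : Hom (simpleSyz k v.succ) Z)
    (hz : ∀ z : Z.obj v, Z.X _ (Z.X _ z) ≠ h.app _ ((place.snd v.succ _).symm (1 : k))) :
    h.IsSplitMono := by
  obtain ⟨ψ, hψ, hψ'⟩ := Submodule.exists_le_ker_of_notMem
    (p := LinearMap.range (Z.X v.succ ∘ₗ Z.X v)) fun ⟨z, h⟩ => hz z h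
  obtain ⟨φ, hφ, hφ'⟩ : ∃ φ : Z.obj v.succ.succ →ₗ[k] k,
      φ (h.app _ ((place.snd v.succ _).symm (1 : k))) = 1 ∧ ∀ z, φ (Z.X _ (Z.X _ z)) = 0 := by
    refine ⟨(ψ (h.app _ ((place.snd v.succ _).symm (1 : k))))⁻¹ • ψ, inv_mul_cancel₀ hψ,
      fun z => ?_⟩
    rw [LinearMap.smul_apply, show ψ (Z.X _ (Z.X _ z)) = 0 from hψ' ⟨z, rfl⟩, smul_zero]
  let r : Hom Z (simpleSyz k v.succ) :=
    toPlace ((φ ∘ₗ Z.X _).prod (φ ∘ₗ Z.Y _)) φ (fun _ => rfl) (fun _ => rfl)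
      (fun u hu n => by
        obtain rfl := Vertex.succ_injective hu
        exact Prod.ext (hφ' n) ((congrArg φ (Z.Y_X _ n)).trans (map_zero φ)))
      (fun u hu n => by
        obtain rfl := Vertex.succ_injective hu
        exact Prod.ext ((congrArg φ (Z.X_Y _ n)).trans (map_zero φ))
          ((congrArg φ (Z.Y_Y _ n)).trans (hφ' n)))
  have hr : ∀ c : k, (r.comp h).snd c = c := fun c => by
    have h1 := (r.comp h).snd.map_smul c (1 : k)
    rw [smul_eq_mul, mul_one] at h1
    refine h1.trans ?_
    rw [show (r.comp h).snd (1 : k) = (1 : k) from hφ]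
    exact mul_one c
  refine ⟨r, Hom.place_ext (fun (a : k × k) => Prod.ext ?_ ?_) hr⟩
  · exact ((r.comp h).snd_x a).symm.trans (hr a.1)
  · exact ((r.comp h).snd_y a).symm.trans (hr a.2)

theorem simpleSyzHom_isIrreducible : (simpleSyzHom k v).IsIrreducible := by
  obtain ⟨v, rfl⟩ := v.exists_succ_eq
  refine ⟨fun ⟨r, hr⟩ => ?_, fun ⟨s, hs⟩ => ?_, fun Z _ h g hgh => ?_⟩
  · have h1 : (r.comp (simpleSyzHom k v.succ)).snd (1 : k) = (1 : k) := by rw [hr]; rfl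
    rw [Hom.snd_comp] at h1
    exact zero_ne_one ((map_zero r.snd).symm.trans h1)
  · have h1 : ((simpleSyzHom k v.succ).comp s).fst (1 : k) = (1 : k) := by rw [hs]; rfl
    rw [Hom.fst_comp] at h1
    exact zero_ne_one ((map_zero s.snd).symm.trans ((s.snd_x (1 : k)).trans h1))
  · by_cases hz : ∃ z : Z.obj v, Z.X _ (Z.X _ z) = h.app _ ((place.snd v.succ _).symm (1 : k))
    · obtain ⟨z, hz⟩ := hz
      exact Or.inr (simpleSyzHom_isSplitEpi h g hgh z hz)
    · exact Or.inl (simpleSyzHom_isSplitMono h (not_exists.1 hz))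

theorem simpleSyz_link : StableLink (simpleSyz k v) (simpleTop k v) :=
  ⟨simpleSyz_isStableVertex, simpleTop_isStableVertex, Or.inr ⟨_, simpleSyzHom_isIrreducible⟩⟩

theorem simpleTop_isSimple : (simpleTop k v).IsSimple := by
  refine ⟨simpleTop_isStableVertex.2.1.1, fun N _ => ?_⟩
  have hz : ∀ w, w ≠ v → Subsingleton ((simpleTop k v).obj w) := fun w hw => by
    by_cases h' : w = v.succ
    · subst h'
      exact (place.snd v _).injective.subsingleton (β := PUnit.{u + 1})
    · exact place.subsingleton hw h'
  have key : N v = ⊥ ∨ N v = ⊤ := by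
    have h1 : ∀ S : Submodule k k, S = ⊥ ∨ S = ⊤ := fun S => eq_bot_or_eq_top S
    let e : (simpleTop k v).obj v ≃ₗ[k] k := place.fst v _
    refine (h1 ((N v).map e.toLinearMap)).imp (fun h => ?_) fun h => ?_
    · exact (Submodule.map_eq_bot_iff (e := e)).1 h
    · exact (Submodule.map_eq_top_iff (e := e)).1 h
  refine key.imp (fun h w => ?_) fun h w => ?_ <;>
  · by_cases hw : w = v
    · subst hw; exact h
    · have := hz w hw
      exact Subsingleton.elim _ _

/-- The syzygy of the simple module at `v` is linked to the simple module at `v.succ`. So `Ω` moves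
the component of one simple module to that of the next, and `Ω⁻¹` moves it back. -/
theorem Rep.IsUneven.eqvGen_simpleTop {N : Rep k} (hN : N.IsUneven) :
    ∃ v, Relation.EqvGen StableLink N (simpleTop k v) := by
  have key : N.IsStableVertex ∧ ∃ v, Relation.EqvGen StableLink N (simpleTop k v) :=
    hN.induction (P := fun N => N.IsStableVertex ∧ ∃ v, Relation.EqvGen StableLink N (simpleTop k v))
      (fun e ⟨h, v, hv⟩ => ⟨h.of_iso e, v, .trans _ _ _ (.symm _ _ (.rel _ _ (h.stableLink_iso e))) hv⟩)
      (fun v => ⟨simpleAt_isStableVertex, v.succ,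
        .rel _ _ (simpleAt_isStableVertex.stableLink_iso (simpleIso k v).symm)⟩)
      (fun s hM' hM ⟨_, v, hv⟩ => ⟨hM', v.succ, .trans _ _ _
        (eqvGen_syz hv s (syzSimple k v) hM hM' simpleSyz_isStableVertex) (.rel _ _ simpleSyz_link)⟩)
      (fun s hM' hM ⟨_, w, hw⟩ => by
        obtain ⟨v, rfl⟩ := w.exists_succ_eq
        exact ⟨hM, v, eqvGen_cosyz (.trans _ _ _ hw (.symm _ _ (.rel _ _ simpleSyz_link))) s
          (syzSimple k v) hM' hM simpleTop_isStableVertex⟩)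
  exact key.2

/-- The common kernel of `X` and `Y` is zero or everything. It contains the second space, so if it
were zero the second space would vanish and the first space would lie in it. So the arrows act as
zero, and `W = xV + yV = 0` while `V ≠ 0`. -/
theorem Rep.IsSimple.isUneven {N : Rep k} (hN : N.IsSimple) (hS : N.IsStableVertex) :
    N.IsUneven := by
  obtain ⟨v, K, hK, hV, ⟨e⟩⟩ := hS.exists_gen
  refine ⟨hS, v, K, ⟨e⟩, ?_⟩
  have hfin := place_finite_fst (hS.of_iso e).1
  have hXY : ∀ (p : (place v K).obj v.succ), (place v K).X _ p = 0 ∧ (place v K).Y _ p = 0 :=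
    fun p => ⟨place.eq_zero v.succ_succ_ne v.succ.succ_ne _,
      place.eq_zero v.succ_succ_ne v.succ.succ_ne _⟩
  have key : (∀ u n, N.X u n = 0 ∧ N.Y u n = 0 → n = 0) ∨ ∀ u n, N.X u n = 0 ∧ N.Y u n = 0 := by
    refine (hN.2 (fun u => LinearMap.ker (N.X u) ⊓ LinearMap.ker (N.Y u))
      (.of_XY (fun u n hn => ?_) fun u n hn => ?_)).imp (fun h u n hn => ?_) fun h u n => ?_
    · rw [show N.X u n = 0 from hn.1]; exact zero_mem _
    · rw [show N.Y u n = 0 from hn.2]; exact zero_mem _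
    · have : n ∈ LinearMap.ker (N.X u) ⊓ LinearMap.ker (N.Y u) := hn
      rwa [h u] at this
    · have : n ∈ LinearMap.ker (N.X u) ⊓ LinearMap.ker (N.Y u) := by rw [h u]; trivial
      exact this
  rcases key with h | h
  · have hW : ∀ n : N.obj v.succ, n = 0 := fun n => h _ n
      ⟨(e.app _).map_eq_zero_iff.1 (by rw [e.app_X, (hXY _).1]),
        (e.app _).map_eq_zero_iff.1 (by rw [e.app_Y, (hXY _).2])⟩
    have : Nontrivial (N.obj v) :=
      ((e.app v).trans (place.fst v K)).symm.injective.nontrivial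
    obtain ⟨n, hn⟩ := exists_ne (0 : N.obj v)
    exact absurd (h v n ⟨hW _, hW _⟩) hn
  · have : Subsingleton K.W := subsingleton_of_forall_eq 0 fun b => by
      obtain ⟨a, a', rfl⟩ := hK b
      have hx : ∀ a : K.V, K.x a = 0 ∧ K.y a = 0 := fun a => by
        obtain ⟨p, rfl⟩ := (place.fst v K).surjective a
        obtain ⟨n, rfl⟩ := (e.app v).surjective p
        rw [← place.snd_X, ← place.snd_Y, ← e.app_X, ← e.app_Y, (h v n).1, (h v n).2]
        simp
      rw [(hx a).1, (hx a').2, add_zero]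
    rw [Module.finrank_zero_of_subsingleton (M := K.W)]
    exact Module.finrank_pos.ne'

/-- The components that contain simple modules consist of the uneven modules. -/
theorem Rep.inSimpleComponent_iff {N : Rep k} : N.InSimpleComponent ↔ N.IsUneven := by
  constructor
  · rintro ⟨S, hS, h1, h2, h3⟩
    exact (eqvGen_isUneven_iff h3).2 (hS.isUneven h2)
  · intro h
    obtain ⟨v, hv⟩ := h.eqvGen_simpleTop
    exact ⟨_, simpleTop_isSimple, h.1, simpleTop_isStableVertex, hv⟩

end SimpleComponent


/-! ### Zigzag Kronecker modules -/

/-- The elements of `{0, …, L}` that have the same parity as `q`. -/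
abbrev Pos (L q : ℕ) : Type := {j : Fin (L + 1) // ((j : ℕ) + q) % 2 = 0}

section Zigzag

variable {k : Type u} [Field k] {L p q : ℕ}

/-- The shift to the right. -/
def shiftRight (k : Type u) [Field k] (L p : ℕ) : (Pos L p → k) →ₗ[k] (Pos L (p + 1) → k) where
  toFun f i := if h : 1 ≤ (i.1 : ℕ) then f ⟨⟨i.1 - 1, by omega⟩, by have := i.2; dsimp only; omega⟩ else 0
  map_add' f g := by
    ext i
    simp only [Pi.add_apply]
    split_ifs <;> simp
  map_smul' c f := by
    ext i
    simp

theorem shiftRight_apply (f : Pos L p → k) (i : Pos L (p + 1)) :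
    shiftRight k L p f i = if h : 1 ≤ (i.1 : ℕ) then
      f ⟨⟨i.1 - 1, by omega⟩, by have := i.2; dsimp only; omega⟩ else 0 := rfl

/-- The shift to the left. -/
def shiftLeft (k : Type u) [Field k] (L p : ℕ) : (Pos L p → k) →ₗ[k] (Pos L (p + 1) → k) where
  toFun f i := if h : (i.1 : ℕ) + 1 ≤ L then
    f ⟨⟨i.1 + 1, by omega⟩, by have := i.2; dsimp only; omega⟩ else 0
  map_add' f g := by
    ext i
    simp only [Pi.add_apply]
    split_ifs <;> simp
  map_smul' c f := by
    ext i
    simp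

/-- The value at a natural number, which is zero outside of the index set. -/
def ev (f : Pos L q → k) (m : ℕ) : k :=
  if h : m ≤ L ∧ (m + q) % 2 = 0 then f ⟨⟨m, by omega⟩, h.2⟩ else 0

theorem ev_val (f : Pos L q → k) (i : Pos L q) : ev f i.1 = f i :=
  dif_pos ⟨by have := i.1.2; omega, i.2⟩

theorem ev_of_not (f : Pos L q → k) {m : ℕ} (h : ¬ (m ≤ L ∧ (m + q) % 2 = 0)) : ev f m = 0 :=
  dif_neg h

theorem ev_zero (m : ℕ) : ev (0 : Pos L q → k) m = 0 := by
  unfold ev; split_ifs <;> rfl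

theorem ev_shiftRight_zero (f : Pos L p → k) : ev (shiftRight k L p f) 0 = 0 := by
  unfold ev
  split_ifs with h
  · rw [shiftRight_apply, dif_neg (by simp)]
  · rfl

theorem ev_shiftRight_succ (f : Pos L p → k) {m : ℕ} (hm : m + 1 ≤ L) :
    ev (shiftRight k L p f) (m + 1) = ev f m := by
  unfold ev
  by_cases h : (m + p) % 2 = 0
  · rw [dif_pos ⟨hm, by omega⟩, dif_pos ⟨by omega, h⟩]
    rw [shiftRight_apply, dif_pos (by simp)]
    rfl
  · rw [dif_neg (by omega), dif_neg (by omega)]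

theorem ev_shiftLeft (f : Pos L p → k) {m : ℕ} (hm : m ≤ L) :
    ev (shiftLeft k L p f) m = ev f (m + 1) := by
  unfold ev
  by_cases h : (m + (p + 1)) % 2 = 0
  · rw [dif_pos ⟨hm, h⟩]
    by_cases h' : m + 1 ≤ L
    · rw [dif_pos ⟨h', by omega⟩]
      exact dif_pos h'
    · rw [dif_neg (by omega)]
      exact dif_neg h'
  · rw [dif_neg (by omega), dif_neg (by omega)]

theorem ext_ev {f g : Pos L q → k} (h : ∀ m ≤ L, ev f m = ev g m) : f = g :=
  funext fun i => by rw [← ev_val f, ← ev_val g, h _ (by have := i.1.2; omega)]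

/-- The characteristic function of a natural number. -/
def delta (k : Type u) [Field k] (L q j : ℕ) : Pos L q → k := fun i => if (i.1 : ℕ) = j then 1 else 0

theorem ev_delta (j m : ℕ) :
    ev (delta k L q j) m = if m = j ∧ m ≤ L ∧ (m + q) % 2 = 0 then 1 else 0 := by
  unfold ev
  by_cases h : m ≤ L ∧ (m + q) % 2 = 0
  · rw [dif_pos h]
    refine if_congr ?_ rfl rfl
    simp [h]
  · rw [dif_neg h, if_neg fun h' => h h'.2]

theorem delta_of_not {j : ℕ} (h : ¬ (j ≤ L ∧ (j + q) % 2 = 0)) : delta k L q j = 0 :=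
  ext_ev fun m _ => by rw [ev_delta, ev_zero, if_neg (by rintro ⟨rfl, h'⟩; exact h h')]

theorem delta_ne_zero {j : ℕ} (h : j ≤ L ∧ (j + q) % 2 = 0) : delta k L q j ≠ 0 := fun h0 => by
  have h1 := ev_delta (k := k) (L := L) (q := q) j j
  rw [h0, ev_zero, if_pos ⟨rfl, h⟩] at h1
  exact zero_ne_one h1

theorem shiftRight_delta (j : ℕ) :
    shiftRight k L p (delta k L p j) = delta k L (p + 1) (j + 1) :=
  ext_ev fun m hm => by
    rcases m with _ | m
    · rw [ev_shiftRight_zero, ev_delta, if_neg (by omega)]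
    · rw [ev_shiftRight_succ _ hm, ev_delta, ev_delta]
      split_ifs <;> first | rfl | omega

theorem shiftLeft_delta_zero : shiftLeft k L p (delta k L p 0) = 0 :=
  ext_ev fun m hm => by
    rw [ev_shiftLeft _ hm, ev_delta, ev_zero, if_neg (by omega)]

theorem shiftLeft_delta_succ {j : ℕ} (hj : j + 1 ≤ L) :
    shiftLeft k L p (delta k L p (j + 1)) = delta k L (p + 1) j :=
  ext_ev fun m hm => by
    rw [ev_shiftLeft _ hm, ev_delta, ev_delta]
    split_ifs <;> first | rfl | omega

theorem eq_smul_of_delta {F : (Pos L q → k) →ₗ[k] (Pos L q → k)} {c : k}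
    (h : ∀ j ≤ L, F (delta k L q j) = c • delta k L q j) (f : Pos L q → k) : F f = c • f := by
  have : F = c • LinearMap.id := by
    refine LinearMap.pi_ext' fun i => LinearMap.ext_ring ?_
    have h1 : (Pi.single i 1 : Pos L q → k) = delta k L q i.1 := by
      ext m
      rw [Pi.single_apply, delta]
      congr 1
      rw [Subtype.ext_iff, Fin.ext_iff]
    change F (Pi.single i 1) = c • (Pi.single i 1 : Pos L q → k)
    rw [h1, h _ (by have := i.1.2; omega)]
  rw [this]; rfl

/-- The combinatorial form of the fact that the endomorphisms of an even zigzag are scalar. -/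
theorem zigzag_matrix {cF cG : ℕ → ℕ → k} (hL : L % 2 = 0)
    (hF : ∀ i j, ¬ (i ≤ L ∧ (i + p) % 2 = 0) ∨ ¬ (j ≤ L ∧ (j + p) % 2 = 0) → cF i j = 0)
    (hG : ∀ i j, ¬ (i ≤ L ∧ (i + p) % 2 = 1) ∨ ¬ (j ≤ L ∧ (j + p) % 2 = 1) → cG i j = 0)
    (h1 : ∀ i j, i + 1 ≤ L → cG (i + 1) (j + 1) = cF i j) (h2 : ∀ j, cG 0 (j + 1) = 0)
    (h3 : ∀ i j, i ≤ L → j + 1 ≤ L → cG i j = cF (i + 1) (j + 1))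
    (h4 : ∀ i ≤ L, cF (i + 1) 0 = 0) :
    (∀ i j, i ≠ j → cF i j = 0 ∧ cG i j = 0) ∧
      ∀ j ≤ L, cF j j + cG j j = cF 0 0 + cG 0 0 := by
  -- Entries agree along each diagonal, with `cF` and `cG` exchanged at every step. Off the main
  -- diagonal one slides to a boundary. In this case it is the upper end, where entries vanish by
  -- parity or because an index exceeds `L`; `d` bounds the number of steps left.
  have up : ∀ i j, (i < j ∧ p % 2 = 0 ∨ j < i ∧ p % 2 = 1) → ∀ d, i ≤ L → j ≤ L → L ≤ i + d →
      cF i j = 0 ∧ cG i j = 0 := by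
    intro i j hij d
    induction d generalizing i j with
    | zero =>
      intro hi hj hd
      constructor
      · exact hF _ _ (by omega)
      · rcases hij with h | h
        · exact hG _ _ (by omega)
        · rw [h3 i j hi (by omega)]
          exact hF _ _ (by omega)
    | succ d ih =>
      intro hi hj hd
      rcases Nat.lt_or_ge i L with hi' | hi'
      · rcases Nat.lt_or_ge j L with hj' | hj'
        · have := ih (i + 1) (j + 1) (by omega) (by omega) (by omega) (by omega)
          rw [← h1 i j (by omega), h3 i j hi (by omega)]
          exact this.symm
        · obtain rfl : j = L := by omega
          refine ⟨?_, hG _ _ (by omega)⟩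
          rw [← h1 i j (by omega)]
          exact hG _ _ (by omega)
      · refine ⟨hF _ _ (by omega), ?_⟩
        rcases hij with h | h
        · exact hG _ _ (by omega)
        · rw [h3 i j hi (by omega)]
          exact hF _ _ (by omega)
  -- In the remaining case one slides down to index zero, where entries vanish by parity or by `h2`
  -- and `h4`.
  have down : ∀ i j, (i < j ∧ p % 2 = 1 ∨ j < i ∧ p % 2 = 0) → i ≤ L → j ≤ L →
      cF i j = 0 ∧ cG i j = 0 := by
    intro i
    induction i with
    | zero =>
      intro j hij hi hj
      refine ⟨hF _ _ (by omega), ?_⟩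
      obtain ⟨j, rfl⟩ : ∃ j', j = j' + 1 := ⟨j - 1, by omega⟩
      exact h2 j
    | succ i ih =>
      intro j hij hi hj
      rcases j with _ | j
      · exact ⟨h4 i (by omega), hG _ _ (by omega)⟩
      · have := ih j (by omega) (by omega) (by omega)
        rw [h1 i j hi, ← h3 i j (by omega) hj]
        exact this.symm
  refine ⟨fun i j hij => ?_, fun j => ?_⟩
  · by_cases hi : i ≤ L
    · by_cases hj : j ≤ L
      · rcases Nat.mod_two_eq_zero_or_one p with hp | hp <;> rcases lt_or_gt_of_ne hij with h | h
        · exact up i j (by omega) L hi hj (by omega)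
        · exact down i j (by omega) hi hj
        · exact down i j (by omega) hi hj
        · exact up i j (by omega) L hi hj (by omega)
      · exact ⟨hF _ _ (by omega), hG _ _ (by omega)⟩
    · exact ⟨hF _ _ (by omega), hG _ _ (by omega)⟩
  -- Parity kills one of the two summands at each `j`, and the step to `j + 1` exchanges their
  -- roles; the sum avoids the case distinction.
  · induction j with
    | zero => exact fun _ => rfl
    | succ j ih =>
      intro hj
      rw [h1 j j hj, ← h3 j j (by omega) hj, add_comm]
      exact ih (by omega)

/-- The hypotheses of `zigzag_matrix` are the two commutation relations read entry by entry, with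
the boundary positions, where a shift gives zero, listed separately. -/
theorem zigzag_scalar (hL : L % 2 = 0) {F : (Pos L p → k) →ₗ[k] (Pos L p → k)}
    {G : (Pos L (p + 1) → k) →ₗ[k] (Pos L (p + 1) → k)}
    (hr : ∀ f, G (shiftRight k L p f) = shiftRight k L p (F f))
    (hl : ∀ f, G (shiftLeft k L p f) = shiftLeft k L p (F f)) :
    ∃ c : k, (∀ f, F f = c • f) ∧ ∀ f, G f = c • f := by
  let cF : ℕ → ℕ → k := fun i j => ev (F (delta k L p j)) i
  let cG : ℕ → ℕ → k := fun i j => ev (G (delta k L (p + 1) j)) i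
  have hF : ∀ i j, ¬ (i ≤ L ∧ (i + p) % 2 = 0) ∨ ¬ (j ≤ L ∧ (j + p) % 2 = 0) → cF i j = 0 := by
    rintro i j (h | h)
    · exact ev_of_not _ h
    · change ev (F _) i = 0
      rw [delta_of_not h, map_zero, ev_zero]
  have hG : ∀ i j, ¬ (i ≤ L ∧ (i + p) % 2 = 1) ∨ ¬ (j ≤ L ∧ (j + p) % 2 = 1) → cG i j = 0 := by
    rintro i j (h | h)
    · exact ev_of_not _ (by omega)
    · change ev (G _) i = 0
      rw [delta_of_not (by omega), map_zero, ev_zero]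
  obtain ⟨h1, h2⟩ := zigzag_matrix hL hF hG
    (fun i j hi => by
      change ev (G _) (i + 1) = ev (F _) i
      rw [← shiftRight_delta, hr, ev_shiftRight_succ _ hi])
    (fun j => by
      change ev (G _) 0 = 0
      rw [← shiftRight_delta, hr, ev_shiftRight_zero])
    (fun i j hi hj => by
      change ev (G _) i = ev (F _) (i + 1)
      rw [← shiftLeft_delta_succ hj, hl, ev_shiftLeft _ hi])
    (fun i hi => by
      change ev (F _) (i + 1) = 0
      rw [← ev_shiftLeft _ hi, ← hl, shiftLeft_delta_zero, map_zero, ev_zero])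
  have ev_smul : ∀ {q : ℕ} (c : k) (f : Pos L q → k) m, ev (c • f) m = c * ev f m := by
    intro q c f m
    unfold ev
    split_ifs
    · rfl
    · rw [mul_zero]
  refine ⟨cF 0 0 + cG 0 0, eq_smul_of_delta fun j hj => ext_ev fun m hm => ?_,
    eq_smul_of_delta fun j hj => ext_ev fun m hm => ?_⟩
  · change cF m j = _
    rw [ev_smul, ev_delta, ← h2 j hj]
    by_cases h : m = j
    · subst h
      by_cases h' : (m + p) % 2 = 0
      · rw [if_pos ⟨rfl, hm, h'⟩, hG m m (by omega), add_zero, mul_one]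
      · rw [if_neg (by omega), hF m m (by omega), mul_zero]
    · rw [if_neg (by omega), (h1 m j h).1, mul_zero]
  · change cG m j = _
    rw [ev_smul, ev_delta, ← h2 j hj]
    by_cases h : m = j
    · subst h
      by_cases h' : (m + p) % 2 = 0
      · rw [if_neg (by omega), hG m m (by omega), mul_zero]
      · rw [if_pos ⟨rfl, hm, by omega⟩, hF m m (by omega), zero_add, mul_one]
    · rw [if_neg (by omega), (h1 m j h).2, mul_zero]

theorem card_pos (n q : ℕ) : Fintype.card (Pos (2 * n) q) = if q % 2 = 0 then n + 1 else n := by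
  have h1 : Fintype.card (Pos (2 * n) q) =
      ∑ i ∈ Finset.range (2 * n + 1), if (i + q) % 2 = 0 then 1 else 0 := by
    rw [Fintype.card_subtype, Finset.card_filter,
      Fin.sum_univ_eq_sum_range (fun i => if (i + q) % 2 = 0 then 1 else 0)]
  rw [h1]
  induction n with
  | zero =>
    rw [Finset.sum_range_one, zero_add]
  | succ n ih =>
    rw [show 2 * (n + 1) + 1 = 2 * n + 1 + 1 + 1 by ring, Finset.sum_range_succ,
      Finset.sum_range_succ, ih (by
        rw [Fintype.card_subtype, Finset.card_filter,
          Fin.sum_univ_eq_sum_range (fun i => if (i + q) % 2 = 0 then 1 else 0)])]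
    split_ifs <;> omega

/-- For odd `L` the positions fall into pairs `(0, 1), (2, 3), …`. For even `p` the first members
index the source and the right shift moves each to its partner; for odd `p` the left shift does so,
as the next lemma states. -/
theorem shiftRight_bijective (hL : L % 2 = 1) (hp : p % 2 = 0) :
    Function.Bijective (shiftRight k L p) := by
  refine ⟨(injective_iff_map_eq_zero _).2 fun f hf => ext_ev fun m hm => ?_, fun b => ?_⟩
  · rcases Nat.lt_or_ge m L with h | h
    · rw [← ev_shiftRight_succ _ h, hf, ev_zero, ev_zero]
    · rw [ev_zero, ev_of_not _ (by omega)]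
  · refine ⟨fun j => ev b (j.1 + 1), ext_ev fun m hm => ?_⟩
    rcases m with _ | m
    · rw [ev_shiftRight_zero, ev_of_not _ (by omega)]
    · rw [ev_shiftRight_succ _ hm]
      by_cases h : (m + p) % 2 = 0
      · exact dif_pos ⟨by omega, h⟩
      · rw [ev_of_not _ (by omega), ev_of_not _ (by omega)]

theorem shiftLeft_bijective (hL : L % 2 = 1) (hp : p % 2 = 1) :
    Function.Bijective (shiftLeft k L p) := by
  refine ⟨(injective_iff_map_eq_zero _).2 fun f hf => ext_ev fun m hm => ?_, fun b => ?_⟩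
  · rcases m with _ | m
    · rw [ev_zero, ev_of_not _ (by omega)]
    · rw [← ev_shiftLeft _ (by omega), hf, ev_zero, ev_zero]
  · refine ⟨fun j => ev b (j.1 - 1), ext_ev fun m hm => ?_⟩
    rw [ev_shiftLeft _ hm]
    by_cases h : (m + (p + 1)) % 2 = 0
    · exact dif_pos ⟨by omega, by omega⟩
    · rw [ev_of_not _ (by omega), ev_of_not _ (by omega)]

end Zigzag


section Words

/-! ### The shape of strings -/

/-- The arrow `α_z` or `α*_z` that starts at a vertex. -/
def Vertex.arrX : Vertex → Arrow
  | .one z => .α z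
  | .two z => .αs z

/-- The arrow `β_z` or `β*_z` that starts at a vertex. -/
def Vertex.arrY : Vertex → Arrow
  | .one z => .β z
  | .two z => .βs z

theorem Arrow.tgt_eq (a : Arrow) : a.tgt = a.src.succ := by cases a <;> rfl

theorem Vertex.arrX_src (v : Vertex) : v.arrX.src = v := by cases v <;> rfl

theorem Vertex.arrY_src (v : Vertex) : v.arrY.src = v := by cases v <;> rfl

theorem Vertex.arrX_ne_arrY (v : Vertex) : v.arrX ≠ v.arrY := by
  cases v <;> simp [Vertex.arrX, Vertex.arrY]

theorem Arrow.eq_or_eq (a : Arrow) {v : Vertex} (h : a.src = v) : a = v.arrX ∨ a = v.arrY := by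
  subst h
  cases a <;> simp [Vertex.arrX, Vertex.arrY]

/-- Every path of length two occurs in a relation. So a string never has two consecutive letters of
the same direction. -/
theorem inRelation_of_tgt_eq_src {a b : Arrow} (h : a.tgt = b.src) : InRelation a b := by
  rcases a with z | z | z | z <;> rcases b with y | y | y | y <;>
    simp only [Arrow.tgt, Arrow.src, Vertex.one.injEq, Vertex.two.injEq, reduceCtorEq] at h <;>
    subst h <;> constructor

/-- `A` and `B` are the two arrows that start at `v`. -/
def IsArrowPair (v : Vertex) (A B : Arrow) : Prop :=
  (A = v.arrX ∧ B = v.arrY) ∨ (A = v.arrY ∧ B = v.arrX)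

theorem IsArrowPair.symm {v : Vertex} {A B : Arrow} (h : IsArrowPair v A B) : IsArrowPair v B A :=
  (h.imp And.symm And.symm).symm

theorem IsArrowPair.src {v : Vertex} {A B : Arrow} (h : IsArrowPair v A B) : A.src = v := by
  rcases h with ⟨rfl, -⟩ | ⟨rfl, -⟩
  · exact v.arrX_src
  · exact v.arrY_src

theorem IsArrowPair.ne {v : Vertex} {A B : Arrow} (h : IsArrowPair v A B) : A ≠ B := by
  rcases h with ⟨rfl, rfl⟩ | ⟨rfl, rfl⟩
  · exact v.arrX_ne_arrY
  · exact v.arrX_ne_arrY.symm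

theorem IsArrowPair.eq_right {v : Vertex} {A B a : Arrow} (h : IsArrowPair v A B) (ha : a.src = v)
    (hne : a ≠ A) : a = B := by
  rcases h with ⟨rfl, rfl⟩ | ⟨rfl, rfl⟩ <;> rcases a.eq_or_eq ha with h | h
  · exact absurd h hne
  · exact h
  · exact h
  · exact absurd h hne

theorem exists_isArrowPair (a : Arrow) : ∃ b, IsArrowPair a.src a b := by
  rcases a.eq_or_eq rfl with h | h
  · exact ⟨_, Or.inl ⟨h, rfl⟩⟩
  · exact ⟨_, Or.inr ⟨h, rfl⟩⟩

namespace StringWord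

/-- The letters of a string are alternately `A` and the inverse of `B`, for the two arrows `A`, `B`
that start at some vertex `v`. -/
structure Shape (w : StringWord) (v : Vertex) (A B : Arrow) (p : ℕ) : Prop where
  pair : IsArrowPair v A B
  letter : ∀ l : Fin w.length, w.letter l = if ((l : ℕ) + p) % 2 = 0 then .dir A else .inv B
  vert : ∀ i : Fin (w.length + 1), w.vert i = if ((i : ℕ) + p) % 2 = 0 then v else v.succ

/-- Directions alternate because paths of length two are forbidden, and reducedness excludes going
back along the same arrow; the only choice left at each turn is the other arrow from `v`. -/
theorem letter_shape (w : StringWord) {v : Vertex} {A B : Arrow} {p : ℕ} (h : IsArrowPair v A B)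
    (h0 : ∀ h0 : 0 < w.length, w.letter ⟨0, h0⟩ = if p % 2 = 0 then .dir A else .inv B) (n : ℕ)
    (hn : n < w.length) : w.letter ⟨n, hn⟩ = if (n + p) % 2 = 0 then .dir A else .inv B := by
  induction n with
  | zero => simpa using h0 hn
  | succ n ih =>
    have h1 := ih (by omega)
    have ht := w.target_eq ⟨n, by omega⟩
    have hs := w.source_eq ⟨n + 1, hn⟩
    have hts : (w.letter ⟨n + 1, hn⟩).source = (w.letter ⟨n, by omega⟩).target :=
      hs.trans (ht.trans rfl).symm
    have hr := w.reduced ⟨n, by omega⟩ ⟨n + 1, hn⟩ rfl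
    have hd := w.not_dir ⟨n, by omega⟩ ⟨n + 1, hn⟩ rfl
    have hi := w.not_inv ⟨n, by omega⟩ ⟨n + 1, hn⟩ rfl
    by_cases hpar : (n + p) % 2 = 0
    · rw [if_pos hpar] at h1
      rw [if_neg (by omega)]
      rw [h1] at hts hr
      rcases hb : w.letter ⟨n + 1, hn⟩ with b | b
      · rw [hb] at hts
        exact absurd (inRelation_of_tgt_eq_src hts.symm) (hd A b h1 hb)
      · rw [hb] at hts hr
        have hsrc : b.src = v := by
          have h2 : b.tgt = A.tgt := hts
          rw [b.tgt_eq, A.tgt_eq] at h2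
          rw [Vertex.succ_injective h2, h.src]
        rw [h.eq_right hsrc (by rintro rfl; exact hr rfl)]
    · rw [if_neg hpar] at h1
      rw [if_pos (by omega)]
      rw [h1] at hts hr
      rcases hb : w.letter ⟨n + 1, hn⟩ with b | b
      · rw [hb] at hts hr
        have hsrc : b.src = v := by
          have h2 : b.src = B.src := hts
          rw [h2, h.symm.src]
        rw [h.symm.eq_right hsrc (by rintro rfl; exact hr rfl)]
      · rw [hb] at hts
        exact absurd (inRelation_of_tgt_eq_src hts) (hi b B h1 hb)

theorem exists_shape (w : StringWord) : ∃ v A B p, w.Shape v A B p := by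
  rcases Nat.eq_zero_or_pos w.length with hL | hL
  · refine ⟨w.vert 0, _, _, 0, Or.inl ⟨rfl, rfl⟩, fun l => absurd l.2 (by omega), fun i => ?_⟩
    have : i = 0 := Fin.ext (by have := i.2; simp; omega)
    subst this
    simp
  · obtain ⟨v, A, B, p, hAB, h0⟩ : ∃ v A B p, IsArrowPair v A B ∧
        w.letter ⟨0, hL⟩ = if p % 2 = 0 then .dir A else .inv B := by
      -- The parity of `p` records whether the walk starts with an arrow or with an inverse arrow.
      rcases h : w.letter ⟨0, hL⟩ with a | a <;> obtain ⟨b, hb⟩ := exists_isArrowPair a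
      · exact ⟨_, a, b, 0, hb, rfl⟩
      · exact ⟨_, b, a, 1, hb.symm, rfl⟩
    have key := w.letter_shape hAB (fun _ => h0)
    refine ⟨v, A, B, p, hAB, fun l => key l.1 l.2, fun i => ?_⟩
    rcases Nat.lt_or_ge i w.length with hi | hi
    · have h1 := w.source_eq ⟨i, hi⟩
      rw [key i hi] at h1
      have h2 : w.vert (Fin.castSucc ⟨i, hi⟩) = w.vert i := rfl
      rw [← h2, ← h1]
      split_ifs
      · exact hAB.src
      · exact (Arrow.tgt_eq _).trans (by rw [hAB.symm.src])
    · obtain ⟨n, hn⟩ : ∃ n, (i : ℕ) = n + 1 := ⟨i - 1, by omega⟩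
      have hi' := i.2
      have h1 := w.target_eq ⟨n, by omega⟩
      rw [key n (by omega)] at h1
      have h2 : w.vert (Fin.succ ⟨n, by omega⟩) = w.vert i := congrArg w.vert (Fin.ext hn.symm)
      rw [← h2, ← h1, hn]
      by_cases hp : (n + p) % 2 = 0
      · rw [if_pos hp, if_neg (by omega)]
        exact (Arrow.tgt_eq _).trans (by rw [hAB.src])
      · rw [if_neg hp, if_pos (by omega)]
        exact hAB.symm.src

variable {w : StringWord} {v : Vertex} {A B : Arrow} {p : ℕ}

theorem Shape.acts_left (h : w.Shape v A B p) (i j : Fin (w.length + 1)) :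
    w.Acts A i j ↔ ((i : ℕ) + p) % 2 = 0 ∧ (j : ℕ) = i + 1 := by
  constructor
  · rintro ⟨l, ⟨h1, rfl, rfl⟩ | ⟨h1, rfl, rfl⟩⟩
    · rw [h.letter] at h1
      split_ifs at h1 with h2
      exact ⟨h2, rfl⟩
    · rw [h.letter] at h1
      split_ifs at h1 with h2
      exact absurd (Letter.inv.inj h1).symm h.pair.ne
  · rintro ⟨h1, h2⟩
    have hj := j.2
    refine ⟨⟨i, by omega⟩, Or.inl ⟨?_, rfl, Fin.ext h2⟩⟩
    rw [h.letter, if_pos h1]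

theorem Shape.acts_right (h : w.Shape v A B p) (i j : Fin (w.length + 1)) :
    w.Acts B i j ↔ ((i : ℕ) + p) % 2 = 0 ∧ (i : ℕ) = j + 1 := by
  constructor
  · rintro ⟨l, ⟨h1, rfl, rfl⟩ | ⟨h1, rfl, rfl⟩⟩
    · rw [h.letter] at h1
      split_ifs at h1 with h2
      exact absurd (Letter.dir.inj h1) h.pair.ne
    · rw [h.letter] at h1
      split_ifs at h1 with h2
      refine ⟨?_, rfl⟩
      simp only [Fin.val_succ]
      omega
  · rintro ⟨h1, h2⟩
    have hi := i.2
    refine ⟨⟨j, by omega⟩, Or.inr ⟨?_, Fin.ext h2, rfl⟩⟩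
    rw [h.letter, if_neg (by simp only; omega)]

variable {k : Type u} [Field k]

theorem act_apply_of_unique {a : Arrow} {u u' : Vertex} (f : {i // w.vert i = u} → k)
    (i : {i // w.vert i = u}) (j : {i // w.vert i = u'}) (hij : w.Acts a i j)
    (hu : ∀ i' : {i // w.vert i = u}, w.Acts a i' j → i' = i) : w.act k a u u' f j = f i := by
  classical
  change ∑ i', (if w.Acts a i'.1 j.1 then (1 : k) else 0) * f i' = f i
  rw [Finset.sum_eq_single i, if_pos hij, one_mul]
  · intro i' _ hne
    rw [if_neg fun h => hne (hu i' h), zero_mul]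
  · simp

theorem act_apply_of_not {a : Arrow} {u u' : Vertex} (f : {i // w.vert i = u} → k)
    (j : {i // w.vert i = u'}) (hu : ∀ i' : {i // w.vert i = u}, ¬ w.Acts a i' j) :
    w.act k a u u' f j = 0 := by
  classical
  change ∑ i', (if w.Acts a i'.1 j.1 then (1 : k) else 0) * f i' = 0
  exact Finset.sum_eq_zero fun i' _ => by rw [if_neg (hu i'), zero_mul]

theorem Shape.vert_iff (h : w.Shape v A B p) (i : Fin (w.length + 1)) :
    w.vert i = v ↔ ((i : ℕ) + p) % 2 = 0 := by
  rw [h.vert]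
  split_ifs with h1
  · simp [h1]
  · simp [h1, v.succ_ne]

theorem Shape.vert_succ_iff (h : w.Shape v A B p) (i : Fin (w.length + 1)) :
    w.vert i = v.succ ↔ ((i : ℕ) + (p + 1)) % 2 = 0 := by
  rw [h.vert]
  split_ifs with h1
  · simp only [v.succ_ne.symm, false_iff]; omega
  · simp only [true_iff]; omega

theorem Shape.act_left (h : w.Shape v A B p) (f : {i // w.vert i = v} → k)
    (j : {i // w.vert i = v.succ}) : w.act k A v v.succ f j =
      shiftRight k w.length p (fun i => f ⟨i.1, (h.vert_iff _).2 i.2⟩)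
        ⟨j.1, (h.vert_succ_iff _).1 j.2⟩ := by
  have hj := (h.vert_succ_iff _).1 j.2
  rw [shiftRight_apply]
  split_ifs with h1
  · refine act_apply_of_unique f _ j ((h.acts_left _ _).2 ⟨?_, ?_⟩) fun i' hi' => ?_
    · simp only at h1 ⊢; omega
    · simp only at h1 ⊢; omega
    · have := ((h.acts_left _ _).1 hi').2
      exact Subtype.ext (Fin.ext (by simp only; omega))
  · refine act_apply_of_not f j fun i' hi' => ?_
    have := ((h.acts_left _ _).1 hi').2
    simp only at h1
    omega

theorem Shape.act_right (h : w.Shape v A B p) (f : {i // w.vert i = v} → k)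
    (j : {i // w.vert i = v.succ}) : w.act k B v v.succ f j =
      shiftLeft k w.length p (fun i => f ⟨i.1, (h.vert_iff _).2 i.2⟩)
        ⟨j.1, (h.vert_succ_iff _).1 j.2⟩ := by
  have hj := (h.vert_succ_iff _).1 j.2
  change _ = dite _ _ _
  split_ifs with h1
  · refine act_apply_of_unique f _ j ((h.acts_right _ _).2 ⟨?_, ?_⟩) fun i' hi' => ?_
    · simp only at h1 ⊢; omega
    · rfl
    · have := ((h.acts_right _ _).1 hi').2
      exact Subtype.ext (Fin.ext (by simp only; omega))
  · refine act_apply_of_not f j fun i' hi' => ?_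
    have := ((h.acts_right _ _).1 hi').2
    have := i'.1.2
    simp only at h1
    omega

theorem module_X (v : Vertex) : (w.module k).X v = w.act k v.arrX v v.succ := by
  cases v <;> rfl

theorem module_Y (v : Vertex) : (w.module k).Y v = w.act k v.arrY v v.succ := by
  cases v <;> rfl

end StringWord

end Words

/-! ### String modules as zigzag Kronecker modules -/

section StringModules

variable {k : Type u} [Field k]

/-- The zigzag Kronecker modules. -/
@[reducible] def zigzag (k : Type u) [Field k] (L p : ℕ) : Kron k :=
  ⟨Pos L p → k, Pos L (p + 1) → k, shiftRight k L p, shiftLeft k L p⟩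

/-- The Kronecker module with the two maps interchanged. -/
@[reducible] def Kron.swap {R : Type u} [CommRing R] (K : Kron R) : Kron R := ⟨K.V, K.W, K.y, K.x⟩

namespace StringWord

variable {w : StringWord} {v : Vertex} {A B : Arrow} {p : ℕ}

theorem Shape.subsingleton (h : w.Shape v A B p) (u : Vertex) (h1 : u ≠ v) (h2 : u ≠ v.succ) :
    Subsingleton ((w.module k).obj u) := by
  have : IsEmpty {i // w.vert i = u} := ⟨fun i => by
    have h3 := h.vert i.1
    rw [i.2] at h3
    split_ifs at h3
    · exact h1 h3
    · exact h2 h3⟩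
  exact inferInstanceAs (Subsingleton ({i // w.vert i = u} → k))

/-- String modules are zigzag Kronecker modules. -/
theorem Shape.exists_iso (h : w.Shape v A B p) :
    (A = v.arrX → Nonempty (Iso (w.module k) (place v (zigzag k w.length p)))) ∧
      (A = v.arrY → Nonempty (Iso (w.module k) (place v (zigzag k w.length p).swap))) := by
  let e₀ : ({i // w.vert i = v} → k) ≃ₗ[k] (Pos w.length p → k) :=
    LinearEquiv.funCongrLeft k k (Equiv.subtypeEquivRight fun i => (h.vert_iff i).symm)
  let e₁ : ({i // w.vert i = v.succ} → k) ≃ₗ[k] (Pos w.length (p + 1) → k) :=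
    LinearEquiv.funCongrLeft k k (Equiv.subtypeEquivRight fun i => (h.vert_succ_iff i).symm)
  have hA : ∀ f, e₁ (w.act k A v v.succ f) = shiftRight k w.length p (e₀ f) := fun f =>
    funext fun j => h.act_left f ⟨j.1, (h.vert_succ_iff _).2 j.2⟩
  have hB : ∀ f, e₁ (w.act k B v v.succ f) = shiftLeft k w.length p (e₀ f) := fun f =>
    funext fun j => h.act_right f ⟨j.1, (h.vert_succ_iff _).2 j.2⟩
  constructor
  · rintro rfl
    have hB' : v.arrY = B := h.pair.eq_right v.arrY_src v.arrX_ne_arrY.symm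
    subst hB'
    refine ⟨isoPlace _ v h.subsingleton e₀ e₁ (fun f => ?_) fun f => ?_⟩
    · rw [module_X]; exact hA f
    · rw [module_Y]; exact hB f
  · rintro rfl
    have hB' : v.arrX = B := h.pair.eq_right v.arrX_src v.arrX_ne_arrY
    subst hB'
    refine ⟨isoPlace _ v h.subsingleton e₀ e₁ (fun f => ?_) fun f => ?_⟩
    · rw [module_X]; exact hB f
    · rw [module_Y]; exact hA f

end StringWord

/-! ### Zigzags of even length -/

variable {v : Vertex} {V W : Type u} [AddCommGroup V] [Module k V] [AddCommGroup W] [Module k W]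
  {x y : V →ₗ[k] W}

/-- Scalar endomorphisms give indecomposability once the module is nonzero, which follows from the
dimensions being different. -/
theorem place_isUneven [Module.Finite k V] [Module.Finite k W]
    (hne : Module.finrank k V ≠ Module.finrank k W)
    (h : ∀ (F : V →ₗ[k] V) (G : W →ₗ[k] W), (∀ a, G (x a) = x (F a)) → (∀ a, G (y a) = y (F a)) →
      ∃ c : k, (∀ a, F a = c • a) ∧ ∀ b, G b = c • b) :
    (place v (⟨V, W, x, y⟩ : Kron k)).IsUneven := by
  let K : Kron k := ⟨V, W, x, y⟩
  have : Module.Finite k K.V := inferInstanceAs (Module.Finite k V)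
  have : Module.Finite k K.W := inferInstanceAs (Module.Finite k W)
  have h0 : (place v K).IsNonzero := by
    rcases subsingleton_or_nontrivial V with hV | hV
    · rcases subsingleton_or_nontrivial W with hW | hW
      · exact absurd (by rw [Module.finrank_zero_of_subsingleton (M := V),
          Module.finrank_zero_of_subsingleton (M := W)]) hne
      · exact Kron.isNonzero_of_snd
    · exact Kron.isNonzero_of_fst
  refine ⟨place_isStableVertex (K := K) (Rep.isIndecomposable_of_endo_scalar h0 fun f => ?_), v, K,
    ⟨Iso.refl _⟩, hne⟩
  obtain ⟨c, hc⟩ := h f.fst f.snd f.snd_x f.snd_y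
  exact ⟨c, Hom.app_eq_smul_iff.2 hc⟩

theorem zigzag_finrank_ne {L p : ℕ} (hL : L % 2 = 0) :
    Module.finrank k (Pos L p → k) ≠ Module.finrank k (Pos L (p + 1) → k) := by
  obtain ⟨n, rfl⟩ : ∃ n, L = 2 * n := ⟨L / 2, by omega⟩
  rw [Module.finrank_fintype_fun_eq_card, Module.finrank_fintype_fun_eq_card, card_pos, card_pos]
  split_ifs <;> omega

theorem zigzag_isUneven {L p : ℕ} (hL : L % 2 = 0) : (place v (zigzag k L p)).IsUneven :=
  place_isUneven (zigzag_finrank_ne hL) fun _ _ h h' => zigzag_scalar hL h h'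

theorem zigzag_swap_isUneven {L p : ℕ} (hL : L % 2 = 0) :
    (place v (zigzag k L p).swap).IsUneven :=
  place_isUneven (zigzag_finrank_ne hL) fun _ _ h h' => zigzag_scalar hL h' h

/-! ### Zigzags of odd length -/

/-- The maps `x⁻¹ y` on `V` and `y x⁻¹` on `W` form an endomorphism, which kills `a₀ ≠ 0` but not
`a₁`. -/
theorem place_endo_not_scalar (hx : Function.Bijective x) {a₀ a₁ : V} (h₀ : a₀ ≠ 0) (hy₀ : y a₀ = 0)
    (hy₁ : y a₁ ≠ 0) : ∃ f : Hom (place v (⟨V, W, x, y⟩ : Kron k)) (place v ⟨V, W, x, y⟩),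
      ¬ ∃ c : k, ∀ w n, f.app w n = c • n := by
  let e := LinearEquiv.ofBijective x hx
  have he : ∀ a, e a = x a := fun _ => rfl
  let f : Hom (place v (⟨V, W, x, y⟩ : Kron k)) (place v ⟨V, W, x, y⟩) :=
    placeHom (e.symm.toLinearMap ∘ₗ y) (y ∘ₗ e.symm.toLinearMap)
      (fun a => by
        change y (e.symm (e a)) = e (e.symm (y a))
        rw [e.symm_apply_apply, e.apply_symm_apply])
      fun a => rfl
  refine ⟨f, fun ⟨c, hc⟩ => hy₁ ?_⟩
  have h1 : ∀ a : V, e.symm (y a) = c • a := (Hom.app_eq_smul_iff.1 hc).1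
  have hc : c = 0 := by
    have h2 := h1 a₀
    rw [hy₀, map_zero] at h2
    exact (smul_eq_zero.1 h2.symm).resolve_right h₀
  have h2 := h1 a₁
  rw [hc, zero_smul] at h2
  exact e.symm.map_eq_zero_iff.1 h2

/-- Interchanging the two maps does not change the endomorphisms. -/
theorem place_swap_endo_not_scalar {K : Kron k} (h : ∃ f : Hom (place v K) (place v K),
      ¬ ∃ c : k, ∀ w n, f.app w n = c • n) :
    ∃ f : Hom (place v K.swap) (place v K.swap), ¬ ∃ c : k, ∀ w n, f.app w n = c • n := by
  obtain ⟨f, hf⟩ := h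
  refine ⟨placeHom f.fst f.snd f.snd_y f.snd_x, fun ⟨c, hc⟩ => hf ⟨c, ?_⟩⟩
  have h := Hom.app_eq_smul_iff.1 hc
  exact Hom.app_eq_smul_iff.2 ⟨h.1, h.2⟩

theorem Kron.Gen.swap {K : Kron k} (hK : K.Gen) : K.swap.Gen := fun b => by
  obtain ⟨a, a', h⟩ := hK b
  exact ⟨a', a, h.trans (add_comm _ _)⟩

theorem zigzag_gen {L p : ℕ} (hL : L % 2 = 1) : (zigzag k L p).Gen := fun b => by
  rcases Nat.mod_two_eq_zero_or_one p with hp | hp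
  · obtain ⟨a, ha⟩ := (shiftRight_bijective hL hp).2 b
    exact ⟨a, 0, by rw [map_zero, add_zero]; exact ha.symm⟩
  · obtain ⟨a, ha⟩ := (shiftLeft_bijective hL hp).2 b
    exact ⟨0, a, by rw [map_zero, zero_add]; exact ha.symm⟩

/-- The shift that is not invertible kills an end position of its source. Length at least three
provides a second position in the source, which it does not kill. -/
theorem zigzag_endo_not_scalar {L p : ℕ} (hL : L % 2 = 1) (h3 : 3 ≤ L) :
    ∃ f : Hom (place v (zigzag k L p)) (place v (zigzag k L p)),
      ¬ ∃ c : k, ∀ w n, f.app w n = c • n := by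
  rcases Nat.mod_two_eq_zero_or_one p with hp | hp
  · refine place_endo_not_scalar (shiftRight_bijective hL hp) (a₀ := delta k L p 0)
      (a₁ := delta k L p 2) (delta_ne_zero (by omega)) shiftLeft_delta_zero ?_
    rw [shiftLeft_delta_succ (by omega)]
    exact delta_ne_zero (by omega)
  · refine place_swap_endo_not_scalar (K := ⟨_, _, shiftLeft k L p, shiftRight k L p⟩)
      (place_endo_not_scalar (shiftLeft_bijective hL hp) (a₀ := delta k L p L)
      (a₁ := delta k L p 1) (delta_ne_zero (by omega)) ?_ ?_)
    · rw [shiftRight_delta]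
      exact delta_of_not (by omega)
    · rw [shiftRight_delta]
      exact delta_ne_zero (by omega)

/-! ### Arrow modules -/

/-- The Kronecker module of an arrow. -/
@[reducible] def arrowKron (R : Type u) [CommRing R] : Kron R := ⟨R, R, LinearMap.id, 0⟩

theorem place_iso_arrow (hV : Module.finrank k V = 1) (hx : Function.Bijective x)
    (hy : ∀ a, y a = 0) :
    Nonempty (Iso (place v (⟨V, W, x, y⟩ : Kron k)) (place v (arrowKron k))) ∧
      Nonempty (Iso (place v (⟨V, W, y, x⟩ : Kron k)) (place v (arrowKron k).swap)) := by
  have : Module.Finite k V := Module.finite_of_finrank_eq_succ hV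
  let e : V ≃ₗ[k] k := LinearEquiv.ofFinrankEq _ _ (by rw [hV, Module.finrank_self])
  let d : W ≃ₗ[k] k := (LinearEquiv.ofBijective x hx).symm.trans e
  have hd : ∀ a, d (x a) = e a := fun a =>
    congrArg e ((LinearEquiv.ofBijective x hx).symm_apply_apply a)
  have hd' : ∀ a, d (y a) = 0 := fun a => by rw [hy, map_zero]
  constructor
  · refine ⟨isoPlace _ v (fun w h h' => place.subsingleton h h') ((place.fst v _).trans e)
      ((place.snd v _).trans d) (fun p => ?_) fun p => ?_⟩
    · exact (congrArg d (place.snd_X p)).trans (hd _)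
    · exact (congrArg d (place.snd_Y p)).trans (hd' _)
  · refine ⟨isoPlace _ v (fun w h h' => place.subsingleton h h') ((place.fst v _).trans e)
      ((place.snd v _).trans d) (fun p => ?_) fun p => ?_⟩
    · exact (congrArg d (place.snd_X p)).trans (hd' _)
    · exact (congrArg d (place.snd_Y p)).trans (hd _)

theorem finrank_pos_one (p : ℕ) : Module.finrank k (Pos 1 p → k) = 1 := by
  rw [Module.finrank_fintype_fun_eq_card, Fintype.card_eq_one_iff]
  rcases Nat.mod_two_eq_zero_or_one p with hp | hp
  · refine ⟨⟨0, by simpa using hp⟩, fun i => Subtype.ext (Fin.ext ?_)⟩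
    have := i.2
    have := i.1.2
    simp only [Fin.val_zero]
    omega
  · refine ⟨⟨1, by simp only [Fin.val_one]; omega⟩, fun i => Subtype.ext (Fin.ext ?_)⟩
    have := i.2
    have := i.1.2
    simp only [Fin.val_one]
    omega

theorem shiftLeft_eq_zero {p : ℕ} (hp : p % 2 = 0) (f : Pos 1 p → k) : shiftLeft k 1 p f = 0 :=
  ext_ev fun m hm => by rw [ev_shiftLeft _ hm, ev_of_not _ (by omega), ev_zero]

theorem shiftRight_eq_zero {p : ℕ} (hp : p % 2 = 1) (f : Pos 1 p → k) : shiftRight k 1 p f = 0 :=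
  ext_ev fun m hm => by
    rcases m with _ | m
    · rw [ev_shiftRight_zero, ev_zero]
    · rw [ev_shiftRight_succ _ hm, ev_of_not _ (by omega), ev_zero]

theorem zigzag_one_iso (p : ℕ) :
    (p % 2 = 0 → Nonempty (Iso (place v (zigzag k 1 p)) (place v (arrowKron k))) ∧
      Nonempty (Iso (place v (zigzag k 1 p).swap) (place v (arrowKron k).swap))) ∧
    (p % 2 = 1 → Nonempty (Iso (place v (zigzag k 1 p)) (place v (arrowKron k).swap)) ∧
      Nonempty (Iso (place v (zigzag k 1 p).swap) (place v (arrowKron k)))) :=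
  ⟨fun hp => place_iso_arrow (finrank_pos_one p) (shiftRight_bijective rfl hp)
    (shiftLeft_eq_zero hp), fun hp => (place_iso_arrow (finrank_pos_one p)
    (shiftLeft_bijective rfl hp) (shiftRight_eq_zero hp)).symm⟩

theorem ofArrow_iso (v : Vertex) :
    Nonempty (Iso ((StringWord.ofArrow v.arrX).module k) (place v (arrowKron k))) ∧
      Nonempty (Iso ((StringWord.ofArrow v.arrY).module k) (place v (arrowKron k).swap)) := by
  have key : ∀ a : Arrow, ∃ B p, (StringWord.ofArrow a).Shape a.src a B p ∧ p % 2 = 0 := fun a => by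
    obtain ⟨v, A, B, p, h⟩ := (StringWord.ofArrow a).exists_shape
    have h1 : Letter.dir a = _ := h.letter (0 : Fin 1)
    split_ifs at h1 with h2
    obtain rfl := Letter.dir.inj h1
    obtain rfl := h.pair.src
    exact ⟨B, p, h, by simpa using h2⟩
  constructor
  · obtain ⟨B, p, h, hp⟩ := key v.arrX
    rw [v.arrX_src] at h
    obtain ⟨e⟩ := (h.exists_iso (k := k)).1 rfl
    obtain ⟨d⟩ := ((zigzag_one_iso (k := k) (v := v) p).1 hp).1
    exact ⟨e.trans d⟩
  · obtain ⟨B, p, h, hp⟩ := key v.arrY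
    rw [v.arrY_src] at h
    obtain ⟨e⟩ := (h.exists_iso (k := k)).2 rfl
    obtain ⟨d⟩ := ((zigzag_one_iso (k := k) (v := v) p).1 hp).2
    exact ⟨e.trans d⟩

theorem Rep.isArrowModule_iff {N : Rep k} : N.IsArrowModule ↔
    ∃ v, Nonempty (Iso N (place v (arrowKron k))) ∨ Nonempty (Iso N (place v (arrowKron k).swap)) := by
  constructor
  · rintro ⟨a, ⟨e⟩⟩
    obtain ⟨⟨e₁⟩, ⟨e₂⟩⟩ := ofArrow_iso (k := k) a.src
    rcases a.eq_or_eq rfl with h | h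
    · rw [← h] at e₁
      exact ⟨_, Or.inl ⟨e.trans e₁⟩⟩
    · rw [← h] at e₂
      exact ⟨_, Or.inr ⟨e.trans e₂⟩⟩
  · rintro ⟨v, ⟨⟨e⟩⟩ | ⟨⟨e⟩⟩⟩
    · obtain ⟨d⟩ := (ofArrow_iso (k := k) v).1
      exact ⟨_, ⟨e.trans d.symm⟩⟩
    · obtain ⟨d⟩ := (ofArrow_iso (k := k) v).2
      exact ⟨_, ⟨e.trans d.symm⟩⟩

/-- The trichotomy of string modules. -/
theorem Rep.IsStringModule.cases {N : Rep k} (hN : N.IsStringModule) :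
    N.IsUneven ∨ N.IsArrowModule ∨
      (N.StablyFaithful ∧ ∃ f : Hom N N, ¬ ∃ c : k, ∀ w n, f.app w n = c • n) := by
  obtain ⟨w, ⟨e⟩⟩ := hN
  obtain ⟨v, A, B, p, h⟩ := w.exists_shape
  have hK : Nonempty (Iso N (place v (zigzag k w.length p))) ∨
      Nonempty (Iso N (place v (zigzag k w.length p).swap)) := by
    rcases h.pair with ⟨hA, -⟩ | ⟨hA, -⟩
    · exact ((h.exists_iso (k := k)).1 hA).elim fun d => Or.inl ⟨e.trans d⟩
    · exact ((h.exists_iso (k := k)).2 hA).elim fun d => Or.inr ⟨e.trans d⟩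
  have transfer : ∀ {M : Rep k}, Iso N M → (∃ f : Hom M M, ¬ ∃ c : k, ∀ w n, f.app w n = c • n) →
      ∃ f : Hom N N, ¬ ∃ c : k, ∀ w n, f.app w n = c • n := fun d ⟨f, hf⟩ => by
    by_contra! hcon
    exact hf (endo_scalar_of_iso d hcon f)
  rcases Nat.mod_two_eq_zero_or_one w.length with hL | hL
  · left
    rcases hK with ⟨⟨d⟩⟩ | ⟨⟨d⟩⟩
    · exact (zigzag_isUneven hL).of_iso d.symm
    · exact (zigzag_swap_isUneven hL).of_iso d.symm
  · right
    rcases (show w.length = 1 ∨ 3 ≤ w.length by omega) with h1 | h3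
    · left
      rw [h1] at hK
      obtain ⟨i0, i1⟩ := zigzag_one_iso (k := k) (v := v) p
      refine Rep.isArrowModule_iff.2 ⟨v, ?_⟩
      rcases Nat.mod_two_eq_zero_or_one p with hp | hp
      · obtain ⟨⟨a⟩, ⟨b⟩⟩ := i0 hp
        exact hK.imp (fun ⟨d⟩ => ⟨d.trans a⟩) fun ⟨d⟩ => ⟨d.trans b⟩
      · obtain ⟨⟨a⟩, ⟨b⟩⟩ := i1 hp
        exact hK.symm.imp (fun ⟨d⟩ => ⟨d.trans b⟩) fun ⟨d⟩ => ⟨d.trans a⟩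
    · right
      rcases hK with ⟨⟨d⟩⟩ | ⟨⟨d⟩⟩
      · exact ⟨((zigzag_gen hL).stablyFaithful v).of_iso d.symm,
          transfer d (zigzag_endo_not_scalar hL h3)⟩
      · exact ⟨((zigzag_gen hL).swap.stablyFaithful v).of_iso d.symm,
          transfer d (place_swap_endo_not_scalar (zigzag_endo_not_scalar hL h3))⟩

end StringModules


section StableEnd

variable {k : Type u} [Field k] {N : Rep k}

/-! ### Stable endomorphism algebras -/

/-- The difference factors through a projective module and is therefore zero. -/
theorem Rep.StablyFaithful.eq_of_mk_eq (hN : N.StablyFaithful) {f g : endAlg N}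
    (h : (projIdeal N).ringCon.mk' f = (projIdeal N).ringCon.mk' g) : f = g := by
  have h1 : (projIdeal N).ringCon f g := (RingCon.eq _).1 h
  rw [TwoSidedIdeal.rel_iff] at h1
  obtain ⟨P, hP, hP', i, p, hip⟩ : FactorsThroughProjective (f - g) :=
    (TwoSidedIdeal.mem_mk' {f : endAlg N | FactorsThroughProjective f} _ _ _ _ _ (f - g)).1 h1
  have h2 : endAlg.toHom (f - g) = 0 := hip.trans (hN P hP hP' i p)
  refine sub_eq_zero.1 (Subtype.ext (funext fun v => LinearMap.ext fun n => ?_))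
  exact Hom.congr_apply h2 v n

/-- The stable endomorphism algebra is the ordinary one, and it is isomorphic to `k` exactly if its
structure map from `k` is bijective. -/
theorem Rep.StablyFaithful.stableEnd_equiv_iff (hN : N.StablyFaithful) (h0 : N.IsNonzero) :
    Nonempty (StableEnd N ≃ₐ[k] k) ↔ ∀ f : Hom N N, ∃ c : k, ∀ v n, f.app v n = c • n := by
  constructor
  · rintro ⟨e⟩ f
    let F : endAlg N := ⟨f.app, f.comm⟩
    refine ⟨e ((projIdeal N).ringCon.mk' F), fun v n => ?_⟩
    have h : (projIdeal N).ringCon.mk' F =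
        (projIdeal N).ringCon.mk' (algebraMap k _ (e ((projIdeal N).ringCon.mk' F))) :=
      e.injective (e.commutes (e ((projIdeal N).ringCon.mk' F))).symm
    exact congrArg (fun F : endAlg N => F.1 v n) (hN.eq_of_mk_eq h)
  · intro h
    refine ⟨(AlgEquiv.ofBijective (Algebra.ofId k (StableEnd N)) ⟨?_, ?_⟩).symm⟩
    · intro c d hcd
      have h1 : algebraMap k (endAlg N) c = algebraMap k (endAlg N) d := hN.eq_of_mk_eq hcd
      obtain ⟨v, hv⟩ := h0
      obtain ⟨n, hn⟩ := exists_ne (0 : N.obj v)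
      have h2 : c • n = d • n := congrArg (fun F : endAlg N => F.1 v n) h1
      rw [← sub_eq_zero, ← sub_smul, smul_eq_zero, sub_eq_zero] at h2
      exact h2.resolve_right hn
    · intro q
      obtain ⟨f, rfl⟩ := RingCon.mk'_surjective _ q
      obtain ⟨c, hc⟩ := h (endAlg.toHom f)
      refine ⟨c, congrArg (projIdeal N).ringCon.mk' (Subtype.ext (funext fun v =>
        LinearMap.ext fun n => ?_))⟩
      exact (hc v n).symm

theorem Rep.StablyFaithful.isNonzero_of_not_scalar
    (h : ∃ f : Hom N N, ¬ ∃ c : k, ∀ w n, f.app w n = c • n) : N.IsNonzero := by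
  by_contra hcon
  obtain ⟨f, hf⟩ := h
  refine hf ⟨0, fun v n => ?_⟩
  have : Subsingleton (N.obj v) := not_nontrivial_iff_subsingleton.1 fun h' => hcon ⟨v, h'⟩
  exact Subsingleton.elim _ _

theorem arrowKron_endo_scalar {v : Vertex} {K : Kron k} (hK : K = arrowKron k ∨ K = (arrowKron k).swap)
    (f : Hom (place v K) (place v K)) : ∃ c : k, ∀ w n, f.app w n = c • n := by
  have mul : ∀ (F : k →ₗ[k] k) (a : k), F a = F 1 • a := fun F a => by
    rw [smul_eq_mul, mul_comm, ← smul_eq_mul, ← map_smul, smul_eq_mul, mul_one]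
  rcases hK with rfl | rfl
  · have h : ∀ a : k, f.snd a = f.fst a := f.snd_x
    exact ⟨f.fst (1 : k), Hom.app_eq_smul_iff.2 ⟨fun a => mul f.fst a,
      fun a => (h a).trans (mul f.fst a)⟩⟩
  · have h : ∀ a : k, f.snd a = f.fst a := f.snd_y
    exact ⟨f.fst (1 : k), Hom.app_eq_smul_iff.2 ⟨fun a => mul f.fst a,
      fun a => (h a).trans (mul f.fst a)⟩⟩

theorem Rep.IsArrowModule.exists_iso (h : N.IsArrowModule) : ∃ (v : Vertex) (K : Kron k),
    (K = arrowKron k ∨ K = (arrowKron k).swap) ∧ Nonempty (Iso N (place v K)) := by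
  obtain ⟨v, h | h⟩ := Rep.isArrowModule_iff.1 h
  · exact ⟨v, _, Or.inl rfl, h⟩
  · exact ⟨v, _, Or.inr rfl, h⟩

theorem Rep.IsArrowModule.stableEnd (h : N.IsArrowModule) : Nonempty (StableEnd N ≃ₐ[k] k) := by
  obtain ⟨v, K, hK, ⟨e⟩⟩ := h.exists_iso
  have hg : (arrowKron k).Gen := fun b => ⟨b, 0, (add_zero b).symm⟩
  have hg' : K.Gen ∧ Nontrivial K.V := by
    rcases hK with rfl | rfl
    · exact ⟨hg, inferInstanceAs (Nontrivial k)⟩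
    · exact ⟨hg.swap, inferInstanceAs (Nontrivial k)⟩
  have := hg'.2
  exact (((hg'.1.stablyFaithful v).of_iso e.symm).stableEnd_equiv_iff
    (Kron.isNonzero_of_fst.of_iso e.symm)).2
    (endo_scalar_of_iso e.symm (arrowKron_endo_scalar hK))

/-- The string modules with trivial stable endomorphism algebra. -/
theorem Rep.IsStringModule.stableEnd_iff (hN : N.IsStringModule) :
    Nonempty (StableEnd N ≃ₐ[k] k) ↔ N.InSimpleComponent ∨ N.IsArrowModule := by
  rw [Rep.inSimpleComponent_iff]
  constructor
  · intro h
    rcases hN.cases with h1 | h1 | ⟨h1, h2⟩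
    · exact Or.inl h1
    · exact Or.inr h1
    · obtain ⟨f, hf⟩ := h2
      exact absurd ((h1.stableEnd_equiv_iff
        (Rep.StablyFaithful.isNonzero_of_not_scalar ⟨f, hf⟩)).1 h f) hf
  · rintro (h | h)
    · exact (h.1.stablyFaithful.stableEnd_equiv_iff h.1.2.1.1).2 h.endo_scalar
    · exact h.stableEnd

end StableEnd


section ExtendUnit

variable {R S : Type u} [CommRing R] [CommRing S]

/-! ### The universal property of extension of scalars -/

/-- The map `m ↦ 1 ⊗ m` from a representation to its extension of scalars. -/
noncomputable def Rep.unit (f : R →+* S) (M : Rep R) (v : Vertex) :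
    M.obj v →ₛₗ[f] (M.extend f).obj v :=
  letI := f.toAlgebra
  { toFun := fun m => ((1 : S) ⊗ₜ[R] m : S ⊗[R] M.obj v)
    map_add' := fun m n => TensorProduct.tmul_add _ _ _
    map_smul' := fun r m => by
      rw [← TensorProduct.smul_tmul]
      exact congrArg (· ⊗ₜ[R] m) (Algebra.smul_def r (1 : S)) }

theorem Rep.unit_X (f : R →+* S) (M : Rep R) (v : Vertex) (m : M.obj v) :
    (M.extend f).X v (M.unit f v m) = M.unit f v.succ (M.X v m) := by
  cases v <;> rfl

theorem Rep.unit_Y (f : R →+* S) (M : Rep R) (v : Vertex) (m : M.obj v) :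
    (M.extend f).Y v (M.unit f v m) = M.unit f v.succ (M.Y v m) := by
  cases v <;> rfl

theorem Rep.span_unit (f : R →+* S) (M : Rep R) (v : Vertex) :
    Submodule.span S (Set.range (M.unit f v)) = ⊤ := by
  let _ := f.toAlgebra
  refine Submodule.eq_top_iff'.2 fun (x : S ⊗[R] M.obj v) => ?_
  induction x with
  | zero => exact zero_mem _
  | add a b ha hb => exact add_mem ha hb
  | tmul s m =>
    have h : (s ⊗ₜ[R] m : S ⊗[R] M.obj v) = s • ((1 : S) ⊗ₜ[R] m) := by
      rw [TensorProduct.smul_tmul', smul_eq_mul, mul_one]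
    rw [h]
    exact Submodule.smul_mem _ _ (Submodule.subset_span ⟨m, rfl⟩)

theorem Rep.unit_surjective (f : R →+* S) (hf : Function.Surjective f) (M : Rep R) (v : Vertex) :
    Function.Surjective (M.unit f v) := fun x => by
  have hx : x ∈ Submodule.span S (Set.range (M.unit f v)) := by
    rw [Rep.span_unit]; trivial
  induction hx using Submodule.span_induction with
  | mem x hx => exact hx
  | zero => exact ⟨0, map_zero _⟩
  | add x y _ _ hx hy =>
    obtain ⟨m, rfl⟩ := hx
    obtain ⟨n, rfl⟩ := hy
    exact ⟨m + n, map_add _ _ _⟩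
  | smul c x _ hx =>
    obtain ⟨m, rfl⟩ := hx
    obtain ⟨r, rfl⟩ := hf c
    exact ⟨r • m, map_smulₛₗ _ _ _⟩

theorem Rep.extend_ext (f : R →+* S) {M : Rep R} {v : Vertex} {N : Type u} [AddCommGroup N]
    [Module S N] {g h : (M.extend f).obj v →ₗ[S] N}
    (hgh : ∀ m, g (M.unit f v m) = h (M.unit f v m)) : g = h :=
  LinearMap.ext_on_range (M.span_unit f v) hgh

/-- The linear map induced by a semilinear map. -/
noncomputable def extendLiftApp {f : R →+* S} {M : Rep R} {v : Vertex} {N : Type u} [AddCommGroup N]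
    [Module S N] (g : M.obj v →ₛₗ[f] N) : (M.extend f).obj v →ₗ[S] N :=
  letI := f.toAlgebra
  letI := Module.compHom N f
  haveI : IsScalarTower R S N := ⟨fun r s n => by
    rw [Algebra.smul_def, mul_smul]; rfl⟩
  LinearMap.liftBaseChange S
    ({ toFun := g, map_add' := map_add g, map_smul' := fun r m => map_smulₛₗ g r m } :
      M.obj v →ₗ[R] N)

theorem extendLiftApp_unit {f : R →+* S} {M : Rep R} {v : Vertex} {N : Type u} [AddCommGroup N]
    [Module S N] (g : M.obj v →ₛₗ[f] N) (m : M.obj v) : extendLiftApp g (M.unit f v m) = g m := by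
  let _ := f.toAlgebra
  let _ := Module.compHom N f
  have : IsScalarTower R S N := ⟨fun r s n => by
    rw [Algebra.smul_def, mul_smul]; rfl⟩
  exact (LinearMap.liftBaseChange_tmul ..).trans (one_smul S _)

/-- The homomorphism induced by a family of semilinear maps that commute with the arrows. -/
noncomputable def extendLift {f : R →+* S} {M : Rep R} {N : Rep S}
    (g : ∀ v, M.obj v →ₛₗ[f] N.obj v) (hX : ∀ v m, g _ (M.X v m) = N.X v (g v m))
    (hY : ∀ v m, g _ (M.Y v m) = N.Y v (g v m)) : Hom (M.extend f) N :=
  Hom.ofXY (fun v => extendLiftApp (g v))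
    (fun v => DFunLike.congr_fun (Rep.extend_ext f (M := M) (g := extendLiftApp (g v.succ) ∘ₗ
      (M.extend f).X v) (h := N.X v ∘ₗ extendLiftApp (g v)) fun m => by
        simp only [LinearMap.comp_apply]
        rw [M.unit_X, extendLiftApp_unit, extendLiftApp_unit, hX]))
    (fun v => DFunLike.congr_fun (Rep.extend_ext f (M := M) (g := extendLiftApp (g v.succ) ∘ₗ
      (M.extend f).Y v) (h := N.Y v ∘ₗ extendLiftApp (g v)) fun m => by
        simp only [LinearMap.comp_apply]
        rw [M.unit_Y, extendLiftApp_unit, extendLiftApp_unit, hY]))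

theorem Rep.extendComp_unit {T : Type u} [CommRing T] (f : R →+* S) (g : S →+* T) (h : R →+* T)
    (hgf : g.comp f = h) (M : Rep R) (v : Vertex) (m : M.obj v) :
    (M.extendComp f g h hgf).app v ((M.extend f).unit g v (M.unit f v m)) = M.unit h v m := by
  let _ := f.toAlgebra
  let _ := g.toAlgebra
  let _ := h.toAlgebra
  have : IsScalarTower R S T := IsScalarTower.of_algebraMap_eq' hgf.symm
  refine (TensorProduct.AlgebraTensorModule.cancelBaseChange_tmul ..).trans ?_
  rw [one_smul]; rfl

end ExtendUnit


section CHatBasics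

variable {k : Type u} [Field k]

/-! ### Complete local algebras -/

namespace CHat

variable {R A : CHat k}

theorem aug_algebraMap (c : k) : R.aug (algebraMap k R.carrier c) = c := R.aug.commutes c

theorem mem_maximalIdeal_iff {r : R.carrier} :
    r ∈ IsLocalRing.maximalIdeal R.carrier ↔ R.aug r = 0 := by
  have h : (RingHom.ker R.aug.toRingHom).IsMaximal :=
    RingHom.ker_isMaximal_of_surjective _ fun c => ⟨_, aug_algebraMap c⟩
  rw [← IsLocalRing.eq_maximalIdeal h]
  exact Iff.rfl

theorem sub_algebraMap_mem (r : R.carrier) :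
    r - algebraMap k R.carrier (R.aug r) ∈ IsLocalRing.maximalIdeal R.carrier := by
  rw [mem_maximalIdeal_iff, map_sub, aug_algebraMap, sub_self]

theorem Mor.aug_hom (θ : CHat.Mor R A) (r : R.carrier) : A.aug (θ.hom r) = R.aug r :=
  DFunLike.congr_fun θ.comp_aug r

theorem Mor.ext {θ θ' : CHat.Mor R A} (h : ∀ r, θ.hom r = θ'.hom r) : θ = θ' := by
  obtain ⟨f, hf⟩ := θ
  obtain ⟨g, hg⟩ := θ'
  obtain rfl : f = g := AlgHom.ext h
  rfl

/-- The composition of morphisms. -/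
def Mor.comp {B : CHat k} (η : CHat.Mor A B) (θ : CHat.Mor R A) : CHat.Mor R B where
  hom := η.hom.comp θ.hom
  comp_aug := AlgHom.ext fun r => (η.aug_hom _).trans (θ.aug_hom r)

/-- The identity morphism. -/
def Mor.id (R : CHat k) : CHat.Mor R R where
  hom := AlgHom.id k R.carrier
  comp_aug := rfl

end CHat

/-! ### The projection of a lift -/

namespace Lift

variable {V : Rep k} {R A B : CHat k}

/-- The projection from a lift of `V` to `V`. -/
noncomputable def π (L : Lift V R) (v : Vertex) : L.M.obj v →ₛₗ[R.aug.toRingHom] V.obj v :=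
  (L.φ.app v).toLinearMap.comp (L.M.unit R.aug.toRingHom v)

theorem π_apply (L : Lift V R) (v : Vertex) (m : L.M.obj v) :
    L.π v m = L.φ.app v (L.M.unit R.aug.toRingHom v m) := rfl

theorem π_smul (L : Lift V R) (v : Vertex) (r : R.carrier) (m : L.M.obj v) :
    L.π v (r • m) = R.aug r • L.π v m := map_smulₛₗ (L.π v) r m

theorem π_X (L : Lift V R) (v : Vertex) (m : L.M.obj v) :
    L.π v.succ (L.M.X v m) = V.X v (L.π v m) := by
  rw [π_apply, π_apply, ← L.φ.app_X, Rep.unit_X]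

theorem π_Y (L : Lift V R) (v : Vertex) (m : L.M.obj v) :
    L.π v.succ (L.M.Y v m) = V.Y v (L.π v m) := by
  rw [π_apply, π_apply, ← L.φ.app_Y, Rep.unit_Y]

theorem π_surjective (L : Lift V R) (v : Vertex) : Function.Surjective (L.π v) := by
  intro y
  obtain ⟨m, hm⟩ := L.M.unit_surjective _ (fun c => ⟨_, CHat.aug_algebraMap c⟩) v
    ((L.φ.app v).symm y)
  exact ⟨m, by rw [π_apply, hm, LinearEquiv.apply_symm_apply]⟩

/-- The quotient map modulo `𝔪` is semilinear along `R.aug`, so it factors through `k ⊗ L.M`. Thus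
`π` is the reduction modulo `𝔪`. -/
theorem π_eq_zero_iff (L : Lift V R) {v : Vertex} {m : L.M.obj v} : L.π v m = 0 ↔
    m ∈ IsLocalRing.maximalIdeal R.carrier • (⊤ : Submodule R.carrier (L.M.obj v)) := by
  constructor
  · intro h
    let P : Submodule R.carrier (L.M.obj v) := IsLocalRing.maximalIdeal R.carrier • ⊤
    let _ : Module k (L.M.obj v ⧸ P) := Module.compHom _ (algebraMap k R.carrier)
    let g : L.M.obj v →ₛₗ[R.aug.toRingHom] (L.M.obj v ⧸ P) :=
      { toFun := P.mkQ
        map_add' := map_add _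
        map_smul' := fun r m => by
          change P.mkQ (r • m) = P.mkQ (algebraMap k R.carrier (R.aug r) • m)
          rw [← sub_eq_zero, ← map_sub, ← sub_smul]
          exact (Submodule.Quotient.mk_eq_zero P).2
            (Submodule.smul_mem_smul (CHat.sub_algebraMap_mem r) trivial) }
    have h1 : L.M.unit R.aug.toRingHom v m = 0 := (L.φ.app v).map_eq_zero_iff.1 h
    have h2 := extendLiftApp_unit g m
    rw [h1, map_zero] at h2
    exact (Submodule.Quotient.mk_eq_zero P).1 h2.symm
  · intro h
    refine Submodule.smul_induction_on h (fun r hr n _ => ?_) fun m n hm hn => ?_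
    · rw [π_smul, CHat.mem_maximalIdeal_iff.1 hr, zero_smul]
    · rw [map_add, hm, hn, add_zero]

theorem finrank_eq (L : Lift V R) (v : Vertex) :
    Module.finrank R.carrier (L.M.obj v) = Module.finrank k (V.obj v) := by
  let _ := R.aug.toRingHom.toAlgebra
  have := L.free v
  rw [← (L.φ.app v).finrank_eq]
  exact (Module.finrank_baseChange (R := k) (S := R.carrier) (M' := L.M.obj v)).symm

/-- A set of elements that generates modulo the maximal ideal generates. -/
theorem eq_top_of_π (L : Lift V R) {v : Vertex} (N : Submodule R.carrier (L.M.obj v))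
    (h : ∀ y : V.obj v, ∃ n ∈ N, L.π v n = y) : N = ⊤ := by
  have := L.finite.1 v
  refine top_le_iff.1 (Submodule.le_of_le_smul_of_le_jacobson_bot (Module.Finite.fg_top)
    (IsLocalRing.maximalIdeal_le_jacobson _) fun m _ => ?_)
  obtain ⟨n, hn, hnm⟩ := h (L.π v m)
  refine Submodule.mem_sup.2 ⟨n, hn, m - n, L.π_eq_zero_iff.1 ?_, add_sub_cancel _ _⟩
  rw [map_sub, hnm, sub_self]

/-- Nakayama's lemma gives surjectivity. Both sides are free of the same finite rank, so a
surjection between them is injective. -/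
theorem bijective_of_π (L L' : Lift V R) {v : Vertex} (f : L.M.obj v →ₗ[R.carrier] L'.M.obj v)
    (hf : ∀ m, L'.π v (f m) = L.π v m) : Function.Bijective f := by
  have hsurj : Function.Surjective f := LinearMap.range_eq_top.1 <|
    L'.eq_top_of_π _ fun y => by
      obtain ⟨m, rfl⟩ := L.π_surjective v y
      exact ⟨f m, ⟨m, rfl⟩, hf m⟩
  refine ⟨?_, hsurj⟩
  have := L.finite.1 v
  have := L'.finite.1 v
  have := L.free v
  have := L'.free v
  let e : L'.M.obj v ≃ₗ[R.carrier] L.M.obj v :=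
    LinearEquiv.ofFinrankEq _ _ ((L'.finrank_eq v).trans (L.finrank_eq v).symm)
  have h := OrzechProperty.injective_of_surjective_endomorphism (e.toLinearMap ∘ₗ f)
    (e.surjective.comp hsurj)
  exact fun a b hab => h (congrArg e hab)

/-- Isomorphy of lifts is thereby expressed through the projections `π`, without tensor products. -/
theorem isIsomorphic_of_hom {L L' : Lift V R} (f : Hom L.M L'.M)
    (hf : ∀ v m, L'.π v (f.app v m) = L.π v m) : L.IsIsomorphic L' := by
  refine ⟨f.toIso fun v => bijective_of_π L L' (f.app v) (hf v), Iso.ext (funext fun v =>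
    LinearEquiv.toLinearMap_injective (Rep.extend_ext _ fun m => ?_))⟩
  exact hf v m

theorem IsIsomorphic.exists_hom {L L' : Lift V R} (h : L.IsIsomorphic L') :
    ∃ f : Hom L.M L'.M, ∀ v m, L'.π v (f.app v m) = L.π v m := by
  obtain ⟨e, he⟩ := h
  refine ⟨e.hom, fun v m => ?_⟩
  rw [π_apply, π_apply, ← he]
  rfl

/-! ### Homomorphisms of lifts over a morphism of the base rings -/

/-- A homomorphism of lifts over a morphism of the base rings. -/
structure Over (θ : CHat.Mor R A) (L : Lift V R) (L' : Lift V A) : Type u where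
  app : ∀ v, L.M.obj v →ₛₗ[θ.hom.toRingHom] L'.M.obj v
  app_X : ∀ v m, app _ (L.M.X v m) = L'.M.X v (app v m)
  app_Y : ∀ v m, app _ (L.M.Y v m) = L'.M.Y v (app v m)
  app_π : ∀ v m, L'.π v (app v m) = L.π v m

/-- The canonical homomorphism to the extension of scalars of a lift. -/
noncomputable def overPush (θ : CHat.Mor R A) (L : Lift V R) : Over θ L (L.push θ) where
  app v := L.M.unit θ.hom.toRingHom v
  app_X v m := (L.M.unit_X _ v m).symm
  app_Y v m := (L.M.unit_Y _ v m).symm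
  app_π v m := congrArg (L.φ.app v) (L.M.extendComp_unit _ _ _ _ v m)

/-- The composition of homomorphisms of lifts over morphisms of the base rings. -/
noncomputable def Over.comp {θ : CHat.Mor R A} {η : CHat.Mor A B} {L : Lift V R} {L' : Lift V A}
    {L'' : Lift V B} (g : Over η L' L'') (f : Over θ L L') : Over (η.comp θ) L L'' where
  app v :=
    { toFun := fun m => g.app v (f.app v m)
      map_add' := fun m n => by rw [map_add, map_add]
      map_smul' := fun r m => by rw [map_smulₛₗ, map_smulₛₗ]; rfl }
  app_X v m := by
    change g.app _ (f.app _ _) = L''.M.X v (g.app v (f.app v m))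
    rw [f.app_X, g.app_X]
  app_Y v m := by
    change g.app _ (f.app _ _) = L''.M.Y v (g.app v (f.app v m))
    rw [f.app_Y, g.app_Y]
  app_π v m := (g.app_π v _).trans (f.app_π v m)

/-- The adjunction between extension and restriction of scalars: linear maps out of `L.push θ` are
semilinear maps out of `L`. -/
theorem push_isIsomorphic_iff {θ : CHat.Mor R A} {L : Lift V R} {L' : Lift V A} :
    (L.push θ).IsIsomorphic L' ↔ Nonempty (Over θ L L') := by
  constructor
  · intro h
    obtain ⟨f, hf⟩ := h.exists_hom
    exact ⟨{
      app := fun v => (f.app v).comp ((overPush θ L).app v)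
      app_X := fun v m => (congrArg _ ((overPush θ L).app_X v m)).trans (f.app_X v _)
      app_Y := fun v m => (congrArg _ ((overPush θ L).app_Y v m)).trans (f.app_Y v _)
      app_π := fun v m => (hf v _).trans ((overPush θ L).app_π v m) }⟩
  · rintro ⟨g⟩
    refine isIsomorphic_of_hom (extendLift g.app g.app_X g.app_Y) fun v => ?_
    have key : (L'.π v).comp (extendLiftApp (g.app v)) = (L.push θ).π v := by
      refine LinearMap.ext_on_range (L.M.span_unit θ.hom.toRingHom v) fun m => ?_
      refine (congrArg (L'.π v) (extendLiftApp_unit (g.app v) m)).trans ?_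
      exact (g.app_π v m).trans ((overPush θ L).app_π v m).symm
    exact DFunLike.congr_fun key

theorem classify_eq_mk_iff {U : Lift V R} {θ : CHat.Mor R A} {L : Lift V A} :
    U.classify A θ = Quotient.mk _ L ↔ Nonempty (Over θ U L) :=
  Quotient.eq.trans push_isIsomorphic_iff

end Lift

end CHatBasics


section Universal

variable {k : Type u} [Field k] {V : Rep k} {R A : CHat k}

/-! ### Universal and versal deformation rings -/

/-- Universal lifts. -/
def Lift.IsUniversal (U : Lift V R) : Prop := ∀ A : CHat k, Function.Bijective (U.classify A)

theorem Lift.IsUniversal.isVersal {U : Lift V R} (h : U.IsUniversal) :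
    IsVersalDeformationRing V R :=
  ⟨U, fun A => (h A).2, h _⟩

theorem Lift.over_unique {U : Lift V R} (h : Function.Injective (U.classify A)) {L : Lift V A}
    {θ θ' : CHat.Mor R A} (g : Lift.Over θ U L) (g' : Lift.Over θ' U L) : θ = θ' :=
  h ((Lift.classify_eq_mk_iff.2 ⟨g⟩).trans (Lift.classify_eq_mk_iff.2 ⟨g'⟩).symm)

theorem Lift.exists_over {U : Lift V R} (h : Function.Surjective (U.classify A)) (L : Lift V A) :
    ∃ θ : CHat.Mor R A, Nonempty (Lift.Over θ U L) := by
  obtain ⟨θ, hθ⟩ := h (Quotient.mk _ L)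
  exact ⟨θ, Lift.classify_eq_mk_iff.1 hθ⟩

/-- The identity of a lift. -/
def Lift.overId (L : Lift V R) : Lift.Over (CHat.Mor.id R) L L where
  app v := (LinearMap.id : L.M.obj v →ₗ[R.carrier] L.M.obj v)
  app_X _ _ := rfl
  app_Y _ _ := rfl
  app_π _ _ := rfl

/-- The derivation given by a linear form. -/
noncomputable def CHat.derivation (R : CHat k) (ℓ : R.carrier →ₗ[k] k) : R.carrier →ₗ[k] k :=
  ℓ ∘ₗ (LinearMap.id - Algebra.linearMap k R.carrier ∘ₗ R.aug.toLinearMap)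

theorem CHat.derivation_apply (ℓ : R.carrier →ₗ[k] k) (r : R.carrier) :
    R.derivation ℓ r = ℓ (r - algebraMap k R.carrier (R.aug r)) := rfl

/-- Write `r` and `s` as scalars plus elements of `𝔪`; the product of the two `𝔪`-parts lies in
`𝔪²`, where `ℓ` vanishes. -/
theorem CHat.derivation_mul (ℓ : R.carrier →ₗ[k] k)
    (hℓ : ∀ r ∈ IsLocalRing.maximalIdeal R.carrier ^ 2, ℓ r = 0) (r s : R.carrier) :
    R.derivation ℓ (r * s) = R.aug r * R.derivation ℓ s + R.aug s * R.derivation ℓ r := by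
  have h : r * s - algebraMap k R.carrier (R.aug (r * s)) =
      R.aug r • (s - algebraMap k R.carrier (R.aug s)) +
      R.aug s • (r - algebraMap k R.carrier (R.aug r)) +
      (r - algebraMap k R.carrier (R.aug r)) * (s - algebraMap k R.carrier (R.aug s)) := by
    rw [Algebra.smul_def, Algebra.smul_def, map_mul, map_mul]
    ring
  have h' : (r - algebraMap k R.carrier (R.aug r)) * (s - algebraMap k R.carrier (R.aug s)) ∈
      IsLocalRing.maximalIdeal R.carrier ^ 2 := by
    rw [pow_two]
    exact Ideal.mul_mem_mul (CHat.sub_algebraMap_mem r) (CHat.sub_algebraMap_mem s)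
  rw [CHat.derivation_apply, h, map_add, map_add, hℓ _ h', add_zero, map_smul, map_smul]
  rfl

/-- The morphism to the dual numbers given by a linear form that vanishes on the square of the
maximal ideal. -/
noncomputable def CHat.toDual (R : CHat k) (ℓ : R.carrier →ₗ[k] k)
    (hℓ : ∀ r ∈ IsLocalRing.maximalIdeal R.carrier ^ 2, ℓ r = 0) : CHat.Mor R (CHat.dual k) where
  hom :=
    let f : R.carrier →ₗ[k] DualNumber k :=
      (TrivSqZeroExt.inlAlgHom k k k).toLinearMap ∘ₗ R.aug.toLinearMap +
        TrivSqZeroExt.inrHom k k ∘ₗ R.derivation ℓ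
    (AlgHom.ofLinearMap f (by
      apply TrivSqZeroExt.ext
      · simp [f]
      · simp [f, CHat.derivation_apply]) (fun r s => by
      apply TrivSqZeroExt.ext
      · simp [f]
      · simp [f, CHat.derivation_mul ℓ hℓ]
        ring) : R.carrier →ₐ[k] DualNumber k)
  comp_aug := AlgHom.ext fun r => by
    change TrivSqZeroExt.fst (TrivSqZeroExt.inl (R.aug r) + TrivSqZeroExt.inr (R.derivation ℓ r)
      : DualNumber k) = R.aug r
    simp

theorem CHat.toDual_snd (R : CHat k) (ℓ : R.carrier →ₗ[k] k)
    (hℓ : ∀ r ∈ IsLocalRing.maximalIdeal R.carrier ^ 2, ℓ r = 0) {r : R.carrier}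
    (hr : r ∈ IsLocalRing.maximalIdeal R.carrier) :
    TrivSqZeroExt.snd (show DualNumber k from (R.toDual ℓ hℓ).hom r) = ℓ r := by
  change TrivSqZeroExt.snd (TrivSqZeroExt.inl (R.aug r) + TrivSqZeroExt.inr (R.derivation ℓ r)
      : DualNumber k) = ℓ r
  rw [CHat.derivation_apply, CHat.mem_maximalIdeal_iff.1 hr]
  simp

/-- Elements of the cotangent space are separated by morphisms to the dual numbers. -/
theorem CHat.mem_sq_of_toDual {r : R.carrier}
    (h : ∀ ℓ : R.carrier →ₗ[k] k, (∀ s ∈ IsLocalRing.maximalIdeal R.carrier ^ 2, ℓ s = 0) →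
      ℓ r = 0) : r ∈ IsLocalRing.maximalIdeal R.carrier ^ 2 := by
  by_contra hcon
  obtain ⟨ℓ, hℓ, hℓ'⟩ := Submodule.exists_le_ker_of_notMem
    (p := (IsLocalRing.maximalIdeal R.carrier ^ 2).restrictScalars k) hcon
  exact hℓ (h ℓ fun _ hr => hℓ' hr)

/-- A versal deformation ring is a retraction of a universal one, with the same tangent
space. -/
theorem Lift.IsUniversal.exists_of_isVersal {U : Lift V R} (hU : U.IsUniversal) {R' : CHat k}
    (hR' : IsVersalDeformationRing V R') : ∃ (θ : CHat.Mor R R') (η : CHat.Mor R' R),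
      (∀ r, η.hom (θ.hom r) = r) ∧ IsLocalRing.maximalIdeal R'.carrier =
        (IsLocalRing.maximalIdeal R.carrier).map θ.hom := by
  obtain ⟨U', hs, hb⟩ := hR'
  obtain ⟨θ, ⟨g⟩⟩ := Lift.exists_over (hU R').2 U'
  obtain ⟨η, ⟨h⟩⟩ := Lift.exists_over (hs R) U
  -- Both sides classify `U` itself.
  have h1 : η.comp θ = CHat.Mor.id R := Lift.over_unique (hU R).1 (h.comp g) U.overId
  -- Morphisms to the dual numbers do not distinguish `r` from `θ (η r)`, so these agree modulo the
  -- square of the maximal ideal of `R'`. Nakayama's lemma then shows that this ideal is generated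
  -- by the image of `θ`.
  have h2 : ∀ τ : CHat.Mor R' (CHat.dual k), τ.comp (θ.comp η) = τ := fun τ =>
    Lift.over_unique hb.1 ((Lift.overPush τ U').comp (g.comp h)) (Lift.overPush τ U')
  refine ⟨θ, η, fun r => congrArg (fun θ : CHat.Mor R R => θ.hom r) h1, le_antisymm ?_ ?_⟩
  · refine Submodule.le_of_le_smul_of_le_jacobson_bot (IsNoetherian.noetherian _)
      (IsLocalRing.maximalIdeal_le_jacobson _) fun r hr => ?_
    have hη : η.hom r ∈ IsLocalRing.maximalIdeal R.carrier := by
      rw [CHat.mem_maximalIdeal_iff, η.aug_hom]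
      exact CHat.mem_maximalIdeal_iff.1 hr
    have hθ : θ.hom (η.hom r) ∈ IsLocalRing.maximalIdeal R'.carrier := by
      rw [CHat.mem_maximalIdeal_iff, θ.aug_hom]
      exact CHat.mem_maximalIdeal_iff.1 hη
    refine Submodule.mem_sup.2 ⟨_, Ideal.mem_map_of_mem θ.hom hη, r - θ.hom (η.hom r), ?_,
      add_sub_cancel _ _⟩
    rw [smul_eq_mul, ← pow_two]
    refine CHat.mem_sq_of_toDual fun ℓ hℓ => ?_
    rw [← CHat.toDual_snd R' ℓ hℓ (sub_mem hr hθ), map_sub, sub_eq_zero.2]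
    · rfl
    · exact congrArg (fun τ : CHat.Mor R' (CHat.dual k) => τ.hom r) (h2 (R'.toDual ℓ hℓ)).symm
  · refine Ideal.map_le_iff_le_comap.2 fun r hr => ?_
    rw [Ideal.mem_comap, CHat.mem_maximalIdeal_iff]
    exact (θ.aug_hom r).trans (CHat.mem_maximalIdeal_iff.1 hr)

end Universal


section Rigid

variable {k : Type u} [Field k]

/-! ### Linear maps between lifts -/

/-- The linear map that measures the failure of a pair of linear maps to be a homomorphism of
Kronecker modules. -/
def Kron.defect {R : Type u} [CommRing R] (K L : Kron R) :
    (K.V →ₗ[R] L.V) × (K.W →ₗ[R] L.W) →ₗ[R] (K.V →ₗ[R] L.W) × (K.V →ₗ[R] L.W) where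
  toFun p := (L.x ∘ₗ p.1 - p.2 ∘ₗ K.x, L.y ∘ₗ p.1 - p.2 ∘ₗ K.y)
  map_add' p q := by
    ext a <;> simp <;> abel
  map_smul' c p := by
    ext a <;> simp [smul_sub]

/-- A Kronecker module whose dimensions differ by one and whose endomorphisms are scalars has no
self-extensions. -/
theorem Kron.defect_surjective {K : Kron k} [Module.Finite k K.V] [Module.Finite k K.W]
    (hK : Module.finrank k K.V = Module.finrank k K.W + 1 ∨
      Module.finrank k K.W = Module.finrank k K.V + 1)
    (h : ∀ p, K.defect K p = 0 → ∃ c : k, p = (c • LinearMap.id, c • LinearMap.id)) :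
    Function.Surjective (K.defect K) := by
  have h1 : Module.finrank k (LinearMap.ker (K.defect K)) ≤ 1 := by
    have h2 : LinearMap.ker (K.defect K) ≤ Submodule.span k {(LinearMap.id, LinearMap.id)} :=
      fun p hp => by
        obtain ⟨c, rfl⟩ := h p hp
        exact Submodule.mem_span_singleton.2 ⟨c, rfl⟩
    exact (Submodule.finrank_mono h2).trans ((finrank_span_le_card _).trans (by simp))
  have h3 := (K.defect K).finrank_range_add_finrank_ker
  rw [← LinearMap.range_eq_top]
  refine Submodule.eq_top_of_finrank_eq (le_antisymm (Submodule.finrank_le _) ?_)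
  simp only [Module.finrank_prod, Module.finrank_linearMap] at h3 ⊢
  -- With dimensions `a` and `b`, source and target have dimensions `a² + b²` and `2ab`. They differ
  -- by `(a - b)² = 1`, which the kernel uses up.
  rcases hK with hK | hK <;> rw [hK] at h3 ⊢ <;> nlinarith

namespace Lift

variable {V : Rep k} {R : CHat k} {v w : Vertex} (L L' : Lift V R)

theorem exists_linear (f : V.obj v →ₗ[k] V.obj w) :
    ∃ F : L.M.obj v →ₗ[R.carrier] L'.M.obj w, ∀ m, L'.π w (F m) = f (L.π v m) := by
  have := L.free v
  let b := Module.Free.chooseBasis R.carrier (L.M.obj v)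
  choose s hs using fun i => L'.π_surjective w (f (L.π v (b i)))
  refine ⟨b.constr R.carrier s, DFunLike.congr_fun (b.ext
    (f₁ := (L'.π w).comp (b.constr R.carrier s)) (f₂ := f.comp (L.π v)) fun i => ?_)⟩
  simp only [LinearMap.comp_apply, b.constr_basis, hs]

theorem exists_reduction (F : L.M.obj v →ₗ[R.carrier] L'.M.obj w) :
    ∃ f : V.obj v →ₗ[k] V.obj w, ∀ m, L'.π w (F m) = f (L.π v m) := by
  refine ⟨extendLiftApp ((L'.π w).comp F) ∘ₗ (L.φ.app v).symm.toLinearMap, fun m => ?_⟩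
  rw [π_apply L]
  simp only [LinearMap.comp_apply, LinearEquiv.coe_coe, LinearEquiv.symm_apply_apply]
  rw [extendLiftApp_unit]
  rfl

/-- The maximal ideal of the base ring. -/
local notation "𝔪" => IsLocalRing.maximalIdeal

/-- In a basis `b` of the free source, `F` is the sum of the maps `m ↦ bᵢ*(m) F(bᵢ)`, so `F` has
coefficients in `𝔪` as soon as its values do. -/
theorem mem_smul_top_iff {F : L.M.obj v →ₗ[R.carrier] L'.M.obj w} :
    F ∈ 𝔪 R.carrier • (⊤ : Submodule R.carrier (L.M.obj v →ₗ[R.carrier] L'.M.obj w)) ↔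
      ∀ m, L'.π w (F m) = 0 := by
  constructor
  · intro h m
    refine L'.π_eq_zero_iff.2 ?_
    exact Submodule.smul_top_le_comap_smul_top _ (LinearMap.applyₗ (R := R.carrier) m) h
  · intro h
    have := L.free v
    have := L.finite.1 v
    let b := Module.Free.chooseBasis R.carrier (L.M.obj v)
    have hF : F = ∑ i, LinearMap.smulRightₗ (R := R.carrier) (b.coord i) (F (b i)) :=
      b.ext fun j => by
        simp [LinearMap.sum_apply, Finsupp.single_apply]
    rw [hF]
    refine sum_mem fun i _ => ?_
    exact Submodule.smul_top_le_comap_smul_top _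
      (LinearMap.smulRightₗ (R := R.carrier) (b.coord i)) (L'.π_eq_zero_iff.1 (h (b i)))

/-- Lifts of a module that is concentrated at a vertex and its successor. -/
theorem isIsomorphic_of_kron {L L' : Lift V R}
    (hV : ∀ w, w ≠ v → w ≠ v.succ → Subsingleton (V.obj w))
    (F : L.M.obj v →ₗ[R.carrier] L'.M.obj v) (G : L.M.obj v.succ →ₗ[R.carrier] L'.M.obj v.succ)
    (hX : ∀ m, G (L.M.X v m) = L'.M.X v (F m)) (hY : ∀ m, G (L.M.Y v m) = L'.M.Y v (F m))
    (hF : ∀ m, L'.π v (F m) = L.π v m) (hG : ∀ m, L'.π v.succ (G m) = L.π v.succ m) :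
    L.IsIsomorphic L' := by
  -- By Nakayama's lemma a lift vanishes wherever `V` does.
  have hL : ∀ (L : Lift V R) (w), w ≠ v → w ≠ v.succ → Subsingleton (L.M.obj w) :=
    fun L w h h' => by
      have := hV w h h'
      refine (Submodule.subsingleton_iff R.carrier).1 (subsingleton_of_bot_eq_top ?_)
      exact L.eq_top_of_π _ fun y => ⟨0, zero_mem _, Subsingleton.elim _ _⟩
  let i (L : Lift V R) : Iso L.M (place v (L.M.kron v)) :=
    isoPlace L.M v (hL L) (LinearEquiv.refl _ _) (LinearEquiv.refl _ _) (fun _ => rfl) fun _ => rfl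
  let f : Hom (place v (L.M.kron v)) (place v (L'.M.kron v)) := placeHom F G hX hY
  have h0 : ∀ m, ((i L').symm.hom.comp (f.comp (i L).hom)).app v m = F m := fun m =>
    ((i L').app v).symm_apply_eq.2 ((place.fst v (L'.M.kron v)).injective rfl)
  have h1 : ∀ m, ((i L').symm.hom.comp (f.comp (i L).hom)).app v.succ m = G m := fun m =>
    ((i L').app v.succ).symm_apply_eq.2 ((place.snd v (L'.M.kron v)).injective rfl)
  refine isIsomorphic_of_hom ((i L').symm.hom.comp (f.comp (i L).hom)) fun w m => ?_
  by_cases h : w = v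
  · subst h
    rw [h0, hF]
  · by_cases h' : w = v.succ
    · subst h'
      rw [h1, hG]
    · exact (hV w h h').elim _ _

/-- All lifts of a module without self-extensions are isomorphic. -/
theorem isIsomorphic_of_rigid (hV : ∀ w, w ≠ v → w ≠ v.succ → Subsingleton (V.obj w))
    (hr : Function.Surjective ((V.kron v).defect (V.kron v))) : L.IsIsomorphic L' := by
  have := L.free v
  have := L.free v.succ
  have := L'.free v
  have := L'.free v.succ
  have := L.finite.1 v
  have := L.finite.1 v.succ
  have := L'.finite.1 v
  have := L'.finite.1 v.succ
  let δ : (L.M.obj v →ₗ[R.carrier] L'.M.obj v) × (L.M.obj v.succ →ₗ[R.carrier] L'.M.obj v.succ)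
      →ₗ[R.carrier] (L.M.obj v →ₗ[R.carrier] L'.M.obj v.succ) ×
        (L.M.obj v →ₗ[R.carrier] L'.M.obj v.succ) := (L.M.kron v).defect (L'.M.kron v)
  have hmem : ∀ D : (L.M.obj v →ₗ[R.carrier] L'.M.obj v.succ) ×
      (L.M.obj v →ₗ[R.carrier] L'.M.obj v.succ),
      (∀ m, L'.π v.succ (D.1 m) = 0) → (∀ m, L'.π v.succ (D.2 m) = 0) →
      D ∈ 𝔪 R.carrier • (⊤ : Submodule R.carrier ((L.M.obj v →ₗ[R.carrier] L'.M.obj v.succ) ×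
        (L.M.obj v →ₗ[R.carrier] L'.M.obj v.succ))) := fun D h1 h2 => by
    have e1 := Submodule.smul_top_le_comap_smul_top (𝔪 R.carrier) (LinearMap.inl R.carrier
      (L.M.obj v →ₗ[R.carrier] L'.M.obj v.succ) (L.M.obj v →ₗ[R.carrier] L'.M.obj v.succ))
      ((L.mem_smul_top_iff L').2 h1)
    have e2 := Submodule.smul_top_le_comap_smul_top (𝔪 R.carrier) (LinearMap.inr R.carrier
      (L.M.obj v →ₗ[R.carrier] L'.M.obj v.succ) (L.M.obj v →ₗ[R.carrier] L'.M.obj v.succ))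
      ((L.mem_smul_top_iff L').2 h2)
    simpa using add_mem (Submodule.mem_comap.1 e1) (Submodule.mem_comap.1 e2)
  -- Modulo `𝔪` the map `δ` is the defect map of `V`, which is surjective; Nakayama's lemma does the
  -- rest.
  have hδ : LinearMap.range δ = ⊤ := by
    refine top_le_iff.1 (Submodule.le_of_le_smul_of_le_jacobson_bot Module.Finite.fg_top
      (IsLocalRing.maximalIdeal_le_jacobson _) fun D _ => ?_)
    obtain ⟨d₁, h₁⟩ := L.exists_reduction L' D.1
    obtain ⟨d₂, h₂⟩ := L.exists_reduction L' D.2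
    obtain ⟨⟨f, g⟩, hfg⟩ := hr (d₁, d₂)
    obtain ⟨F, hF⟩ := L.exists_linear L' f
    obtain ⟨G, hG⟩ := L.exists_linear L' g
    refine Submodule.mem_sup.2 ⟨δ (F, G), ⟨_, rfl⟩, D - δ (F, G), hmem _ (fun m => ?_)
      (fun m => ?_), add_sub_cancel _ _⟩
    · change L'.π _ (D.1 m - (L'.M.X v (F m) - G (L.M.X v m))) = 0
      have e := LinearMap.congr_fun (congrArg Prod.fst hfg) (L.π v m)
      change V.X v (f _) - g (V.X v _) = d₁ _ at e
      rw [map_sub, map_sub, h₁, L'.π_X, hF, hG, L.π_X, e, sub_self]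
    · change L'.π _ (D.2 m - (L'.M.Y v (F m) - G (L.M.Y v m))) = 0
      have e := LinearMap.congr_fun (congrArg Prod.snd hfg) (L.π v m)
      change V.Y v (f _) - g (V.Y v _) = d₂ _ at e
      rw [map_sub, map_sub, h₂, L'.π_Y, hF, hG, L.π_Y, e, sub_self]
  -- `F₀` and `G₀` are linear lifts of the identity. Their defect has coefficients in `𝔪`, so by
  -- surjectivity of `δ` it is the defect of a pair `(F₁, G₁)` with coefficients in `𝔪`. Subtracting
  -- that pair gives a homomorphism that still reduces to the identity.
  obtain ⟨F₀, hF₀⟩ := L.exists_linear L' (LinearMap.id : V.obj v →ₗ[k] V.obj v)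
  obtain ⟨G₀, hG₀⟩ := L.exists_linear L' (LinearMap.id : V.obj v.succ →ₗ[k] V.obj v.succ)
  have hD := hmem (δ (F₀, G₀))
    (fun m => by
      change L'.π _ (L'.M.X v (F₀ m) - G₀ (L.M.X v m)) = 0
      rw [map_sub, L'.π_X, hF₀, hG₀, L.π_X]
      exact sub_self _)
    (fun m => by
      change L'.π _ (L'.M.Y v (F₀ m) - G₀ (L.M.Y v m)) = 0
      rw [map_sub, L'.π_Y, hF₀, hG₀, L.π_Y]
      exact sub_self _)
  rw [← hδ, LinearMap.range_eq_map, ← Submodule.map_smul''] at hD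
  obtain ⟨⟨F₁, G₁⟩, h₁, hδ₁⟩ := hD
  have hF₁ : ∀ m, L'.π v (F₁ m) = 0 := by
    exact (L.mem_smul_top_iff L').1 (Submodule.smul_top_le_comap_smul_top _
      (LinearMap.fst R.carrier (L.M.obj v →ₗ[R.carrier] L'.M.obj v)
        (L.M.obj v.succ →ₗ[R.carrier] L'.M.obj v.succ)) h₁)
  have hG₁ : ∀ m, L'.π v.succ (G₁ m) = 0 := by
    exact (L.mem_smul_top_iff L').1 (Submodule.smul_top_le_comap_smul_top _
      (LinearMap.snd R.carrier (L.M.obj v →ₗ[R.carrier] L'.M.obj v)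
        (L.M.obj v.succ →ₗ[R.carrier] L'.M.obj v.succ)) h₁)
  refine isIsomorphic_of_kron hV (F₀ - F₁) (G₀ - G₁) (fun m => ?_) (fun m => ?_)
    (fun m => ?_) fun m => ?_
  · have e := LinearMap.congr_fun (congrArg Prod.fst hδ₁) m
    change L'.M.X v (F₁ m) - G₁ (L.M.X v m) = L'.M.X v (F₀ m) - G₀ (L.M.X v m) at e
    rw [LinearMap.sub_apply, LinearMap.sub_apply, map_sub, sub_eq_sub_iff_sub_eq_sub,
      ← neg_sub (L'.M.X v (F₀ m)), ← e, neg_sub]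
  · have e := LinearMap.congr_fun (congrArg Prod.snd hδ₁) m
    change L'.M.Y v (F₁ m) - G₁ (L.M.Y v m) = L'.M.Y v (F₀ m) - G₀ (L.M.Y v m) at e
    rw [LinearMap.sub_apply, LinearMap.sub_apply, map_sub, sub_eq_sub_iff_sub_eq_sub,
      ← neg_sub (L'.M.Y v (F₀ m)), ← e, neg_sub]
  · rw [LinearMap.sub_apply, map_sub, hF₀, hF₁, sub_zero]; rfl
  · rw [LinearMap.sub_apply, map_sub, hG₀, hG₁, sub_zero]; rfl

/-! ### Construction of lifts -/

/-- The lift given by a family of projections. -/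
noncomputable def ofProjections (M : Rep R.carrier) (hM : M.IsFinite)
    (hM' : ∀ v, Module.Free R.carrier (M.obj v))
    (p : ∀ v, M.obj v →ₛₗ[R.aug.toRingHom] V.obj v) (hX : ∀ v m, p _ (M.X v m) = V.X v (p v m))
    (hY : ∀ v m, p _ (M.Y v m) = V.Y v (p v m)) (hs : ∀ v, Function.Surjective (p v))
    (hk : ∀ v m, p v m = 0 → M.unit R.aug.toRingHom v m = 0) : Lift V R where
  M := M
  finite := hM
  free := hM'
  φ := (extendLift p hX hY).toIso fun v => by
    refine ⟨(injective_iff_map_eq_zero (extendLiftApp (p v))).2 fun x hx => ?_, fun y => ?_⟩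
    · obtain ⟨m, rfl⟩ := M.unit_surjective R.aug.toRingHom
        (fun c => ⟨_, CHat.aug_algebraMap c⟩) v x
      rw [extendLiftApp_unit] at hx
      exact hk v m hx
    · obtain ⟨m, rfl⟩ := hs v y
      exact ⟨_, extendLiftApp_unit (p v) m⟩

theorem ofProjections_π (M : Rep R.carrier) (hM : M.IsFinite)
    (hM' : ∀ v, Module.Free R.carrier (M.obj v))
    (p : ∀ v, M.obj v →ₛₗ[R.aug.toRingHom] V.obj v) (hX : ∀ v m, p _ (M.X v m) = V.X v (p v m))
    (hY : ∀ v m, p _ (M.Y v m) = V.Y v (p v m)) (hs : ∀ v, Function.Surjective (p v))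
    (hk : ∀ v m, p v m = 0 → M.unit R.aug.toRingHom v m = 0) (v : Vertex) (m : M.obj v) :
    (ofProjections M hM hM' p hX hY hs hk).π v m = p v m :=
  extendLiftApp_unit (p v) m

end Lift

/-! ### Rigid modules -/

/-- The base field as a complete local algebra. -/
def CHat.base (k : Type u) [Field k] : CHat k :=
  haveI : IsAdicComplete (IsLocalRing.maximalIdeal k) k := by
    rw [IsLocalRing.maximalIdeal_eq_bot]
    infer_instance
  { carrier := k
    aug := AlgHom.id k k }

/-- The trivial lift over the base field. -/
noncomputable def Lift.base {V : Rep k} (hV : V.IsFinite) : Lift V (CHat.base k) :=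
  Lift.ofProjections (R := CHat.base k) (V : Rep k) hV
    (fun v => (inferInstance : Module.Free k (V.obj v)))
    (fun v => (LinearMap.id : V.obj v →ₗ[k] V.obj v)) (fun _ _ => rfl) (fun _ _ => rfl)
    (fun _ => Function.surjective_id) (fun v m h => by
      obtain rfl : m = 0 := h
      exact map_zero _)

theorem Lift.base_isUniversal {V : Rep k} (hV : V.IsFinite)
    (h : ∀ (R : CHat k) (L L' : Lift V R), L.IsIsomorphic L') :
    (Lift.base hV).IsUniversal := fun A => by
  refine ⟨fun θ θ' _ => CHat.Mor.ext fun (c : k) => ?_, fun D => ?_⟩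
  · exact (θ.hom.commutes c).trans (θ'.hom.commutes c).symm
  · obtain ⟨L, rfl⟩ := Quotient.exists_rep D
    exact ⟨⟨Algebra.ofId k A.carrier, AlgHom.ext fun c => CHat.aug_algebraMap (R := A) c⟩,
      Quotient.sound (h A _ L)⟩

/-- The maximal ideal of a versal ring is generated by the image of the zero ideal of `k`. -/
theorem versalDeformationRingIso_base {V : Rep k} (hV : V.IsFinite)
    (h : ∀ (R : CHat k) (L L' : Lift V R), L.IsIsomorphic L') : VersalDeformationRingIso V k := by
  have hU := Lift.base_isUniversal hV h
  refine ⟨⟨_, hU.isVersal⟩, fun R hR => ?_⟩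
  obtain ⟨θ, -, -, hm⟩ := hU.exists_of_isVersal hR
  have hbot : IsLocalRing.maximalIdeal (CHat.base k).carrier = ⊥ :=
    IsLocalRing.maximalIdeal_eq_bot (R := k)
  rw [hbot, Ideal.map_bot] at hm
  refine ⟨AlgEquiv.ofBijective R.aug ⟨(injective_iff_map_eq_zero _).2 fun r hr => ?_,
    fun c => ⟨_, CHat.aug_algebraMap c⟩⟩⟩
  have hr' := CHat.mem_maximalIdeal_iff.2 hr
  rw [hm] at hr'
  exact hr'

/-- Scalar endomorphisms and dimensions that differ by one make the defect map surjective, so any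
two lifts over the same ring are isomorphic. -/
theorem Rep.IsUneven.versalDeformationRingIso {V : Rep k} (hV : V.IsUneven) :
    VersalDeformationRingIso V k := by
  refine versalDeformationRingIso_base hV.1.1 fun R L L' => ?_
  obtain ⟨-, v, K, ⟨e⟩, -⟩ := id hV
  have h0 : ∀ w, w ≠ v → w ≠ v.succ → Subsingleton (V.obj w) := fun w h h' =>
    have := place.subsingleton (K := K) h h'
    (e.app w).injective.subsingleton
  let e' : Iso V (place v (V.kron v)) := isoPlace V v h0 (LinearEquiv.refl _ _)
    (LinearEquiv.refl _ _) (fun _ => rfl) fun _ => rfl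
  have : Module.Finite k (V.kron v).V := hV.1.1.1 v
  have : Module.Finite k (V.kron v).W := hV.1.1.1 v.succ
  refine L.isIsomorphic_of_rigid L' h0 (Kron.defect_surjective (hV.finrank e') fun p hp => ?_)
  have hx : ∀ a, p.2 (V.X v a) = V.X v (p.1 a) := fun a =>
    (sub_eq_zero.1 (LinearMap.congr_fun (congrArg Prod.fst hp) a)).symm
  have hy : ∀ a, p.2 (V.Y v a) = V.Y v (p.1 a) := fun a =>
    (sub_eq_zero.1 (LinearMap.congr_fun (congrArg Prod.snd hp) a)).symm
  obtain ⟨c, hc⟩ := (hV.of_iso e').endo_scalar (placeHom (K := V.kron v) (L := V.kron v)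
    p.1 p.2 hx hy)
  obtain ⟨h1, h2⟩ := Hom.app_eq_smul_iff.1 hc
  exact ⟨c, Prod.ext (LinearMap.ext h1) (LinearMap.ext h2)⟩

end Rigid


section Line

variable {k : Type u} [Field k]

/-! ### The power series ring -/

/-- The power series ring as a complete local algebra. -/
noncomputable def CHat.powerSeries (k : Type u) [Field k] : CHat k :=
  haveI : IsAdicComplete (IsLocalRing.maximalIdeal (PowerSeries k)) (PowerSeries k) := by
    rw [PowerSeries.maximalIdeal_eq_span_X]
    infer_instance
  { carrier := PowerSeries k
    aug := { PowerSeries.constantCoeff (R := k) with commutes' := fun _ => by simp } }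

namespace CHat

variable {A : CHat k}

/-- The variable of the power series ring. -/
noncomputable def var (k : Type u) [Field k] : (powerSeries k).carrier := (PowerSeries.X : PowerSeries k)

theorem maximalIdeal_powerSeries :
    IsLocalRing.maximalIdeal (powerSeries k).carrier = Ideal.span {var k} :=
  PowerSeries.maximalIdeal_eq_span_X

theorem aug_var : (powerSeries k).aug (var k) = 0 := PowerSeries.constantCoeff_X

theorem aeval_mem_pow {c : A.carrier} (hc : c ∈ IsLocalRing.maximalIdeal A.carrier) {n : ℕ}
    {p : Polynomial k} (hp : ∀ i < n, p.coeff i = 0) :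
    Polynomial.aeval c p ∈ IsLocalRing.maximalIdeal A.carrier ^ n := by
  obtain ⟨q, rfl⟩ := Polynomial.X_pow_dvd_iff.2 hp
  rw [map_mul, map_pow, Polynomial.aeval_X]
  exact Ideal.mul_mem_right _ _ (Ideal.pow_mem_pow hc n)

theorem mk_aeval_eq {c : A.carrier} (hc : c ∈ IsLocalRing.maximalIdeal A.carrier) {n : ℕ}
    {p q : Polynomial k} (hp : ∀ i < n, p.coeff i = q.coeff i) :
    Ideal.Quotient.mkₐ k (IsLocalRing.maximalIdeal A.carrier ^ n) (Polynomial.aeval c p) =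
      Ideal.Quotient.mkₐ k (IsLocalRing.maximalIdeal A.carrier ^ n) (Polynomial.aeval c q) := by
  refine Ideal.Quotient.eq.2 ?_
  rw [← map_sub]
  exact aeval_mem_pow hc fun i hi => by rw [Polynomial.coeff_sub, hp i hi, sub_self]

/-- The evaluation of power series modulo a power of the maximal ideal. -/
noncomputable def evalMod (c : A.carrier) (hc : c ∈ IsLocalRing.maximalIdeal A.carrier) (n : ℕ) :
    PowerSeries k →ₐ[k] A.carrier ⧸ IsLocalRing.maximalIdeal A.carrier ^ n :=
  AlgHom.ofLinearMap ((Ideal.Quotient.mkₐ k _).toLinearMap ∘ₗ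
    (Polynomial.aeval (R := k) c).toLinearMap ∘ₗ PowerSeries.trunc n)
    ((mk_aeval_eq hc (p := PowerSeries.trunc n (1 : PowerSeries k)) (q := 1) fun i hi => by
      rw [PowerSeries.coeff_trunc, if_pos hi, PowerSeries.coeff_one, Polynomial.coeff_one]).trans ((congrArg _ (map_one _)).trans (map_one _)))
    fun f g => (mk_aeval_eq hc (p := PowerSeries.trunc n (f * g))
      (q := PowerSeries.trunc n f * PowerSeries.trunc n g) fun i hi => by
      rw [PowerSeries.coeff_trunc, if_pos hi,
        PowerSeries.coeff_mul_eq_coeff_trunc_mul_trunc f g hi, ← Polynomial.coe_mul,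
        Polynomial.coeff_coe]).trans
      ((congrArg _ (map_mul _ _ _)).trans (map_mul _ _ _))

theorem factor_comp_evalMod (c : A.carrier) (hc : c ∈ IsLocalRing.maximalIdeal A.carrier)
    {m n : ℕ} (hmn : m ≤ n) : (Ideal.Quotient.factorₐ k (Ideal.pow_le_pow_right hmn)).comp
      (evalMod c hc n) = evalMod c hc m :=
  AlgHom.ext fun f => mk_aeval_eq hc (p := PowerSeries.trunc n f) (q := PowerSeries.trunc m f)
    fun i hi => by
      rw [PowerSeries.coeff_trunc, PowerSeries.coeff_trunc, if_pos hi, if_pos (hi.trans_le hmn)]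

/-- The evaluation of power series at an element of the maximal ideal. -/
noncomputable def eval (c : A.carrier) (hc : c ∈ IsLocalRing.maximalIdeal A.carrier) :
    PowerSeries k →ₐ[k] A.carrier :=
  IsAdicComplete.liftAlgHom (IsLocalRing.maximalIdeal A.carrier) (evalMod c hc)
    (factor_comp_evalMod c hc)

theorem eval_sub_mem (c : A.carrier) (hc : c ∈ IsLocalRing.maximalIdeal A.carrier) (n : ℕ)
    (f : PowerSeries k) : eval c hc f - Polynomial.aeval c (PowerSeries.trunc n f) ∈
      IsLocalRing.maximalIdeal A.carrier ^ n :=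
  Ideal.Quotient.eq.1 (IsAdicComplete.mk_liftAlgHom (IsLocalRing.maximalIdeal A.carrier)
    (evalMod c hc) (factor_comp_evalMod c hc) n f)

theorem eq_zero_of_forall_mem {r : A.carrier}
    (h : ∀ n, r ∈ IsLocalRing.maximalIdeal A.carrier ^ n) : r = 0 :=
  IsHausdorff.haus (inferInstance : IsHausdorff (IsLocalRing.maximalIdeal A.carrier) A.carrier) r
    fun n => by
      rw [SModEq.zero, smul_eq_mul, Ideal.mul_top]
      exact h n

theorem eval_var (c : A.carrier) (hc : c ∈ IsLocalRing.maximalIdeal A.carrier) :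
    eval c hc PowerSeries.X = c := by
  refine sub_eq_zero.1 (eq_zero_of_forall_mem fun n => ?_)
  rw [← sub_add_sub_cancel _ (Polynomial.aeval c (PowerSeries.trunc n (PowerSeries.X : PowerSeries k)))]
  refine add_mem (eval_sub_mem c hc n _) (Ideal.Quotient.eq.1 ((mk_aeval_eq hc
    (p := PowerSeries.trunc n (PowerSeries.X : PowerSeries k)) (q := Polynomial.X) fun i hi => ?_).trans (by rw [Polynomial.aeval_X]; rfl)))
  rw [PowerSeries.coeff_trunc, if_pos hi, PowerSeries.coeff_X, Polynomial.coeff_X]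
  simp only [eq_comm]

/-- The evaluation of power series as a morphism. -/
noncomputable def evalMor (c : A.carrier) (hc : c ∈ IsLocalRing.maximalIdeal A.carrier) :
    Mor (powerSeries k) A where
  hom := eval c hc
  comp_aug := AlgHom.ext fun (f : PowerSeries k) => by
    have h := eval_sub_mem c hc 1 f
    rw [pow_one, mem_maximalIdeal_iff, map_sub, PowerSeries.trunc_one_left, Polynomial.aeval_C,
      aug_algebraMap, sub_eq_zero] at h
    exact h.trans (PowerSeries.coeff_zero_eq_constantCoeff_apply f)

theorem evalMor_var (c : A.carrier) (hc : c ∈ IsLocalRing.maximalIdeal A.carrier) :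
    (evalMor c hc).hom (var k) = c := eval_var c hc

theorem Mor.hom_mem {R : CHat k} (θ : Mor R A) {r : R.carrier}
    (hr : r ∈ IsLocalRing.maximalIdeal R.carrier) :
    θ.hom r ∈ IsLocalRing.maximalIdeal A.carrier := by
  rw [mem_maximalIdeal_iff, θ.aug_hom]
  exact mem_maximalIdeal_iff.1 hr

/-- The two morphisms agree on polynomials. A power series is a polynomial up to a multiple of `Xⁿ`,
which both send into `𝔪ⁿ`, and `A` is separated. -/
theorem Mor.ext_var {θ θ' : Mor (powerSeries k) A} (h : θ.hom (var k) = θ'.hom (var k)) :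
    θ = θ' := by
  refine Mor.ext fun (f : PowerSeries k) => sub_eq_zero.1 (eq_zero_of_forall_mem fun n => ?_)
  have h1 : ∀ (φ ψ : PowerSeries k →ₐ[k] A.carrier) (_ : φ PowerSeries.X = ψ PowerSeries.X)
      (p : Polynomial k), φ p = ψ p := fun φ ψ h p => by
    have e : φ.comp (Polynomial.coeToPowerSeries.algHom (R := k) k) =
        ψ.comp (Polynomial.coeToPowerSeries.algHom (R := k) k) :=
      Polynomial.algHom_ext (by simpa [Polynomial.coeToPowerSeries.algHom_apply] using h)
    simpa [Polynomial.coeToPowerSeries.algHom_apply] using DFunLike.congr_fun e p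
  obtain ⟨g, hg⟩ : ∃ g : PowerSeries k,
      f = PowerSeries.X ^ n * g + (PowerSeries.trunc n f : PowerSeries k) :=
    ⟨_, PowerSeries.eq_X_pow_mul_shift_add_trunc n f⟩
  have h2 : θ.hom (PowerSeries.trunc n f : PowerSeries k) =
      θ'.hom (PowerSeries.trunc n f : PowerSeries k) := h1 θ.hom θ'.hom h _
  have h3 : ∀ θ : Mor (powerSeries k) A, θ.hom ((PowerSeries.X : PowerSeries k) ^ n * g) ∈
      IsLocalRing.maximalIdeal A.carrier ^ n := fun θ => by
    have e : θ.hom ((PowerSeries.X : PowerSeries k) ^ n * g) = θ.hom (var k) ^ n * θ.hom g :=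
      (map_mul θ.hom _ _).trans (congrArg (· * _) (map_pow θ.hom (var k) n))
    rw [e]
    exact Ideal.mul_mem_right _ _ (Ideal.pow_mem_pow (θ.hom_mem (mem_maximalIdeal_iff.2 aug_var)) n)
  have e : ∀ θ : Mor (powerSeries k) A, θ.hom f = θ.hom ((PowerSeries.X : PowerSeries k) ^ n * g) +
      θ.hom (PowerSeries.trunc n f : PowerSeries k) := fun θ =>
    (congrArg θ.hom hg).trans (map_add θ.hom _ _)
  have e' := e θ'
  rw [← h2] at e'
  rw [e θ, e', add_sub_add_right_eq_sub]
  exact sub_mem (h3 θ) (h3 θ')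

/-- A retraction onto the power series ring is bijective if the maximal ideal is generated by
the image of the variable. -/
theorem Mor.bijective_of_retraction {R : CHat k} (θ : Mor (powerSeries k) R)
    (η : Mor R (powerSeries k)) (h : ∀ r, η.hom (θ.hom r) = r)
    (hm : IsLocalRing.maximalIdeal R.carrier = Ideal.span {θ.hom (var k)}) :
    Function.Bijective η.hom := by
  refine ⟨(injective_iff_map_eq_zero _).2 fun s hs => ?_, fun r => ⟨_, h r⟩⟩
  by_contra h0
  have h1 : ∃ n, s ∉ IsLocalRing.maximalIdeal R.carrier ^ n := by
    by_contra! hcon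
    exact h0 (eq_zero_of_forall_mem hcon)
  -- Let `n` be the order of `s ≠ 0`. Then `s = θ(t)ⁿ a`, and `a` is a unit since otherwise the
  -- order would be larger. Hence `η s` is `tⁿ` times a unit and cannot vanish.
  obtain ⟨n, hn, hn'⟩ : ∃ n, s ∈ IsLocalRing.maximalIdeal R.carrier ^ n ∧
      s ∉ IsLocalRing.maximalIdeal R.carrier ^ (n + 1) := by
    by_contra! hcon
    obtain ⟨n, hn⟩ := h1
    exact hn (Nat.rec (by rw [pow_zero, Ideal.one_eq_top]; trivial) (fun n hn => hcon n hn) n)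
  rw [hm, Ideal.span_singleton_pow] at hn
  obtain ⟨a, rfl⟩ := Ideal.mem_span_singleton.1 hn
  have ha : IsUnit a := by
    by_contra hna
    refine hn' ?_
    rw [pow_succ]
    exact Ideal.mul_mem_mul (Ideal.pow_mem_pow (hm ▸ Ideal.mem_span_singleton_self _) n) hna
  rw [map_mul, map_pow, h] at hs
  have hs' := (ha.map η.hom).mul_left_eq_zero.1 hs
  exact (pow_ne_zero n (PowerSeries.X_ne_zero : (PowerSeries.X : PowerSeries k) ≠ 0)) hs'

end CHat

end Line


section LineLifts

variable {k : Type u} [Field k] {V : Rep k} {R A : CHat k} {v : Vertex}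

/-! ### Lifts of modules of dimension vector `(1, 1)` -/

/-- Isomorphisms from an extension of scalars, for modules that are concentrated at a vertex and
its successor. -/
theorem Lift.push_isIsomorphic_of_kron (hV : ∀ w, w ≠ v → w ≠ v.succ → Subsingleton (V.obj w))
    {θ : CHat.Mor R A} {U : Lift V R} {L : Lift V A}
    (f : U.M.obj v →ₛₗ[θ.hom.toRingHom] L.M.obj v)
    (g : U.M.obj v.succ →ₛₗ[θ.hom.toRingHom] L.M.obj v.succ)
    (hX : ∀ m, g (U.M.X v m) = L.M.X v (f m)) (hY : ∀ m, g (U.M.Y v m) = L.M.Y v (f m))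
    (hf : ∀ m, L.π v (f m) = U.π v m) (hg : ∀ m, L.π v.succ (g m) = U.π v.succ m) :
    (U.push θ).IsIsomorphic L := by
  have key : ∀ (w) (f : U.M.obj w →ₛₗ[θ.hom.toRingHom] L.M.obj w) (_ : ∀ m, L.π w (f m) = U.π w m)
      (m), L.π w (extendLiftApp f m) = (U.push θ).π w m := fun w f hf => by
    have e : (L.π w).comp (extendLiftApp f) = (U.push θ).π w := by
      refine LinearMap.ext_on_range (U.M.span_unit θ.hom.toRingHom w) fun m => ?_
      refine (congrArg (L.π w) (extendLiftApp_unit f m)).trans ?_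
      exact (hf m).trans ((overPush θ U).app_π w m).symm
    exact DFunLike.congr_fun e
  refine isIsomorphic_of_kron hV (extendLiftApp f) (extendLiftApp g)
    (DFunLike.congr_fun (Rep.extend_ext θ.hom.toRingHom (M := U.M) (g := extendLiftApp g ∘ₗ
      (U.M.extend θ.hom.toRingHom).X v) (h := L.M.X v ∘ₗ extendLiftApp f) fun m => ?_))
    (DFunLike.congr_fun (Rep.extend_ext θ.hom.toRingHom (M := U.M) (g := extendLiftApp g ∘ₗ
      (U.M.extend θ.hom.toRingHom).Y v) (h := L.M.Y v ∘ₗ extendLiftApp f) fun m => ?_))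
    (key _ f hf) (key _ g hg)
  · simp only [LinearMap.comp_apply]
    rw [U.M.unit_X, extendLiftApp_unit, extendLiftApp_unit, hX]
  · simp only [LinearMap.comp_apply]
    rw [U.M.unit_Y, extendLiftApp_unit, extendLiftApp_unit, hY]

/-- The Kronecker module of rank one on which the two maps are given by scalars. -/
def lineKron (R : Type u) [CommRing R] (s : Bool → R) : Kron R :=
  ⟨R, R, s true • LinearMap.id, s false • LinearMap.id⟩

/-- The two arrows that start at a vertex. -/
def Rep.act {R : Type u} [CommRing R] (M : Rep R) (v : Vertex) : Bool → M.obj v →ₗ[R] M.obj v.succ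
  | true => M.X v
  | false => M.Y v

/-! ### Coordinates and basis vectors in rank one -/

section Basis

variable {S : Type u} [CommRing S] {s : Bool → S}

/-- The coordinate at the first vertex. -/
def lineKron.fst (v : Vertex) (s : Bool → S) : (place v (lineKron S s)).obj v ≃ₗ[S] S :=
  place.fst v (lineKron S s)

/-- The coordinate at the second vertex. -/
def lineKron.snd (v : Vertex) (s : Bool → S) : (place v (lineKron S s)).obj v.succ ≃ₗ[S] S :=
  place.snd v (lineKron S s)

/-- The basis vector at the first vertex. -/
def lineKron.top (v : Vertex) (s : Bool → S) : (place v (lineKron S s)).obj v :=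
  (fst v s).symm 1

/-- The basis vector at the second vertex. -/
def lineKron.bot (v : Vertex) (s : Bool → S) : (place v (lineKron S s)).obj v.succ :=
  (snd v s).symm 1

theorem lineKron.smul_top (p : (place v (lineKron S s)).obj v) : fst v s p • top v s = p := by
  rw [top, ← map_smul, smul_eq_mul, mul_one, LinearEquiv.symm_apply_apply]

theorem lineKron.smul_bot (p : (place v (lineKron S s)).obj v.succ) :
    snd v s p • bot v s = p := by
  rw [bot, ← map_smul, smul_eq_mul, mul_one, LinearEquiv.symm_apply_apply]

theorem lineKron.snd_act (b : Bool) (p : (place v (lineKron S s)).obj v) :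
    snd v s ((place v (lineKron S s)).act v b p) = s b * fst v s p := by
  cases b
  · exact place.snd_Y p
  · exact place.snd_X p

theorem lineKron.act_top (b : Bool) :
    (place v (lineKron S s)).act v b (top v s) = s b • bot v s := by
  rw [← smul_bot ((place v (lineKron S s)).act v b (top v s)), snd_act, top,
    LinearEquiv.apply_symm_apply, mul_one]

end Basis

theorem Lift.π_act (L : Lift V R) (b : Bool) (m : L.M.obj v) :
    L.π v.succ (L.M.act v b m) = V.act v b (L.π v m) := by
  cases b
  · exact L.π_Y v m
  · exact L.π_X v m

theorem Lift.Over.app_act {θ : CHat.Mor R A} {L : Lift V R} {L' : Lift V A} (g : Over θ L L')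
    (b : Bool) (m : L.M.obj v) : g.app _ (L.M.act v b m) = L'.M.act v b (g.app v m) := by
  cases b
  · exact g.app_Y v m
  · exact g.app_X v m

variable {s₀ : Bool → k} (e : Iso (place v (lineKron k s₀)) V)

theorem Iso.app_act (b : Bool) (p : (place v (lineKron k s₀)).obj v) :
    e.app _ ((place v (lineKron k s₀)).act v b p) = V.act v b (e.app v p) := by
  cases b
  · exact e.app_Y v p
  · exact e.app_X v p

/-- The projection of a lift of rank one. -/
def lineProj (v : Vertex) (R : CHat k) (s : Bool → R.carrier) (s₀ : Bool → k) (w : Vertex) :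
    (place v (lineKron R.carrier s)).obj w →ₛₗ[R.aug.toRingHom] (place v (lineKron k s₀)).obj w where
  toFun p := (fun h => R.aug (p.1 h), fun h => R.aug (p.2 h))
  map_add' _ _ := Prod.ext (funext fun _ => map_add R.aug _ _) (funext fun _ => map_add R.aug _ _)
  map_smul' _ _ := Prod.ext (funext fun _ => map_mul R.aug _ _) (funext fun _ => map_mul R.aug _ _)

theorem lineKron.fst_lineProj {s : Bool → R.carrier}
    (p : (place v (lineKron R.carrier s)).obj v) :
    fst v s₀ (lineProj v R s s₀ v p) = R.aug (fst v s p) := rfl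

theorem lineKron.snd_lineProj {s : Bool → R.carrier}
    (p : (place v (lineKron R.carrier s)).obj v.succ) :
    snd v s₀ (lineProj v R s s₀ v.succ p) = R.aug (snd v s p) := rfl

/-- Lifts of rank one. -/
noncomputable def Lift.line (s : Bool → R.carrier) (hs : ∀ b, R.aug (s b) = s₀ b) : Lift V R :=
  Lift.ofProjections (place v (lineKron R.carrier s)) (by
      have : Module.Finite R.carrier (lineKron R.carrier s).V :=
        inferInstanceAs (Module.Finite R.carrier R.carrier)
      have : Module.Finite R.carrier (lineKron R.carrier s).W :=
        inferInstanceAs (Module.Finite R.carrier R.carrier)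
      exact place_isFinite v _)
    (fun w => (inferInstance : Module.Free R.carrier
      ((PLift (w = v) → R.carrier) × (PLift (w = v.succ) → R.carrier))))
    (fun w => (e.app w).toLinearMap.comp (lineProj v R s s₀ w))
    (fun w m => Eq.trans (congrArg (e.app _) (by
        cases w <;> exact Prod.ext (funext fun _ => map_zero R.aug) (funext fun _ =>
          (map_mul R.aug _ _).trans (congrArg (· * _) (hs true))))) (e.app_X w _))
    (fun w m => Eq.trans (congrArg (e.app _) (by
        cases w <;> exact Prod.ext (funext fun _ => map_zero R.aug) (funext fun _ =>
          (map_mul R.aug _ _).trans (congrArg (· * _) (hs false))))) (e.app_Y w _))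
    (fun w => (e.app w).surjective.comp fun
      (p : (PLift (w = v) → k) × (PLift (w = v.succ) → k)) =>
      ⟨(fun h => algebraMap k R.carrier (p.1 h), fun h => algebraMap k R.carrier (p.2 h)),
        Prod.ext (funext fun h => CHat.aug_algebraMap (p.1 h))
          (funext fun h => CHat.aug_algebraMap (p.2 h))⟩)
    (fun w m hm => by
      have hm' : lineProj v R s s₀ w m = 0 := (e.app w).map_eq_zero_iff.1 hm
      by_cases h : w = v
      · subst h
        have h1 : R.aug (lineKron.fst w s m) = 0 := by
          rw [← lineKron.fst_lineProj (s₀ := s₀), hm', map_zero]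
        rw [← lineKron.smul_top m, map_smulₛₗ]
        exact (congrArg (· • _) h1).trans (zero_smul _ _)
      · by_cases h' : w = v.succ
        · subst h'
          have h1 : R.aug (lineKron.snd v s m) = 0 := by
            rw [← lineKron.snd_lineProj (s₀ := s₀), hm', map_zero]
          rw [← lineKron.smul_bot m, map_smulₛₗ]
          exact (congrArg (· • _) h1).trans (zero_smul _ _)
        · rw [place.eq_zero h h' m, map_zero])

theorem Lift.line_π (s : Bool → R.carrier) (hs : ∀ b, R.aug (s b) = s₀ b) (w : Vertex)
    (m : (place v (lineKron R.carrier s)).obj w) :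
    (Lift.line e s hs).π w m = e.app w (lineProj v R s s₀ w m) :=
  Lift.ofProjections_π ..

theorem Lift.line_π_top (s : Bool → R.carrier) (hs : ∀ b, R.aug (s b) = s₀ b) :
    (Lift.line e s hs).π v (lineKron.top v s) = e.app v (lineKron.top v s₀) := by
  rw [line_π]
  refine congrArg (e.app v) ((lineKron.fst v s₀).injective ?_)
  rw [lineKron.fst_lineProj, lineKron.top, lineKron.top, LinearEquiv.apply_symm_apply,
    LinearEquiv.apply_symm_apply, map_one]

/-- The scalars `1` and `t`, in the order given by `b`. -/
def scalars {S : Type u} [CommRing S] (b : Bool) (t : S) (b' : Bool) : S := if b' = b then 1 else t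

theorem aug_scalars (b : Bool) {t : R.carrier} (ht : R.aug t = 0) (b' : Bool) :
    R.aug (scalars b t b') = scalars b 0 b' := by
  unfold scalars
  split_ifs
  · exact map_one _
  · exact ht

variable {b : Bool} (e : Iso (place v (lineKron k (scalars b 0))) V)

/-- The lift `1, t` of the module `1, 0` over the power series ring. -/
noncomputable def Lift.universalLine : Lift V (CHat.powerSeries k) :=
  Lift.line e (scalars b (CHat.var k)) (aug_scalars b CHat.aug_var)

theorem lineKron.subsingleton {e : Iso (place v (lineKron k s₀)) V} {w : Vertex} (h : w ≠ v)
    (h' : w ≠ v.succ) : Subsingleton (V.obj w) :=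
  have := place.subsingleton (K := lineKron k s₀) h h'
  (e.app w).symm.injective.subsingleton

namespace Lift

variable {L : Lift V A} {u : L.M.obj v}

/-- `u` lifts the basis vector of `V` at `v`, so it generates by Nakayama's lemma; in the same way
its image under the arrow `b` generates at `v.succ`. -/
theorem line_span_top (hu : L.π v u = e.app v (lineKron.top v (scalars b 0))) :
    Submodule.span A.carrier {u} = ⊤ := by
  refine L.eq_top_of_π _ fun y => ?_
  refine ⟨algebraMap k A.carrier (lineKron.fst v (scalars b 0) ((e.app v).symm y)) • u,
    Submodule.smul_mem _ _ (Submodule.mem_span_singleton_self u), ?_⟩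
  rw [L.π_smul, CHat.aug_algebraMap, hu, ← map_smul, lineKron.smul_top,
    LinearEquiv.apply_symm_apply]

theorem line_π_act (hu : L.π v u = e.app v (lineKron.top v (scalars b 0))) :
    L.π v.succ (L.M.act v b u) = e.app v.succ (lineKron.bot v (scalars b 0)) := by
  rw [L.π_act, hu, ← e.app_act, lineKron.act_top, scalars, if_pos rfl, one_smul]

theorem line_span_bot (hu : L.π v u = e.app v (lineKron.top v (scalars b 0))) :
    Submodule.span A.carrier {L.M.act v b u} = ⊤ := by
  refine L.eq_top_of_π _ fun y => ?_
  refine ⟨algebraMap k A.carrier (lineKron.snd v (scalars b 0) ((e.app v.succ).symm y)) •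
    L.M.act v b u, Submodule.smul_mem _ _ (Submodule.mem_span_singleton_self _), ?_⟩
  rw [L.π_smul, CHat.aug_algebraMap, line_π_act e hu, ← map_smul, lineKron.smul_bot,
    LinearEquiv.apply_symm_apply]

/-- A scalar is determined by its action on a generator of a nonzero free module. -/
theorem line_smul_bot_injective (hu : L.π v u = e.app v (lineKron.top v (scalars b 0)))
    {c d : A.carrier} (h : c • L.M.act v b u = d • L.M.act v b u) : c = d := by
  have := L.free v.succ
  have : Nontrivial (L.M.obj v.succ) := by
    refine ⟨L.M.act v b u, 0, fun h0 => ?_⟩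
    have h1 := line_π_act e hu
    rw [h0, map_zero, eq_comm, LinearEquiv.map_eq_zero_iff, lineKron.bot,
      LinearEquiv.map_eq_zero_iff] at h1
    exact one_ne_zero h1
  refine eq_of_smul_eq_smul (α := L.M.obj v.succ) fun m => ?_
  have hm : m ∈ Submodule.span A.carrier {L.M.act v b u} := by
    rw [line_span_bot e hu]; trivial
  obtain ⟨r, rfl⟩ := Submodule.mem_span_singleton.1 hm
  rw [smul_comm c, smul_comm d, h]

/-- The image of `u` under the arrow `b` generates, so the other arrow sends `u` to a multiple `c`
of it; `c` reduces to `0` because that arrow acts as zero on `V`. -/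
theorem line_exists_scalar (hu : L.π v u = e.app v (lineKron.top v (scalars b 0))) :
    ∃ c ∈ IsLocalRing.maximalIdeal A.carrier,
      ∀ b', L.M.act v b' u = scalars b c b' • L.M.act v b u := by
  have hm : L.M.act v (!b) u ∈ Submodule.span A.carrier {L.M.act v b u} := by
    rw [line_span_bot e hu]; trivial
  obtain ⟨c, hc⟩ := Submodule.mem_span_singleton.1 hm
  refine ⟨c, ?_, fun b' => ?_⟩
  · have h1 := congrArg (L.π v.succ) hc
    rw [L.π_smul, line_π_act e hu, L.π_act, hu, ← e.app_act, lineKron.act_top, scalars,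
      if_neg (Bool.not_ne_self b), zero_smul, ← map_smul] at h1
    have h2 := congrArg (lineKron.snd v (scalars b 0)) ((e.app v.succ).injective h1)
    rw [map_smul, map_zero, lineKron.bot, LinearEquiv.apply_symm_apply, smul_eq_mul, mul_one] at h2
    exact CHat.mem_maximalIdeal_iff.2 h2
  · unfold scalars
    split_ifs with h
    · rw [h, one_smul]
    · rw [hc, Bool.eq_not_of_ne h]

/-- The ratio `c` of the two arrows on a generator `u` is a complete invariant of a lift: it does
not depend on `u`, and a lift is the one given by the scalars `1` and `c`. Morphisms from `k⟦t⟧` to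
`A` are exactly the choices of `c` in the maximal ideal. -/
theorem universalLine_isUniversal : (universalLine e).IsUniversal := fun A => by
  refine ⟨fun θ θ' h => ?_, fun D => ?_⟩
  -- If a lift receives the universal one over `θ`, its ratio is `θ(t)`.
  · have key : ∀ (θ : CHat.Mor (CHat.powerSeries k) A) (L : Lift V A)
        (g : Over θ (universalLine e) L), ∃ u : L.M.obj v,
        L.π v u = e.app v (lineKron.top v (scalars b 0)) ∧
          L.M.act v (!b) u = θ.hom (CHat.var k) • L.M.act v b u := fun θ L g => by
      refine ⟨g.app v (lineKron.top v _), (g.app_π v _).trans (line_π_top ..), ?_⟩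
      have h : ∀ b', L.M.act v b' (g.app v (lineKron.top v _)) =
          θ.hom (scalars b (CHat.var k) b') • g.app v.succ (lineKron.bot v _) := fun b' =>
        (g.app_act b' _).symm.trans ((congrArg (g.app v.succ) (lineKron.act_top b')).trans
          (map_smulₛₗ (g.app v.succ) _ _))
      refine (h _).trans ?_
      refine Eq.trans ?_ (congrArg (θ.hom (CHat.var k) • ·) (h b).symm)
      simp [scalars]
    obtain ⟨u, hu, hu'⟩ := key θ _ (overPush θ _)
    obtain ⟨g⟩ := classify_eq_mk_iff.1 h.symm
    obtain ⟨w, hw, hw'⟩ := key θ' _ g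
    -- The two generators are proportional, so they have the same ratio.
    have hwu : w ∈ Submodule.span A.carrier {u} := by
      rw [line_span_top e hu]; trivial
    obtain ⟨r, rfl⟩ := Submodule.mem_span_singleton.1 hwu
    refine CHat.Mor.ext_var (line_smul_bot_injective e hw ?_)
    rw [← hw', map_smul, map_smul, hu', smul_comm]
  · obtain ⟨L, rfl⟩ := Quotient.exists_rep D
    obtain ⟨u, hu⟩ := L.π_surjective v (e.app v (lineKron.top v (scalars b 0)))
    obtain ⟨c, hc, hcu⟩ := line_exists_scalar e hu
    let s := scalars b (CHat.var k)
    let θ := CHat.evalMor c hc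
    have hθ : ∀ b', θ.hom (s b') = scalars b c b' := fun b' => by
      simp only [s, scalars]
      split_ifs
      · exact map_one _
      · exact CHat.evalMor_var c hc
    let f : (place v (lineKron _ s)).obj v →ₛₗ[θ.hom.toRingHom] L.M.obj v :=
      { toFun := fun p => θ.hom (lineKron.fst v s p) • u
        map_add' := fun p q => by rw [map_add, map_add, add_smul]
        map_smul' := fun r p => by
          rw [map_smul, smul_eq_mul, map_mul, mul_smul]; rfl }
    let g : (place v (lineKron _ s)).obj v.succ →ₛₗ[θ.hom.toRingHom] L.M.obj v.succ :=
      { toFun := fun p => θ.hom (lineKron.snd v s p) • L.M.act v b u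
        map_add' := fun p q => by rw [map_add, map_add, add_smul]
        map_smul' := fun r p => by
          rw [map_smul, smul_eq_mul, map_mul, mul_smul]; rfl }
    have hfg : ∀ b' p, g ((place v (lineKron _ s)).act v b' p) = L.M.act v b' (f p) :=
      fun b' p => by
        change θ.hom (lineKron.snd v s _) • _ = L.M.act v b' (θ.hom (lineKron.fst v s p) • u)
        rw [lineKron.snd_act, map_mul, map_smul, hcu b', hθ, mul_comm, mul_smul]
    refine ⟨θ, Quotient.sound (push_isIsomorphic_of_kron (U := universalLine e)
      (fun w h h' => lineKron.subsingleton (e := e) h h') f g (hfg true) (hfg false)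
      (fun m => ?_) fun m => ?_)⟩
    · refine Eq.trans ?_ (line_π e s _ v m).symm
      change L.π v (θ.hom (lineKron.fst v s m) • u) = _
      rw [L.π_smul, hu, θ.aug_hom, ← map_smul]
      exact congrArg (e.app v) (lineKron.smul_top (lineProj v _ s (scalars b 0) v m))
    · refine Eq.trans ?_ (line_π e s _ v.succ m).symm
      change L.π v.succ (θ.hom (lineKron.snd v s m) • L.M.act v b u) = _
      rw [L.π_smul, line_π_act e hu, θ.aug_hom, ← map_smul]
      exact congrArg (e.app v.succ) (lineKron.smul_bot (lineProj v _ s (scalars b 0) v.succ m))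

end Lift

theorem lineKron.versalDeformationRingIso (e : Iso (place v (lineKron k (scalars b 0))) V) :
    VersalDeformationRingIso V (PowerSeries k) := by
  have hU := Lift.universalLine_isUniversal e
  refine ⟨⟨_, hU.isVersal⟩, fun R hR => ?_⟩
  obtain ⟨θ, η, h, hm⟩ := hU.exists_of_isVersal hR
  rw [CHat.maximalIdeal_powerSeries, Ideal.map_span, Set.image_singleton] at hm
  exact ⟨AlgEquiv.ofBijective η.hom (θ.bijective_of_retraction η h hm)⟩

theorem Rep.IsArrowModule.versalDeformationRingIso (hV : V.IsArrowModule) :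
    VersalDeformationRingIso V (PowerSeries k) := by
  obtain ⟨v, K, hK, ⟨e⟩⟩ := hV.exists_iso
  obtain ⟨b, rfl⟩ : ∃ b, K = lineKron k (scalars b 0) := by
    rcases hK with rfl | rfl
    · exact ⟨true, by simp [arrowKron, lineKron, scalars]⟩
    · exact ⟨false, by simp [arrowKron, Kron.swap, lineKron, scalars]⟩
  exact lineKron.versalDeformationRingIso e.symm

end LineLifts

end KronRep

theorem theorem1p2 (k : Type u) [Field k] [IsAlgClosed k] (V : KronRep.Rep k)
    (hV : V.IsStringModule) :
    (Nonempty (KronRep.StableEnd V ≃ₐ[k] k) ↔ (V.InSimpleComponent ∨ V.IsArrowModule)) ∧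
    (V.InSimpleComponent → KronRep.VersalDeformationRingIso V k) ∧
    (V.IsArrowModule → KronRep.VersalDeformationRingIso V (PowerSeries k)) :=
  ⟨hV.stableEnd_iff, fun h => (KronRep.Rep.inSimpleComponent_iff.1 h).versalDeformationRingIso,
    fun h => h.versalDeformationRingIso⟩
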